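/- **Setting.** Let $f:\mathbb R^p\to\mathbb R$ and $g_\xi:\mathbb R^d\to\mathbb R^p$ be differentiable, $F=f\circ g$ and $F^*=\inf_x F(x)>-\infty$, where either $(\Sigma^1)$ $g=\frac1n\sum_{i=1}^n g_i$ with $n\ge1$, or $(\mathbb E^1)$ $g(x)=\mathbb E_\xi g_\xi(x)$ for a random variable $\xi$. There is no regularizer ($r\equiv0$). Assume that $f$ is $l_f$-Lipschitz, $\nabla f$ is $L_f$-Lipschitz, every $g_\xi$ is $l_g$-Lipschitz and every Jacobian $g_\xi'$ is $L_g$-Lipschitz (Jacobians are measured in the Frobenius norm). In case $(\mathbb E^1)$ assume also $\mathbb E_\xi\|g_\xi(x)-g(x)\|^2\le\sigma_g^2$ and $\mathbb E_\xi\|g'_\xi(x)-g'(x)\|^2\le\sigma_{g'}^2$ for all $x$, with $\sigma_g,\sigma_{g'}>0$. Let $S\subseteq\mathbb R^d$ and $v>0$ be such that $F(x)-F^*\le\frac v2\|\nabla F(x)\|^2$ for all $x\in S$; assume that almost surely all points $z_t$ produced by the algorithm below lie in $S$ (this is void if $S=\mathbb R^d$). Put $L_F=l_g^2L_f+l_fL_g$,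 $G_0=2(l_g^4L_f^2+l_f^2L_g^2)$, $\sigma_0^2=2(l_g^2L_f^2\sigma_g^2+l_f^2\sigma_{g'}^2)$. **Algorithm (MVRC-1, constant momentum).** Fix $\alpha\in(0,1]$, $0<\beta\le\big(4\sqrt{(1+1/\alpha)^2L_F^2+3G_0}+4(1+1/\alpha)L_F\big)^{-1}$, and $\lambda_t\in[\beta,(1+\alpha)\beta]$. Set $y_0=x_0$. For $t=0,\dots,T-1$: $z_t=(1-\alpha)y_t+\alpha x_t$; draw a batch $\mathcal A_t$; if $t\bmod\tau=0$, let $\tilde g_t=\frac1{|\mathcal A_t|}\sum_{\xi\in\mathcal A_t}g_\xi(z_t)$ and $\tilde g_t'=\frac1{|\mathcal A_t|}\sum_{\xi\in\mathcal A_t}g'_\xi(z_t)$; otherwise $\tilde g_t=\tilde g_{t-1}+\frac1{|\mathcal A_t|}\sum_{\xi\in\mathcal A_t}(g_\xi(z_t)-g_\xi(z_{t-1}))$ and likewise for $\tilde g_t'$; then $x_{t+1}=x_t-\lambda_t\,\tilde g_t'^{\top}\nabla f(\tilde g_t)$ and $y_{t+1}=z_t+\frac{\beta}{\lambda_t}(x_{t+1}-x_t)$.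 The output is $z_\zeta$ with $\zeta$ uniform on $\{0,\dots,T-1\}$. All batches and output indices are independent. For $(\Sigma^1)$, $\mathcal A_t$ is a uniformly random subset of $\{1,\dots,n\}$, $\tau=\lfloor\sqrt n\rfloor$, $|\mathcal A_t|=n$ if $t\bmod\tau=0$ and $|\mathcal A_t|=\lfloor\sqrt n\rfloor$ otherwise. For $(\mathbb E^1)$ with parameter $\epsilon>0$, $\epsilon^2\le2\sigma_0^2$, $\mathcal A_t$ consists of i.i.d. copies of $\xi$, $\tau=\lfloor\sqrt{2\sigma_0^2\epsilon^{-2}}\rfloor$, $|\mathcal A_t|=\lceil2\sigma_0^2\epsilon^{-2}\rceil$ if $t\bmod\tau=0$ and $|\mathcal A_t|=\lfloor\sqrt{2\sigma_0^2\epsilon^{-2}}\rfloor$ otherwise. **Theorem.** (1) There is an absolute constant $C$ such that for all $T\ge1$: $$(\Sigma^1):\quad \mathbb E F(z_\zeta)-F^*\le C\,\frac{v(\alpha^{-1}+1)}{T\beta}\big(F(x_0)-F^*\big),$$ $$(\mathbb E^1):\quad \mathbb E F(z_\zeta)-F^*\le C\,v(\alpha^{-1}+1)\Big(\epsilon^2+\frac{F(x_0)-F^*}{T\beta}\Big).$$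 (2) Restart the algorithm $M$ times, with $y_{0,m+1}=x_{0,m+1}$ the output $z_{\zeta_m,m}$ of the $m$-th run ($\zeta_m$ uniform on $\{0,\dots,T-1\}$), and let $w=z_{\zeta_M,M}$ be the final output. Count all evaluations of sample mappings $g_\xi$ and sample Jacobians $g'_\xi$. The constants $\kappa,K>0$ and $\theta\in(0,1]$ below depend only on $\alpha,\beta,l_f,L_f,l_g,L_g$, on an upper bound $\Delta$ of $F(x_0)-F^*$ and, for $(\mathbb E^1)$, on $\sigma_g,\sigma_{g'}$. For every $\epsilon\in(0,\frac12]$ there is an $M\le K\log\frac1\epsilon$, depending on $\epsilon$ and the same quantities only, such that: * For $(\Sigma^1)$ with $T=\max\{\lceil\kappa v\rceil,\tau\}$: $\mathbb E\|\nabla F(w)\|\le\epsilon$, $\mathbb EF(w)-F^*\le\epsilon^2$, and the number of evaluations is at most $K(n+\sqrt n\,v)\log\frac1\epsilon$. * For $(\mathbb E^1)$ with $\tau$ and $|\mathcal A_t|$ as above for the parameter $\theta\epsilon$ in place of $\epsilon$ (for which $\tau\ge1$), and $T=\max\{\lceil\kappa v\rceil,\tau\}$, provided that $F(x)>F^*$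 for some $x\in S$: $\mathbb E\|\nabla F(w)\|\le\epsilon$, $\mathbb EF(w)-F^*\le v\epsilon^2$, and the number of evaluations is at most $K\,v\,\epsilon^{-2}\log\frac1\epsilon$. -/

import Mathlib

open MeasureTheory ProbabilityTheory
open scoped BigOperators

namespace MVRC

noncomputable section

/-- The Euclidean space `ℝ^k`. -/
abbrev Vec (k : ℕ) : Type := EuclideanSpace ℝ (Fin k)

/-- The Frobenius norm of (the matrix of) a linear map `ℝ^d → ℝ^p`, the norm used for Jacobians. -/
def frobNorm {d p : ℕ} (A : Vec d →L[ℝ] Vec p) : ℝ :=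
  Real.sqrt (∑ i : Fin p, ∑ j : Fin d, (A (EuclideanSpace.single j (1 : ℝ)) i) ^ 2)

/-- `p` minimizes `y ↦ r y + ‖y - x‖² / (2 lam)`. -/
def IsProx {d : ℕ} (r : Vec d → ℝ) (lam : ℝ) (x p : Vec d) : Prop :=
  ∀ y, r p + ‖p - x‖ ^ 2 / (2 * lam) ≤ r y + ‖y - x‖ ^ 2 / (2 * lam)

open Classical in
/-- The proximal mapping `prox_{lam r}` (the unique minimizer when `r` is convex and `lam > 0`). -/
def prox {d : ℕ} (r : Vec d → ℝ) (lam : ℝ) (x : Vec d) : Vec d :=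
  if h : ∃ p, IsProx r lam x p then Classical.choose h else x

/-- The average `|A|⁻¹ ∑_{ξ ∈ A} h ξ` over a batch `A` of samples, counted with multiplicity. -/
def batchMean {Ξ V : Type*} [AddCommGroup V] [Module ℝ V] (A : Multiset Ξ) (h : Ξ → V) : V :=
  ((Multiset.card A : ℝ))⁻¹ • (A.map h).sum

/-- The input parameters of the algorithm. -/
structure Params where
  /-- length of an epoch -/
  tau : ℕ
  /-- momentum parameters -/
  al : ℕ → ℝ
  /-- step sizes of the `y`-update -/
  be : ℕ → ℝ
  /-- step sizes of the `x`-update -/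
  lam : ℕ → ℝ

/-- The memory of the algorithm before iteration `t`: `x_t`, `y_t`, the previous query point
`z_{t-1}`, the estimates of `g` and `g'` made at iteration `t-1`, and the number of evaluations of
sample mappings `g_ξ` and sample Jacobians `g_ξ'` made so far. -/
structure State (d p : ℕ) where
  x : Vec d
  y : Vec d
  z : Vec d
  gEst : Vec p
  jEst : Vec d →L[ℝ] Vec p
  evals : ℕ

section Algorithm

variable {d p : ℕ} {Ξ : Type*}

/-- The state before iteration `0`: `x_0 = y_0`; the other entries are placeholders that iteration
`0` overwrites without reading them. -/
def initState (x0 : Vec d) : State d p :=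
  { x := x0, y := x0, z := x0, gEst := 0, jEst := 0, evals := 0 }

/-- Iteration `t` of the algorithm, with batch `A`. At a refresh (`t mod τ = 0`) every sample costs
one evaluation of `g_ξ` and one of `g_ξ'`; otherwise it costs two of each (at `z_t` and at
`z_{t-1}`). -/
def step (P : Params) (f : Vec p → ℝ) (r : Vec d → ℝ) (G : Ξ → Vec d → Vec p)
    (A : Multiset Ξ) (t : ℕ) (s : State d p) : State d p :=
  let z : Vec d := (1 - P.al (t + 1)) • s.y + P.al (t + 1) • s.x
  let ge : Vec p :=
    if t % P.tau = 0 then batchMean A (fun ξ => G ξ z)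
    else s.gEst + batchMean A (fun ξ => G ξ z - G ξ s.z)
  let je : Vec d →L[ℝ] Vec p :=
    if t % P.tau = 0 then batchMean A (fun ξ => fderiv ℝ (G ξ) z)
    else s.jEst + batchMean A (fun ξ => fderiv ℝ (G ξ) z - fderiv ℝ (G ξ) s.z)
  let grad : Vec d := ContinuousLinearMap.adjoint je (gradient f ge)
  let x' : Vec d := prox r (P.lam t) (s.x - P.lam t • grad)
  { x := x'
    y := z + (P.be t / P.lam t) • (x' - s.x)
    z := z
    gEst := ge
    jEst := je
    evals := s.evals + (if t % P.tau = 0 then 2 else 4) * Multiset.card A }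

/-- The state after iterations `0, …, t - 1`, with batches `A 0, A 1, …` and initial point `x0`. -/
def run (P : Params) (f : Vec p → ℝ) (r : Vec d → ℝ) (G : Ξ → Vec d → Vec p)
    (x0 : Vec d) (A : ℕ → Multiset Ξ) : ℕ → State d p
  | 0 => initState x0
  | t + 1 => step P f r G (A t) t (run P f r G x0 A t)

/-- The point `z_t`. -/
def zPoint (P : Params) (f : Vec p → ℝ) (r : Vec d → ℝ) (G : Ξ → Vec d → Vec p)
    (x0 : Vec d) (A : ℕ → Multiset Ξ) (t : ℕ) : Vec d :=
  (run P f r G x0 A (t + 1)).z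

/-- The restarted algorithm: run `m` uses the batches `A m 0, A m 1, …` and its output is its point
`z_t` with `t = ζ m`, from which the next run starts. `restartPoint … m` is the output of the `m`-th
run, i.e. the starting point of the `(m+1)`-st one. -/
def restartPoint (P : Params) (f : Vec p → ℝ) (r : Vec d → ℝ) (G : Ξ → Vec d → Vec p)
    (x0 : Vec d) (A : ℕ → ℕ → Multiset Ξ) (ζ : ℕ → ℕ) : ℕ → Vec d
  | 0 => x0
  | m + 1 => zPoint P f r G (restartPoint P f r G x0 A ζ m) (A m) (ζ m)

/-- Total number of evaluations of sample mappings and sample Jacobians in `M` runs of `T`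
iterations each. -/
def restartEvals (P : Params) (f : Vec p → ℝ) (r : Vec d → ℝ) (G : Ξ → Vec d → Vec p)
    (x0 : Vec d) (A : ℕ → ℕ → Multiset Ξ) (ζ : ℕ → ℕ) (T M : ℕ) : ℕ :=
  ∑ m ∈ Finset.range M, (run P f r G (restartPoint P f r G x0 A ζ m) (A m) T).evals

end Algorithm

section Assumptions

variable {d p : ℕ} {Ξ : Type*}

/-- Smoothness of the outer function `f` and of the sample mappings `G ξ`: both are differentiable
and Lipschitz, with Lipschitz gradient and Lipschitz Jacobians. -/
structure IsSmooth (f : Vec p → ℝ) (G : Ξ → Vec d → Vec p) (lf Lf lg Lg : ℝ) : Prop where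
  diff_f : Differentiable ℝ f
  lip_f : ∀ u w, |f u - f w| ≤ lf * ‖u - w‖
  lip_grad_f : ∀ u w, ‖gradient f u - gradient f w‖ ≤ Lf * ‖u - w‖
  diff_g : ∀ ξ, Differentiable ℝ (G ξ)
  lip_g : ∀ ξ x y, ‖G ξ x - G ξ y‖ ≤ lg * ‖x - y‖
  lip_jac_g : ∀ ξ x y, frobNorm (fderiv ℝ (G ξ) x - fderiv ℝ (G ξ) y) ≤ Lg * ‖x - y‖

/-- `F* = inf F`. -/
def infVal (F : Vec d → ℝ) : ℝ := ⨅ x, F x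

/-- `F* > -∞`, and `F x - F* ≤ (v / 2) ‖∇F x‖²` for all `x` in `S`, with `v > 0`. The usual global
condition is the case `S = Set.univ`. (On all of `ℝ^d`, a nonconstant Lipschitz `F` with Lipschitz
gradient cannot satisfy it.) -/
structure GradDominantOn (F : Vec d → ℝ) (S : Set (Vec d)) (v : ℝ) : Prop where
  pos : 0 < v
  bddBelow : BddBelow (Set.range F)
  dom : ∀ x ∈ S, F x - infVal F ≤ v / 2 * ‖gradient F x‖ ^ 2

/-- The objective of the finite-sum problem (without regularizer). -/
def finObj {n : ℕ} (f : Vec p → ℝ) (G : Fin n → Vec d → Vec p) (x : Vec d) : ℝ :=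
  f ((n : ℝ)⁻¹ • ∑ i, G i x)

/-- The mapping `g = 𝔼 g_ξ`, where `ξ` has distribution `D`. -/
def meanMap [MeasurableSpace Ξ] (D : Measure Ξ) (G : Ξ → Vec d → Vec p) (x : Vec d) : Vec p :=
  ∫ ξ, G ξ x ∂D

/-- The objective of the online problem (without regularizer). -/
def onlObj [MeasurableSpace Ξ] (D : Measure Ξ) (f : Vec p → ℝ) (G : Ξ → Vec d → Vec p)
    (x : Vec d) : ℝ :=
  f (meanMap D G x)

/-- The online problem is well posed and its sample mappings and sample Jacobians have variances
bounded by `sg²` and `sg'²`. -/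
structure BoundedVariance [MeasurableSpace Ξ] (D : Measure Ξ) (G : Ξ → Vec d → Vec p)
    (sg sg' : ℝ) : Prop where
  meas : ∀ x, Measurable (fun ξ => G ξ x)
  integrable : ∀ x, Integrable (fun ξ => G ξ x) D
  integrable_var : ∀ x, Integrable (fun ξ => ‖G ξ x - meanMap D G x‖ ^ 2) D
  var : ∀ x, ∫ ξ, ‖G ξ x - meanMap D G x‖ ^ 2 ∂D ≤ sg ^ 2
  integrable_jac_var : ∀ x,
    Integrable (fun ξ => frobNorm (fderiv ℝ (G ξ) x - fderiv ℝ (meanMap D G) x) ^ 2) D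
  jac_var : ∀ x, ∫ ξ, frobNorm (fderiv ℝ (G ξ) x - fderiv ℝ (meanMap D G) x) ^ 2 ∂D ≤ sg' ^ 2

end Assumptions

/-- `L_F = l_g² L_f + l_f L_g`. -/
def LF (lf Lf lg Lg : ℝ) : ℝ := lg ^ 2 * Lf + lf * Lg

/-- `G₀ = 2 (l_g⁴ L_f² + l_f² L_g²)`. -/
def G0 (lf Lf lg Lg : ℝ) : ℝ := 2 * (lg ^ 4 * Lf ^ 2 + lf ^ 2 * Lg ^ 2)

/-- `σ₀² = 2 (l_g² L_f² σ_g² + l_f² σ_{g'}²)`. -/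
def sigmaSq (lf Lf lg sg sg' : ℝ) : ℝ := 2 * (lg ^ 2 * Lf ^ 2 * sg ^ 2 + lf ^ 2 * sg' ^ 2)

/-- The constant momentum `α ∈ (0, 1]` and the step size `β`, where
`0 < β ≤ (4 √((1 + 1/α)² L_F² + 3 G₀) + 4 (1 + 1/α) L_F)⁻¹` is written without division, so that it
reads `0 < β < ∞` if `L_F = G₀ = 0`. -/
structure StepCond (α β lf Lf lg Lg : ℝ) : Prop where
  al_pos : 0 < α
  al_le : α ≤ 1
  be_pos : 0 < β
  be_le : β * (4 * Real.sqrt ((1 + 1 / α) ^ 2 * LF lf Lf lg Lg ^ 2 + 3 * G0 lf Lf lg Lg)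
    + 4 * (1 + 1 / α) * LF lf Lf lg Lg) ≤ 1

/-- Parameters with constant momentum `α` and constant `β_t = β`. -/
def constParams (tau : ℕ) (α β : ℝ) (lam : ℕ → ℝ) : Params :=
  { tau := tau, al := fun _ => α, be := fun _ => β, lam := lam }

/-- Epoch length for the finite-sum problem: `⌊√n⌋`. -/
def finTau (n : ℕ) : ℕ := ⌊Real.sqrt n⌋₊

/-- Batch sizes for the finite-sum problem: `n` if `t mod τ = 0` and `⌊√n⌋` otherwise. -/
def finBatch (n t : ℕ) : ℕ := if t % finTau n = 0 then n else ⌊Real.sqrt n⌋₊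

/-- Epoch length for the online problem: `⌊√(2 σ₀² ε⁻²)⌋`, where `s` stands for `σ₀²`. -/
def onlTau (s ε : ℝ) : ℕ := ⌊Real.sqrt (2 * s / ε ^ 2)⌋₊

/-- Batch sizes for the online problem: `⌈2 σ₀² ε⁻²⌉` if `t mod τ = 0` and `⌊√(2 σ₀² ε⁻²)⌋`
otherwise. -/
def onlBatch (s ε : ℝ) (t : ℕ) : ℕ :=
  if t % onlTau s ε = 0 then ⌈2 * s / ε ^ 2⌉₊ else ⌊Real.sqrt (2 * s / ε ^ 2)⌋₊

/-- The randomness for the finite-sum problem, for runs of `T` iterations indexed by `R`: all the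
index sets `A ρ t` and the output indices `ζ ρ` are mutually independent; `A ρ t` is a uniformly
random subset of the `n` indices with `b t` elements, and `ζ ρ` is uniform on `{0, …, T - 1}`. -/
structure FinSampling {Ω R : Type*} [MeasurableSpace Ω] (μ : Measure Ω) {n T : ℕ} (b : ℕ → ℕ)
    (A : R → ℕ → Ω → Finset (Fin n)) (ζ : R → Ω → Fin T) : Prop where
  meas_A : ∀ ρ t, Measurable (A ρ t)
  card_A : ∀ ρ t ω, (A ρ t ω).card = b t
  unif_A : ∀ ρ t (S : Finset (Fin n)), S.card = b t →
    μ {ω | A ρ t ω = S} = ((n.choose (b t) : ℕ) : ENNReal)⁻¹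
  meas_ζ : ∀ ρ, Measurable (ζ ρ)
  unif_ζ : ∀ ρ (t : Fin T), μ {ω | ζ ρ ω = t} = ((T : ℕ) : ENNReal)⁻¹
  indep_A : iIndepFun (fun q : R × ℕ => A q.1 q.2) μ
  indep_ζ : iIndepFun ζ μ
  indep : IndepFun (fun ω (q : R × ℕ) => A q.1 q.2 ω) (fun ω ρ => ζ ρ ω) μ

/-- The randomness for the online problem, for runs of `T` iterations indexed by `R`: all the
samples `ξ ρ t i` and the output indices `ζ ρ` are mutually independent; the samples have
distribution `D`, and `ζ ρ` is uniform on `{0, …, T - 1}`. -/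
structure OnlSampling {Ω R Ξ : Type*} [MeasurableSpace Ω] [MeasurableSpace Ξ] (μ : Measure Ω)
    (D : Measure Ξ) {T : ℕ} (ξ : R → ℕ → ℕ → Ω → Ξ) (ζ : R → Ω → Fin T) : Prop where
  meas_ξ : ∀ ρ t i, Measurable (ξ ρ t i)
  law_ξ : ∀ ρ t i, μ.map (ξ ρ t i) = D
  meas_ζ : ∀ ρ, Measurable (ζ ρ)
  unif_ζ : ∀ ρ (t : Fin T), μ {ω | ζ ρ ω = t} = ((T : ℕ) : ENNReal)⁻¹
  indep_ξ : iIndepFun (fun q : R × ℕ × ℕ => ξ q.1 q.2.1 q.2.2) μ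
  indep_ζ : iIndepFun ζ μ
  indep : IndepFun (fun ω (q : R × ℕ × ℕ) => ξ q.1 q.2.1 q.2.2 ω) (fun ω ρ => ζ ρ ω) μ

/-- The batch consisting of the first `k` samples of the sequence `ξ`. -/
def sampleBatch {Ξ : Type*} (k : ℕ) (ξ : ℕ → Ξ) : Multiset Ξ := (Multiset.range k).map ξ

end

end MVRC

/-! A pathwise descent inequality is combined with a variance bound for the recursive estimators.
Write `D t` for the search direction, i.e. the estimate of `∇F (z t)`.

Descent. The gap `x - y` shrinks by the factor `1 - α` and receives a push of norm at most `α β ‖D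
t‖`, so convexity of the square gives `∑ ‖x t - y t‖² ≤ β² ∑ ‖D t‖²` without any loss in `α`
(`IsMomentumSeq.sum_gap_le`). Hence `∑ ‖z (t+1) - z t‖² ≤ 4 β² ∑ ‖D t‖²`. Smoothness of `F` and the
bound on `β` then leave a spare term `(β/8) ∑ ‖D t‖²` on the left of `IsMomentumSeq.descent`.

Variance. Given the past, each batch inside an epoch adds centred noise to the estimators of `g` and
`g'`, so squared errors add up. A batch of size `τ` contributes at most `(G₀/τ) ‖z (t+1) - z t‖²` to
the squared gradient error, and this contribution survives for fewer than `τ` iterations. The total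
error is thus at most `T V + G₀ ∑ ‖z (t+1) - z t‖²` in expectation, where `V` is the error at a
refresh (`0` for finite sums, at most `ε²/2` online). Its second part is at most `(1/8) ∑ 𝔼‖D t‖²`
and is absorbed by the spare term (`IsModel.sum_lintegral_sq_gradient_le`).

Output and restarts. A uniform independent index turns the sum into `𝔼‖∇F w‖² ≤ (2/(T β)) (𝔼 F x₀ -
F*) + 2 V`, and gradient dominance bounds the gap of `w` by `v/2` times this
(`IsModel.outputBound`). This is part (1). If `T ≥ 2 v/β`, a run halves the gap up to `v V`, so
logarithmically many runs suffice for part (2). The cost of a run is of order `τ T` plus one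
refresh. For the online problem a nonconstant `F` forces `v ≥ 8 β`, which lets all terms be measured
in units of `v`. -/

namespace MVRC

/-! ### Deterministic facts -/

/-- The point `x` itself makes the quadratic term vanish, so any chosen minimizer is at distance
zero. Without a regularizer the update of `x` is therefore a plain gradient step. -/
theorem prox_zero_fun {d : ℕ} {lam : ℝ} (hlam : 0 < lam) (x : Vec d) :
    prox (fun _ => 0) lam x = x := by
  have h : ∃ p, IsProx (fun _ : Vec d => (0 : ℝ)) lam x p :=
    ⟨x, fun y => by
      have : 0 ≤ ‖y - x‖ ^ 2 / (2 * lam) := by positivity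
      simpa using this⟩
  rw [prox, dif_pos h]
  have h1 := Classical.choose_spec h x
  simp only [sub_self, norm_zero, zero_add] at h1
  have h2 : ‖Classical.choose h - x‖ ^ 2 ≤ 0 := by
    have h3 : ‖Classical.choose h - x‖ ^ 2 / (2 * lam) ≤ 0 := by simpa using h1
    by_contra hc
    have : 0 < ‖Classical.choose h - x‖ ^ 2 / (2 * lam) := by
      apply div_pos (not_le.1 hc); positivity
    linarith
  have h4 : ‖Classical.choose h - x‖ = 0 := by
    have := sq_nonneg ‖Classical.choose h - x‖
    exact pow_eq_zero_iff (two_ne_zero) |>.1 (le_antisymm h2 this)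
  exact sub_eq_zero.1 (norm_eq_zero.1 h4)

/-! ### Descent of the momentum recursion with inexact search directions. -/

section Descent

variable {E : Type*} [NormedAddCommGroup E] [InnerProductSpace ℝ E]

/-- A quadratic upper bound for a function with Lipschitz gradient. -/
theorem le_add_inner_add_sq [CompleteSpace E] {F : E → ℝ} {L : ℝ} (hF : Differentiable ℝ F)
    (hL : ∀ x y, ‖gradient F x - gradient F y‖ ≤ L * ‖x - y‖) (x y : E) :
    F y ≤ F x + inner ℝ (gradient F x) (y - x) + L * ‖y - x‖ ^ 2 := by
  have hL0 : 0 ≤ L * ‖y - x‖ := (norm_nonneg _).trans (hL y x)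
  -- The mean value inequality for `F` minus its linearization at `x` gives the coefficient `L`
  -- rather than `L / 2`; the step size condition has room for this.
  have key := (convex_segment (𝕜 := ℝ) x y).norm_image_sub_le_of_norm_hasFDerivWithin_le'
    (f := F) (f' := fun u => InnerProductSpace.toDual ℝ E (gradient F u))
    (φ := InnerProductSpace.toDual ℝ E (gradient F x)) (C := L * ‖y - x‖)
    (fun u _ => ((hF u).hasGradientAt.hasFDerivAt).hasFDerivWithinAt)
    (fun u hu => by
      rw [← map_sub, LinearIsometryEquiv.norm_map]
      refine (hL u x).trans ?_
      by_cases hxy : y = x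
      · subst hxy
        simp at hu
        simp [hu]
      · have hpos : 0 < ‖y - x‖ := norm_pos_iff.2 (sub_ne_zero.2 hxy)
        have hLn : 0 ≤ L := by
          by_contra hc
          have := mul_neg_of_neg_of_pos (not_le.1 hc) hpos
          linarith
        refine mul_le_mul_of_nonneg_left ?_ hLn
        have hu' := hu
        rw [segment_eq_image'] at hu'
        obtain ⟨θ, ⟨h0, h1⟩, rfl⟩ := hu'
        rw [add_sub_cancel_left, norm_smul, Real.norm_of_nonneg h0]
        exact mul_le_of_le_one_left (norm_nonneg _) h1)
    (left_mem_segment ℝ x y) (right_mem_segment ℝ x y)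
  rw [InnerProductSpace.toDual_apply_apply] at key
  have := (abs_le.1 (Real.norm_eq_abs _ ▸ key)).2
  nlinarith [this]

/-- The squared gradient is controlled by the optimality gap. -/
theorem sq_norm_gradient_le [CompleteSpace E] {F : E → ℝ} {L β m : ℝ} (hF : Differentiable ℝ F)
    (hL : ∀ x y, ‖gradient F x - gradient F y‖ ≤ L * ‖x - y‖) (hβ : 0 < β) (hβL : 16 * β * L ≤ 1)
    (hm : ∀ x, m ≤ F x) (x : E) : 4 * β * ‖gradient F x‖ ^ 2 ≤ F x - m := by
  -- A gradient step of size `8 β` gains `8 β ‖∇F‖²` to first order and loses at most half of it,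
  -- because `16 β L ≤ 1`.
  have h := le_add_inner_add_sq hF hL x (x - (8 * β) • gradient F x)
  have h1 := hm (x - (8 * β) • gradient F x)
  rw [sub_sub_cancel_left, inner_neg_right, inner_smul_right, real_inner_self_eq_norm_sq, norm_neg,
    norm_smul, Real.norm_of_nonneg (by positivity)] at h
  have h2 : L * (8 * β * ‖gradient F x‖) ^ 2 = (16 * β * L) * (4 * β * ‖gradient F x‖ ^ 2) := by
    ring
  have h3 : (16 * β * L) * (4 * β * ‖gradient F x‖ ^ 2) ≤ 1 * (4 * β * ‖gradient F x‖ ^ 2) :=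
    mul_le_mul_of_nonneg_right hβL (by positivity)
  nlinarith

/-- The recursion of the momentum scheme with search directions `D t`. -/
structure IsMomentumSeq (α β : ℝ) (lam : ℕ → ℝ) (x y z D : ℕ → E) : Prop where
  init : y 0 = x 0
  z_eq : ∀ t, z t = (1 - α) • y t + α • x t
  x_succ : ∀ t, x (t + 1) = x t - lam t • D t
  y_succ : ∀ t, y (t + 1) = z t - β • D t

variable {α β : ℝ} {lam : ℕ → ℝ} {x y z D : ℕ → E}

/-- The new gap is `(1 - α)` times the old one minus `(lam t - β) • D t`, and `0 ≤ lam t - β ≤ α β`.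
Its norm is thus a convex combination of `‖x t - y t‖` and `β ‖D t‖`; squaring by convexity makes
the sum telescope. -/
theorem IsMomentumSeq.sum_gap_le (h : IsMomentumSeq α β lam x y z D) (hα : 0 < α) (hα1 : α ≤ 1)
    (hlam : ∀ t, β ≤ lam t ∧ lam t ≤ (1 + α) * β) (T : ℕ) :
    ‖x T - y T‖ ^ 2 + α * ∑ t ∈ Finset.range T, ‖x t - y t‖ ^ 2 ≤
      α * β ^ 2 * ∑ t ∈ Finset.range T, ‖D t‖ ^ 2 := by
  induction T with
  | zero => simp [h.init]
  | succ T ih =>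
    rw [Finset.sum_range_succ, Finset.sum_range_succ]
    have e : x (T + 1) - y (T + 1) = (1 - α) • (x T - y T) - (lam T - β) • D T := by
      rw [h.x_succ, h.y_succ, h.z_eq]; module
    have hn : ‖x (T + 1) - y (T + 1)‖ ≤ (1 - α) * ‖x T - y T‖ + α * (β * ‖D T‖) := by
      rw [e]
      refine (norm_sub_le _ _).trans ?_
      rw [norm_smul, norm_smul, Real.norm_of_nonneg (by linarith),
        Real.norm_of_nonneg (by linarith [(hlam T).1])]
      have := mul_le_mul_of_nonneg_right (show lam T - β ≤ α * β by linarith [(hlam T).2])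
        (norm_nonneg (D T))
      linarith
    have hsq : ‖x (T + 1) - y (T + 1)‖ ^ 2 ≤
        (1 - α) * ‖x T - y T‖ ^ 2 + α * (β * ‖D T‖) ^ 2 := by
      have h0 := pow_le_pow_left₀ (norm_nonneg _) hn 2
      have h1 : 0 ≤ (1 - α) * α * (‖x T - y T‖ - β * ‖D T‖) ^ 2 :=
        mul_nonneg (mul_nonneg (by linarith) hα.le) (sq_nonneg _)
      nlinarith
    nlinarith

theorem IsMomentumSeq.sum_sq_dist_le (h : IsMomentumSeq α β lam x y z D) (hα : 0 < α) (hα1 : α ≤ 1)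
    (hlam : ∀ t, β ≤ lam t ∧ lam t ≤ (1 + α) * β) (T : ℕ) :
    ∑ t ∈ Finset.range (T + 1), ‖x t - y t‖ ^ 2 ≤
      β ^ 2 * ∑ t ∈ Finset.range T, ‖D t‖ ^ 2 := by
  have h1 := h.sum_gap_le hα hα1 hlam T
  rw [Finset.sum_range_succ]
  have h2 : α * ‖x T - y T‖ ^ 2 ≤ ‖x T - y T‖ ^ 2 := mul_le_of_le_one_left (sq_nonneg _) hα1
  refine le_of_mul_le_mul_left (a := α) ?_ hα
  nlinarith

/-- Since `z (t+1) - z t = α • (x (t+1) - y (t+1)) - β • D t`, the movement of the query points is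
paid half by the gaps and half by the directions. -/
theorem IsMomentumSeq.sum_sq_step_le (h : IsMomentumSeq α β lam x y z D) (hα : 0 < α) (hα1 : α ≤ 1)
    (hlam : ∀ t, β ≤ lam t ∧ lam t ≤ (1 + α) * β) (T : ℕ) :
    ∑ t ∈ Finset.range T, ‖z (t + 1) - z t‖ ^ 2 ≤
      4 * β ^ 2 * ∑ t ∈ Finset.range T, ‖D t‖ ^ 2 := by
  have h1 := h.sum_sq_dist_le hα hα1 hlam T
  rw [Finset.sum_range_succ'] at h1
  have hstep : ∀ t, ‖z (t + 1) - z t‖ ^ 2 ≤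
      2 * ‖x (t + 1) - y (t + 1)‖ ^ 2 + 2 * β ^ 2 * ‖D t‖ ^ 2 := by
    intro t
    have e : z (t + 1) - z t = α • (x (t + 1) - y (t + 1)) - β • D t := by
      rw [h.z_eq (t + 1)]
      have : z t = y (t + 1) + β • D t := by rw [h.y_succ]; module
      rw [this]; module
    have h2 : ‖z (t + 1) - z t‖ ≤ ‖x (t + 1) - y (t + 1)‖ + |β| * ‖D t‖ := by
      rw [e]
      refine (norm_sub_le _ _).trans ?_
      rw [norm_smul, norm_smul, Real.norm_of_nonneg hα.le, Real.norm_eq_abs]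
      gcongr
      exact mul_le_of_le_one_left (norm_nonneg _) hα1
    have h3 := pow_le_pow_left₀ (norm_nonneg _) h2 2
    have h4 : (|β| * ‖D t‖) ^ 2 = β ^ 2 * ‖D t‖ ^ 2 := by rw [mul_pow, sq_abs]
    nlinarith [sq_nonneg (‖x (t + 1) - y (t + 1)‖ - |β| * ‖D t‖)]
  calc ∑ t ∈ Finset.range T, ‖z (t + 1) - z t‖ ^ 2
      ≤ ∑ t ∈ Finset.range T, (2 * ‖x (t + 1) - y (t + 1)‖ ^ 2 + 2 * β ^ 2 * ‖D t‖ ^ 2) :=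
        Finset.sum_le_sum fun t _ => hstep t
    _ = 2 * ∑ t ∈ Finset.range T, ‖x (t + 1) - y (t + 1)‖ ^ 2
        + 2 * β ^ 2 * ∑ t ∈ Finset.range T, ‖D t‖ ^ 2 := by
        rw [Finset.sum_add_distrib, Finset.mul_sum, Finset.mul_sum]
    _ ≤ _ := by nlinarith [sq_nonneg ‖x 0 - y 0‖]

/-- Descent of the objective along the momentum scheme with inexact gradients. -/
theorem IsMomentumSeq.descent [CompleteSpace E] (h : IsMomentumSeq α β lam x y z D)
    (hα : 0 < α) (hα1 : α ≤ 1)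
    (hβ : 0 < β) (hlam : ∀ t, β ≤ lam t ∧ lam t ≤ (1 + α) * β) {F : E → ℝ} {L : ℝ}
    (hF : Differentiable ℝ F) (hL0 : 0 ≤ L)
    (hL : ∀ x y, ‖gradient F x - gradient F y‖ ≤ L * ‖x - y‖) (hβL : 16 * β * L ≤ 1) (T : ℕ) :
    F (x T) + β / 2 * ∑ t ∈ Finset.range T, ‖gradient F (z t)‖ ^ 2
      + 1 / 8 * β * ∑ t ∈ Finset.range T, ‖D t‖ ^ 2 ≤
      F (x 0) + β * ∑ t ∈ Finset.range T, ‖D t - gradient F (z t)‖ ^ 2 := by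
  have hstep : ∀ t, F (x (t + 1)) + β / 2 * ‖gradient F (z t)‖ ^ 2 + 3 / 16 * β * ‖D t‖ ^ 2 ≤
      F (x t) + β * ‖D t - gradient F (z t)‖ ^ 2 + L * ‖x t - y t‖ ^ 2 := by
    intro t
    obtain ⟨hl1, hl2⟩ := hlam t
    have hl3 : lam t ≤ 2 * β := by nlinarith
    have hl0 : 0 < lam t := hβ.trans_le hl1
    have h1 := le_add_inner_add_sq hF hL (x t) (x (t + 1))
    have e1 : x (t + 1) - x t = -(lam t • D t) := by rw [h.x_succ]; abel
    rw [e1, inner_neg_right, inner_smul_right, norm_neg, norm_smul,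
      Real.norm_of_nonneg hl0.le] at h1
    have h2 : ‖gradient F (x t) - gradient F (z t)‖ ≤ L * ‖x t - y t‖ := by
      refine (hL _ _).trans (mul_le_mul_of_nonneg_left ?_ hL0)
      have : x t - z t = (1 - α) • (x t - y t) := by rw [h.z_eq]; module
      rw [this, norm_smul, Real.norm_of_nonneg (by linarith)]
      exact mul_le_of_le_one_left (norm_nonneg _) (by linarith)
    -- The gradient is wanted at `z t`, where it is estimated, but smoothness is applied at `x t`;
    -- the change costs `L ‖x t - y t‖ ‖D t‖`.
    have h3 : -(inner ℝ (gradient F (x t)) (D t)) ≤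
        -(inner ℝ (gradient F (z t)) (D t)) + L * ‖x t - y t‖ * ‖D t‖ := by
      have := (abs_le.1 (abs_real_inner_le_norm (gradient F (x t) - gradient F (z t)) (D t))).1
      rw [inner_sub_left] at this
      nlinarith [mul_le_mul_of_nonneg_right h2 (norm_nonneg (D t))]
    -- Polarization trades the inner product for the squared error minus both squared norms. Of the
    -- `β / 2` in front of `‖D t‖²`, five times `β / 16` pays for `h6` and `h7`, which leaves `3 /
    -- 16 * β`.
    have h4 := norm_sub_sq_real (D t) (gradient F (z t))
    rw [real_inner_comm] at h4
    set gz := ‖gradient F (z t)‖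
    set a := ‖D t‖ with ha
    set q := ‖x t - y t‖
    set er := ‖D t - gradient F (z t)‖
    have ha0 : 0 ≤ a := norm_nonneg _
    have hq0 : 0 ≤ q := norm_nonneg _
    have h5 : lam t * (-(inner ℝ (gradient F (x t)) (D t))) ≤
        lam t * (er ^ 2 / 2 - a ^ 2 / 2 - gz ^ 2 / 2 + L * q * a) :=
      mul_le_mul_of_nonneg_left (by linarith) hl0.le
    have h6 : lam t * (L * q * a) ≤ L * q ^ 2 + L * β ^ 2 * a ^ 2 := by
      have : lam t * (L * q * a) ≤ 2 * β * (L * q * a) :=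
        mul_le_mul_of_nonneg_right hl3 (by positivity)
      nlinarith [mul_nonneg hL0 (sq_nonneg (q - β * a))]
    have h7 : L * (lam t * a) ^ 2 ≤ 4 * L * β ^ 2 * a ^ 2 := by
      have h70 : (lam t * a) ^ 2 ≤ (2 * β * a) ^ 2 :=
        pow_le_pow_left₀ (by positivity) (mul_le_mul_of_nonneg_right hl3 ha0) 2
      nlinarith [mul_le_mul_of_nonneg_left h70 hL0]
    have h8 : L * β ^ 2 * a ^ 2 ≤ β / 16 * a ^ 2 := by
      have : L * β ^ 2 ≤ β / 16 := by nlinarith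
      exact mul_le_mul_of_nonneg_right this (sq_nonneg _)
    have h9 : lam t * (er ^ 2 / 2) ≤ β * er ^ 2 := by nlinarith [sq_nonneg er]
    have h10 : β / 2 * gz ^ 2 ≤ lam t * (gz ^ 2 / 2) := by nlinarith [sq_nonneg gz]
    have h11 : β / 2 * a ^ 2 ≤ lam t * (a ^ 2 / 2) := by nlinarith [sq_nonneg a]
    have h12 : 0 ≤ β * a ^ 2 := by positivity
    linarith
  have hsum : ∀ T : ℕ, F (x T) + β / 2 * ∑ t ∈ Finset.range T, ‖gradient F (z t)‖ ^ 2
      + 3 / 16 * β * ∑ t ∈ Finset.range T, ‖D t‖ ^ 2 ≤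
      F (x 0) + β * ∑ t ∈ Finset.range T, ‖D t - gradient F (z t)‖ ^ 2
        + L * ∑ t ∈ Finset.range T, ‖x t - y t‖ ^ 2 := by
    intro T
    induction T with
    | zero => simp
    | succ T ih =>
      simp only [Finset.sum_range_succ, mul_add]
      linarith [hstep T]
  have h1 := hsum T
  have h2 := h.sum_sq_dist_le hα hα1 hlam T
  rw [Finset.sum_range_succ] at h2
  have hS : 0 ≤ ∑ t ∈ Finset.range T, ‖D t‖ ^ 2 := Finset.sum_nonneg fun _ _ => sq_nonneg _
  -- The gaps cost a further `β / 16`, so `3 / 16` drops to `1 / 8`.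
  have h3 : L * ∑ t ∈ Finset.range T, ‖x t - y t‖ ^ 2 ≤
      L * (β ^ 2 * ∑ t ∈ Finset.range T, ‖D t‖ ^ 2) :=
    mul_le_mul_of_nonneg_left (by linarith [sq_nonneg ‖x T - y T‖]) hL0
  have h4 : L * β ^ 2 ≤ β / 16 := by nlinarith
  nlinarith [mul_le_mul_of_nonneg_right h4 hS]

end Descent

/-! ### The Frobenius norm -/

section Frobenius

variable {d p : ℕ}

/-- The matrix entries of a linear map, as a vector of a Euclidean space. -/
noncomputable def frobVec :
    (Vec d →L[ℝ] Vec p) →L[ℝ] EuclideanSpace ℝ (Fin p × Fin d) :=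
  LinearMap.toContinuousLinearMap
    { toFun := fun A => WithLp.toLp 2 fun q => A (EuclideanSpace.single q.2 (1 : ℝ)) q.1
      map_add' := fun A B => by ext q; simp
      map_smul' := fun c A => by ext q; simp }

theorem frobVec_apply (A : Vec d →L[ℝ] Vec p) (q : Fin p × Fin d) :
    frobVec A q = A (EuclideanSpace.single q.2 (1 : ℝ)) q.1 := rfl

theorem norm_frobVec (A : Vec d →L[ℝ] Vec p) : ‖frobVec A‖ = frobNorm A := by
  rw [EuclideanSpace.norm_eq, frobNorm, Fintype.sum_prod_type]
  simp [frobVec_apply]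

/-- Cauchy–Schwarz in each row of the matrix. -/
theorem norm_le_frobNorm (A : Vec d →L[ℝ] Vec p) : ‖A‖ ≤ frobNorm A := by
  refine ContinuousLinearMap.opNorm_le_bound _ (Real.sqrt_nonneg _) fun x => ?_
  rw [EuclideanSpace.norm_eq, EuclideanSpace.norm_eq, frobNorm,
    ← Real.sqrt_mul (Finset.sum_nonneg fun _ _ => Finset.sum_nonneg fun _ _ => sq_nonneg _)]
  refine Real.sqrt_le_sqrt ?_
  rw [Finset.sum_mul]
  refine Finset.sum_le_sum fun i _ => ?_
  have hx : A x i = ∑ j, A (EuclideanSpace.single j (1 : ℝ)) i * x j := by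
    have h1 : x = ∑ j, x j • EuclideanSpace.single j (1 : ℝ) := by
      ext k
      simp [Finset.sum_apply, Pi.single_apply]
    conv_lhs => rw [h1]
    simp [mul_comm]
  rw [hx]
  simp only [Real.norm_eq_abs, sq_abs]
  exact Finset.sum_mul_sq_le_sq_mul_sq _ _ _

end Frobenius

/-! ### Smoothness of the composition -/

section Smooth

variable {d p : ℕ} {Ξ : Type*} {f : Vec p → ℝ} {G : Ξ → Vec d → Vec p} {lf Lf lg Lg : ℝ}

theorem IsSmooth.norm_gradient_le (h : IsSmooth f G lf Lf lg Lg) (hlf : 0 ≤ lf) (u : Vec p) :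
    ‖gradient f u‖ ≤ lf := by
  rw [gradient, LinearIsometryEquiv.norm_map]
  refine norm_fderiv_le_of_lip' ℝ hlf (Filter.Eventually.of_forall fun w => ?_)
  rw [Real.norm_eq_abs]
  exact h.lip_f w u

theorem IsSmooth.norm_fderiv_le (h : IsSmooth f G lf Lf lg Lg) (hlg : 0 ≤ lg) (ξ : Ξ) (x : Vec d) :
    ‖fderiv ℝ (G ξ) x‖ ≤ lg :=
  norm_fderiv_le_of_lip' ℝ hlg (Filter.Eventually.of_forall fun w => h.lip_g ξ w x)

theorem continuous_of_norm_sub_le {E H : Type*} [NormedAddCommGroup E] [NormedAddCommGroup H]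
    {h : E → H} {c : ℝ} (hc : ∀ x y, ‖h x - h y‖ ≤ c * ‖x - y‖) : Continuous h := by
  refine (LipschitzWith.of_dist_le_mul (K := Real.toNNReal c) fun x y => ?_).continuous
  rw [dist_eq_norm, dist_eq_norm]
  exact (hc x y).trans (mul_le_mul_of_nonneg_right (Real.le_coe_toNNReal c) (norm_nonneg _))

theorem IsSmooth.continuous_gradient (h : IsSmooth f G lf Lf lg Lg) : Continuous (gradient f) :=
  continuous_of_norm_sub_le h.lip_grad_f

theorem IsSmooth.continuous_fderiv (h : IsSmooth f G lf Lf lg Lg) (ξ : Ξ) :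
    Continuous (fderiv ℝ (G ξ)) :=
  continuous_of_norm_sub_le fun x y => (norm_le_frobNorm _).trans (h.lip_jac_g ξ x y)

theorem IsSmooth.gradient_comp (h : IsSmooth f G lf Lf lg Lg) (ξ : Ξ) (x : Vec d) :
    gradient (fun x => f (G ξ x)) x =
      ContinuousLinearMap.adjoint (fderiv ℝ (G ξ) x) (gradient f (G ξ x)) := by
  apply HasGradientAt.gradient
  rw [hasGradientAt_iff_hasFDerivAt]
  have h1 := ((h.diff_f (G ξ x)).hasGradientAt.hasFDerivAt).comp x (h.diff_g ξ x).hasFDerivAt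
  refine h1.congr_fderiv ?_
  ext v
  simp [ContinuousLinearMap.adjoint_inner_left]

/-- The error of an estimated gradient of the composition. -/
theorem IsSmooth.sq_norm_adjoint_sub_le (h : IsSmooth f G lf Lf lg Lg) (hlf : 0 ≤ lf)
    (hlg : 0 ≤ lg) (ξ : Ξ) (x : Vec d) (u : Vec p) (A : Vec d →L[ℝ] Vec p) :
    ‖ContinuousLinearMap.adjoint A (gradient f u) - gradient (fun x => f (G ξ x)) x‖ ^ 2 ≤
      2 * (lg ^ 2 * Lf ^ 2) * ‖u - G ξ x‖ ^ 2
        + 2 * lf ^ 2 * ‖frobVec A - frobVec (fderiv ℝ (G ξ) x)‖ ^ 2 := by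
  rw [h.gradient_comp, ← map_sub, norm_frobVec]
  -- The Jacobian error meets a gradient of norm at most `lf`, and the error of `∇f` meets a
  -- Jacobian of norm at most `lg`.
  have e : ContinuousLinearMap.adjoint A (gradient f u)
      - ContinuousLinearMap.adjoint (fderiv ℝ (G ξ) x) (gradient f (G ξ x)) =
      ContinuousLinearMap.adjoint (A - fderiv ℝ (G ξ) x) (gradient f u)
      + ContinuousLinearMap.adjoint (fderiv ℝ (G ξ) x) (gradient f u - gradient f (G ξ x)) := by
    simp only [map_sub, sub_apply]; abel
  have h1 : ‖ContinuousLinearMap.adjoint (A - fderiv ℝ (G ξ) x) (gradient f u)‖ ≤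
      frobNorm (A - fderiv ℝ (G ξ) x) * lf := by
    refine (ContinuousLinearMap.le_opNorm _ _).trans ?_
    rw [LinearIsometryEquiv.norm_map]
    exact mul_le_mul (norm_le_frobNorm _) (h.norm_gradient_le hlf u) (norm_nonneg _)
      (Real.sqrt_nonneg _)
  have h2 : ‖ContinuousLinearMap.adjoint (fderiv ℝ (G ξ) x) (gradient f u - gradient f (G ξ x))‖ ≤
      lg * (Lf * ‖u - G ξ x‖) := by
    refine (ContinuousLinearMap.le_opNorm _ _).trans ?_
    rw [LinearIsometryEquiv.norm_map]
    exact mul_le_mul (h.norm_fderiv_le hlg ξ x) (h.lip_grad_f _ _) (norm_nonneg _) hlg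
  rw [e]
  have h3 := pow_le_pow_left₀ (norm_nonneg _) ((norm_add_le _ _).trans (add_le_add h1 h2)) 2
  refine h3.trans ?_
  nlinarith [sq_nonneg (frobNorm (A - fderiv ℝ (G ξ) x) * lf - lg * (Lf * ‖u - G ξ x‖))]

theorem IsSmooth.differentiable_comp (h : IsSmooth f G lf Lf lg Lg) (ξ : Ξ) :
    Differentiable ℝ (fun x => f (G ξ x)) :=
  h.diff_f.comp (h.diff_g ξ)

theorem IsSmooth.norm_gradient_comp_le (h : IsSmooth f G lf Lf lg Lg) (hlf : 0 ≤ lf)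
    (hlg : 0 ≤ lg) (ξ : Ξ) (x : Vec d) : ‖gradient (fun x => f (G ξ x)) x‖ ≤ lg * lf := by
  rw [h.gradient_comp]
  refine (ContinuousLinearMap.le_opNorm _ _).trans ?_
  rw [LinearIsometryEquiv.norm_map]
  exact mul_le_mul (h.norm_fderiv_le hlg ξ x) (h.norm_gradient_le hlf _) (norm_nonneg _) hlg

/-- Changing the Jacobian first and the outer gradient second gives the two summands `lf Lg` and
`lg² Lf` of `LF`. -/
theorem IsSmooth.lip_gradient_comp (h : IsSmooth f G lf Lf lg Lg) (hlf : 0 ≤ lf) (hLf : 0 ≤ Lf)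
    (hlg : 0 ≤ lg) (ξ : Ξ) (x y : Vec d) :
    ‖gradient (fun x => f (G ξ x)) x - gradient (fun x => f (G ξ x)) y‖ ≤
      LF lf Lf lg Lg * ‖x - y‖ := by
  rw [h.gradient_comp, h.gradient_comp]
  have e : ContinuousLinearMap.adjoint (fderiv ℝ (G ξ) x) (gradient f (G ξ x))
      - ContinuousLinearMap.adjoint (fderiv ℝ (G ξ) y) (gradient f (G ξ y)) =
      ContinuousLinearMap.adjoint (fderiv ℝ (G ξ) x - fderiv ℝ (G ξ) y) (gradient f (G ξ x))
      + ContinuousLinearMap.adjoint (fderiv ℝ (G ξ) y)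
        (gradient f (G ξ x) - gradient f (G ξ y)) := by
    simp only [map_sub, sub_apply]; abel
  have h1 : ‖ContinuousLinearMap.adjoint (fderiv ℝ (G ξ) x - fderiv ℝ (G ξ) y)
      (gradient f (G ξ x))‖ ≤ Lg * ‖x - y‖ * lf := by
    refine (ContinuousLinearMap.le_opNorm _ _).trans ?_
    rw [LinearIsometryEquiv.norm_map]
    have h10 := (norm_le_frobNorm _).trans (h.lip_jac_g ξ x y)
    exact mul_le_mul h10 (h.norm_gradient_le hlf _) (norm_nonneg _) ((norm_nonneg _).trans h10)
  have h2 : ‖ContinuousLinearMap.adjoint (fderiv ℝ (G ξ) y)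
      (gradient f (G ξ x) - gradient f (G ξ y))‖ ≤ lg * (Lf * (lg * ‖x - y‖)) := by
    refine (ContinuousLinearMap.le_opNorm _ _).trans ?_
    rw [LinearIsometryEquiv.norm_map]
    exact mul_le_mul (h.norm_fderiv_le hlg ξ y) ((h.lip_grad_f _ _).trans
      (mul_le_mul_of_nonneg_left (h.lip_g ξ x y) hLf)) (norm_nonneg _) hlg
  rw [e, LF]
  refine (norm_add_le _ _).trans ((add_le_add h1 h2).trans (le_of_eq ?_))
  ring

theorem IsSmooth.continuous_gradient_comp (h : IsSmooth f G lf Lf lg Lg) (hlf : 0 ≤ lf)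
    (hLf : 0 ≤ Lf) (hlg : 0 ≤ lg) (ξ : Ξ) : Continuous (gradient (fun x => f (G ξ x))) :=
  continuous_of_norm_sub_le (h.lip_gradient_comp hlf hLf hlg ξ)

end Smooth

/-- As `1 + 1 / α ≥ 2`, each of the two summands that multiply `β` in the step size condition is at
least `8 L_F`. -/
theorem StepCond.smooth_le {α β lf Lf lg Lg : ℝ} (h : StepCond α β lf Lf lg Lg)
    (hL : 0 ≤ LF lf Lf lg Lg) : 16 * β * LF lf Lf lg Lg ≤ 1 := by
  obtain ⟨h1, h2, h3, h4⟩ := h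
  have h5 : 1 ≤ 1 / α := by rw [le_div_iff₀ h1]; linarith
  set L := LF lf Lf lg Lg
  have h6 : 2 * L ≤ Real.sqrt ((1 + 1 / α) ^ 2 * L ^ 2 + 3 * G0 lf Lf lg Lg) := by
    refine Real.le_sqrt_of_sq_le ?_
    have hG : 0 ≤ G0 lf Lf lg Lg := by unfold G0; positivity
    have : (2 * L) ^ 2 ≤ ((1 + 1 / α) * L) ^ 2 :=
      pow_le_pow_left₀ (by positivity) (mul_le_mul_of_nonneg_right (by linarith) hL) 2
    nlinarith
  have h7 : 2 * L ≤ (1 + 1 / α) * L := mul_le_mul_of_nonneg_right (by linarith) hL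
  have h8 : β * (16 * L) ≤ β * (4 * Real.sqrt ((1 + 1 / α) ^ 2 * L ^ 2 + 3 * G0 lf Lf lg Lg)
    + 4 * (1 + 1 / α) * L) := mul_le_mul_of_nonneg_left (by linarith) h3.le
  linarith

/-- Dropping the `L_F` terms leaves `48 β² G₀ ≤ 1`. The value `1 / 8` is what the spare term of the
descent inequality can absorb. -/
theorem StepCond.variance_le {α β lf Lf lg Lg : ℝ} (h : StepCond α β lf Lf lg Lg)
    (hL : 0 ≤ LF lf Lf lg Lg) : G0 lf Lf lg Lg * (4 * β ^ 2) ≤ 1 / 8 := by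
  obtain ⟨h1, h2, h3, h4⟩ := h
  have hG : 0 ≤ G0 lf Lf lg Lg := by unfold G0; positivity
  have h6 : Real.sqrt (3 * G0 lf Lf lg Lg) ≤
      Real.sqrt ((1 + 1 / α) ^ 2 * LF lf Lf lg Lg ^ 2 + 3 * G0 lf Lf lg Lg) :=
    Real.sqrt_le_sqrt (le_add_of_nonneg_left (by positivity))
  have h7 : 0 ≤ 4 * (1 + 1 / α) * LF lf Lf lg Lg := by positivity
  have h8 : β * (4 * Real.sqrt (3 * G0 lf Lf lg Lg)) ≤ 1 :=
    (mul_le_mul_of_nonneg_left (by linarith) h3.le).trans h4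
  have h9 := pow_le_pow_left₀ (by positivity) h8 2
  have h10 := Real.sq_sqrt (show 0 ≤ 3 * G0 lf Lf lg Lg by positivity)
  have : (β * (4 * Real.sqrt (3 * G0 lf Lf lg Lg))) ^ 2 = 12 * (G0 lf Lf lg Lg * (4 * β ^ 2)) := by
    rw [mul_pow, mul_pow, h10]; ring
  linarith

theorem LF_nonneg {lf Lf lg Lg : ℝ} (hlf : 0 ≤ lf) (hLf : 0 ≤ Lf) (hLg : 0 ≤ Lg) :
    0 ≤ LF lf Lf lg Lg := by unfold LF; positivity

/-! ### Batch means -/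

section BatchMean

variable {Ξ V W : Type*} [AddCommGroup V] [Module ℝ V] [AddCommGroup W] [Module ℝ W]

theorem batchMean_sub (A : Multiset Ξ) (h k : Ξ → V) :
    batchMean A (fun ξ => h ξ - k ξ) = batchMean A h - batchMean A k := by
  rw [batchMean, Multiset.sum_map_sub, smul_sub, batchMean, batchMean]

theorem map_batchMean {F : Type*} [FunLike F V W] [LinearMapClass F ℝ V W] (φ : F)
    (A : Multiset Ξ) (h : Ξ → V) : φ (batchMean A h) = batchMean A (fun ξ => φ (h ξ)) := by
  rw [batchMean, map_smul, map_multiset_sum, Multiset.map_map, batchMean]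
  rfl

end BatchMean

/-! ### Recursive estimators -/

section Estimator

/-- Fubini for the product law of `(Y, a)`: a bound valid for every frozen value of `Y` may be
integrated. This replaces conditional expectations throughout. -/
theorem lintegral_le_of_indepFun {Ω S X : Type*} [MeasurableSpace Ω] [MeasurableSpace S]
    [MeasurableSpace X] {μ : Measure Ω} [IsProbabilityMeasure μ] {Y : Ω → S} {a : Ω → X}
    (hY : Measurable Y) (ha : Measurable a) (hind : IndepFun Y a μ) {φ : S × X → ENNReal}
    (hφ : Measurable φ) {ψ : S → ENNReal} (h : ∀ s, ∫⁻ ω, φ (s, a ω) ∂μ ≤ ψ s) :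
    ∫⁻ ω, φ (Y ω, a ω) ∂μ ≤ ∫⁻ ω, ψ (Y ω) ∂μ := by
  have h1 := (indepFun_iff_map_prod_eq_prod_map_map hY.aemeasurable ha.aemeasurable).1 hind
  have : IsProbabilityMeasure (μ.map a) := Measure.isProbabilityMeasure_map ha.aemeasurable
  calc ∫⁻ ω, φ (Y ω, a ω) ∂μ = ∫⁻ q, φ q ∂(μ.map fun ω => (Y ω, a ω)) :=
        (lintegral_map hφ (hY.prodMk ha)).symm
    _ = ∫⁻ s, ∫⁻ x, φ (s, x) ∂(μ.map a) ∂(μ.map Y) := by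
        rw [h1, lintegral_prod _ hφ.aemeasurable]
    _ = ∫⁻ ω, ∫⁻ x, φ (Y ω, x) ∂(μ.map a) ∂μ :=
        lintegral_map hφ.lintegral_prod_right' hY
    _ ≤ ∫⁻ ω, ψ (Y ω) ∂μ := by
        refine lintegral_mono fun ω => ?_
        exact (lintegral_map (hφ.comp measurable_prodMk_left) ha).trans_le (h (Y ω))

theorem indepFun_of_indep_comap {Ω S X : Type*} {mΩ : MeasurableSpace Ω} [MeasurableSpace S]
    [mX : MeasurableSpace X] {μ : Measure Ω} {m : MeasurableSpace Ω} {Y : Ω → S} {a : Ω → X}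
    (h : Indep m (mX.comap a) μ) (hY : Measurable[m] Y) : IndepFun Y a μ := by
  rw [IndepFun_iff_Indep]
  exact indep_of_indep_of_le_left h hY.comap_le

variable {Ω X E H : Type*} [mΩ : MeasurableSpace Ω] [mX : MeasurableSpace X] {μ : Measure Ω}
  [IsProbabilityMeasure μ]
  [NormedAddCommGroup E] [MeasurableSpace E]
  [NormedAddCommGroup H] [MeasurableSpace H] [BorelSpace H] [SecondCountableTopology H]

/-- Moment bounds for the batch estimates `Q t (a t) z` of `q z`. -/
structure IsOracle (μ : Measure Ω) (τ : ℕ) (a : ℕ → Ω → X) (Q : ℕ → X → E → H) (q : E → H)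
    (V c : ℝ) : Prop where
  refresh : ∀ t z, t % τ = 0 → ∫⁻ ω, ENNReal.ofReal (‖Q t (a t ω) z - q z‖ ^ 2) ∂μ ≤
    ENNReal.ofReal V
  update : ∀ t e z w, t % τ ≠ 0 →
    ∫⁻ ω, ENNReal.ofReal (‖e + (Q t (a t ω) z - Q t (a t ω) w - (q z - q w))‖ ^ 2) ∂μ ≤
      ENNReal.ofReal (‖e‖ ^ 2) + ENNReal.ofReal c * ENNReal.ofReal (‖z - w‖ ^ 2)

/-- Batches that are revealed along a filtration. -/
structure IsSeedSeq (μ : Measure Ω) (𝓕 : ℕ → MeasurableSpace Ω) (a : ℕ → Ω → X) : Prop where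
  mono : Monotone 𝓕
  le : ∀ t, 𝓕 t ≤ mΩ
  meas : ∀ t, Measurable[𝓕 (t + 1)] (a t)
  indep : ∀ t, Indep (𝓕 t) (mX.comap (a t)) μ

variable {𝓕 : ℕ → MeasurableSpace Ω} {a : ℕ → Ω → X} {Q : ℕ → X → E → H} {q : E → H}
  {V c : ℝ} {τ : ℕ} {est : ℕ → Ω → H} {z : ℕ → Ω → E}

theorem IsOracle.lintegral_refresh_le (h : IsOracle μ τ a Q q V c) (hs : IsSeedSeq μ 𝓕 a)
    (hQ : ∀ t, Measurable fun r : X × E => Q t r.1 r.2) (hq : Measurable q)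
    (hz : ∀ t, Measurable[𝓕 t] (z t)) (t : ℕ) (ht : t % τ = 0)
    (he : ∀ ω, est t ω = Q t (a t ω) (z t ω)) :
    ∫⁻ ω, ENNReal.ofReal (‖est t ω - q (z t ω)‖ ^ 2) ∂μ ≤ ENNReal.ofReal V := by
  have ha : Measurable (a t) := (hs.meas t).mono (hs.le _) le_rfl
  have hφ : Measurable fun r : E × X => ENNReal.ofReal (‖Q t r.2 r.1 - q r.1‖ ^ 2) :=
    ((((hQ t).comp measurable_swap).sub (hq.comp measurable_fst)).norm.pow_const 2).ennreal_ofReal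
  have := lintegral_le_of_indepFun ((hz t).mono (hs.le _) le_rfl) ha
    (indepFun_of_indep_comap (hs.indep t) (hz t)) hφ (ψ := fun _ => ENNReal.ofReal V)
    (fun w => h.refresh t w ht)
  simpa [he] using this

/-- The current error and both query points are known before batch `t + 1` is drawn, so they may be
frozen in the moment bound of the oracle. -/
theorem IsOracle.lintegral_update_le [BorelSpace E] [SecondCountableTopology E]
    (h : IsOracle μ τ a Q q V c) (hs : IsSeedSeq μ 𝓕 a)
    (hQ : ∀ t, Measurable fun r : X × E => Q t r.1 r.2) (hq : Measurable q)
    (hz : ∀ t, Measurable[𝓕 t] (z t)) (hest : ∀ t, Measurable[𝓕 (t + 1)] (est t)) (t : ℕ)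
    (ht : (t + 1) % τ ≠ 0)
    (he : ∀ ω, est (t + 1) ω = est t ω +
      (Q (t + 1) (a (t + 1) ω) (z (t + 1) ω) - Q (t + 1) (a (t + 1) ω) (z t ω))) :
    ∫⁻ ω, ENNReal.ofReal (‖est (t + 1) ω - q (z (t + 1) ω)‖ ^ 2) ∂μ ≤
      ∫⁻ ω, ENNReal.ofReal (‖est t ω - q (z t ω)‖ ^ 2) ∂μ +
        ENNReal.ofReal c * ∫⁻ ω, ENNReal.ofReal (‖z (t + 1) ω - z t ω‖ ^ 2) ∂μ := by
  have ha : Measurable (a (t + 1)) := (hs.meas _).mono (hs.le _) le_rfl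
  have hz0 : Measurable[𝓕 (t + 1)] (z t) := (hz t).mono (hs.mono (Nat.le_succ t)) le_rfl
  have hY : Measurable[𝓕 (t + 1)] fun ω => (est t ω - q (z t ω), z (t + 1) ω, z t ω) :=
    ((hest t).sub (hq.comp hz0)).prodMk ((hz (t + 1)).prodMk hz0)
  have hY' := hY.mono (hs.le _) le_rfl
  have hφ : Measurable fun r : (H × E × E) × X => ENNReal.ofReal (‖r.1.1 +
      (Q (t + 1) r.2 r.1.2.1 - Q (t + 1) r.2 r.1.2.2 - (q r.1.2.1 - q r.1.2.2))‖ ^ 2) := by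
    have m1 : Measurable fun r : (H × E × E) × X => Q (t + 1) r.2 r.1.2.1 :=
      (hQ (t + 1)).comp (measurable_snd.prodMk (by fun_prop))
    have m2 : Measurable fun r : (H × E × E) × X => Q (t + 1) r.2 r.1.2.2 :=
      (hQ (t + 1)).comp (measurable_snd.prodMk (by fun_prop))
    have m3 : Measurable fun r : (H × E × E) × X => q r.1.2.1 := hq.comp (by fun_prop)
    have m4 : Measurable fun r : (H × E × E) × X => q r.1.2.2 := hq.comp (by fun_prop)
    have m5 : Measurable fun r : (H × E × E) × X => r.1.1 := by fun_prop
    exact ((m5.add ((m1.sub m2).sub (m3.sub m4))).norm.pow_const 2).ennreal_ofReal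
  have key := lintegral_le_of_indepFun hY' ha (indepFun_of_indep_comap (hs.indep (t + 1)) hY) hφ
    (ψ := fun r => ENNReal.ofReal (‖r.1‖ ^ 2)
      + ENNReal.ofReal c * ENNReal.ofReal (‖r.2.1 - r.2.2‖ ^ 2))
    (fun r => h.update (t + 1) r.1 r.2.1 r.2.2 ht)
  have hm : Measurable fun ω => ENNReal.ofReal (‖z (t + 1) ω - z t ω‖ ^ 2) :=
    ((((hz (t + 1)).mono (hs.le _) le_rfl).sub
      (hz0.mono (hs.le _) le_rfl)).norm.pow_const 2).ennreal_ofReal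
  rw [lintegral_add_right _ (hm.const_mul _), lintegral_const_mul _ hm] at key
  refine le_trans (le_of_eq ?_) key
  refine lintegral_congr fun ω => ?_
  rw [he]
  dsimp only
  congr 3
  abel

end Estimator

/-! ### Accumulated error of a recursion that is refreshed periodically -/

section Recursion

variable {τ : ℕ} {Err D : ℕ → ENNReal} {V c : ENNReal}

/-- Unrolls the recursion back to the last refresh, at time `t - t % τ`. -/
theorem periodic_error_le (h0 : ∀ t, t % τ = 0 → Err t ≤ V)
    (h1 : ∀ t, (t + 1) % τ ≠ 0 → Err (t + 1) ≤ Err t + c * D t) (t : ℕ) :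
    Err t ≤ V + c * ∑ s ∈ Finset.Ico (t - t % τ) t, D s := by
  induction t with
  | zero => simpa using h0 0 (Nat.zero_mod _)
  | succ t ih =>
    by_cases ht : (t + 1) % τ = 0
    · exact (h0 _ ht).trans le_self_add
    · have e : (t + 1) % τ = t % τ + 1 := by
        have h3 := Nat.add_mod t 1 τ
        rcases Nat.lt_or_ge 1 τ with h | h
        · rw [Nat.mod_eq_of_lt h] at h3
          have h2 := Nat.mod_lt t (by omega : 0 < τ)
          rcases Nat.lt_or_ge (t % τ + 1) τ with h4 | h4
          · rw [h3, Nat.mod_eq_of_lt h4]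
          · have : t % τ + 1 = τ := by omega
            rw [this, Nat.mod_self] at h3
            exact absurd h3 ht
        -- For `τ = 0` the remainder of `t` is `t` itself, so only time `0` is a refresh; for `τ =
        -- 1` every time is one.
        · interval_cases τ
          · simp
          · simp [Nat.mod_one] at ht
      have h5 := Nat.mod_le t τ
      rw [e, Nat.add_sub_add_right, Finset.sum_Ico_succ_top (Nat.sub_le _ _), mul_add, ← add_assoc]
      exact (h1 t ht).trans (add_le_add_left ih _)

/-- A coarser form, used only to see that second moments are finite. -/
theorem periodic_error_le_sum_range (h0 : ∀ t, t % τ = 0 → Err t ≤ V)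
    (h1 : ∀ t, (t + 1) % τ ≠ 0 → Err (t + 1) ≤ Err t + c * D t) (t : ℕ) :
    Err t ≤ V + c * ∑ s ∈ Finset.range t, D s := by
  refine (periodic_error_le h0 h1 t).trans ?_
  gcongr
  intro s hs
  simp only [Finset.mem_Ico, Finset.mem_range] at hs ⊢
  exact hs.2

/-- Double counting: the increment of time `s` enters the error of time `t` only if `s < t < s + τ`.
-/
theorem sum_periodic_error_le (hτ : 0 < τ) (h0 : ∀ t, t % τ = 0 → Err t ≤ V)
    (h1 : ∀ t, (t + 1) % τ ≠ 0 → Err (t + 1) ≤ Err t + c * D t) (T : ℕ) :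
    ∑ t ∈ Finset.range T, Err t ≤ T * V + c * τ * ∑ s ∈ Finset.range T, D s := by
  have hE : ∀ t ∈ Finset.range T,
      Err t ≤ V + c * ∑ s ∈ Finset.range T, if s < t ∧ t < s + τ then D s else 0 := by
    intro t ht
    refine (periodic_error_le h0 h1 t).trans ?_
    rw [← Finset.sum_filter]
    gcongr
    intro s hs
    have := Nat.mod_lt t hτ
    simp only [Finset.mem_Ico, Finset.mem_range, Finset.mem_filter] at hs ht ⊢
    omega
  refine (Finset.sum_le_sum hE).trans ?_
  rw [Finset.sum_add_distrib, ← Finset.mul_sum, Finset.sum_comm, Finset.sum_const,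
    Finset.card_range, nsmul_eq_mul, mul_assoc c, Finset.mul_sum (a := (τ : ENNReal))]
  gcongr with s
  rw [← Finset.sum_filter, Finset.sum_const, nsmul_eq_mul]
  gcongr
  calc _ ≤ (Finset.Ioo s (s + τ)).card := Finset.card_le_card fun t ht => by
        simp only [Finset.mem_Ioo, Finset.mem_filter] at ht ⊢
        exact ht.2
    _ ≤ τ := by rw [Nat.card_Ioo]; omega

end Recursion

/-! ### A run of the algorithm with a random initial point -/

section Run

variable {d p : ℕ} {Ξ X Ω : Type*} {f : Vec p → ℝ} {G : Ξ → Vec d → Vec p} {g : Vec d → Vec p}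
  {lf Lf lg Lg α β : ℝ} {lam : ℕ → ℝ} {τ : ℕ}

/-- The search direction of iteration `t`. -/
noncomputable def direction (P : Params) (f : Vec p → ℝ) (r : Vec d → ℝ) (G : Ξ → Vec d → Vec p)
    (x0 : Vec d) (A : ℕ → Multiset Ξ) (t : ℕ) : Vec d :=
  ContinuousLinearMap.adjoint (run P f r G x0 A (t + 1)).jEst
    (gradient f (run P f r G x0 A (t + 1)).gEst)

/-- The factor `β / lam t` in the update of `y` cancels the step size of `x`, so `y` moves from `z`
by exactly `-β • D t`. -/
theorem isMomentumSeq_run (hβ : 0 < β) (hlam : ∀ t, β ≤ lam t) (x0 : Vec d)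
    (A : ℕ → Multiset Ξ) :
    IsMomentumSeq α β lam (fun t => (run (constParams τ α β lam) f (fun _ => 0) G x0 A t).x)
      (fun t => (run (constParams τ α β lam) f (fun _ => 0) G x0 A t).y)
      (zPoint (constParams τ α β lam) f (fun _ => 0) G x0 A)
      (direction (constParams τ α β lam) f (fun _ => 0) G x0 A) := by
  have hx : ∀ t, (run (constParams τ α β lam) f (fun _ => 0) G x0 A (t + 1)).x =
      (run (constParams τ α β lam) f (fun _ => 0) G x0 A t).x
        - lam t • direction (constParams τ α β lam) f (fun _ => 0) G x0 A t :=
    fun t => prox_zero_fun (hβ.trans_le (hlam t)) _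
  refine ⟨rfl, fun t => rfl, hx, fun t => ?_⟩
  have hy : (run (constParams τ α β lam) f (fun _ => 0) G x0 A (t + 1)).y =
      zPoint (constParams τ α β lam) f (fun _ => 0) G x0 A t + (β / lam t) •
      ((run (constParams τ α β lam) f (fun _ => 0) G x0 A (t + 1)).x
        - (run (constParams τ α β lam) f (fun _ => 0) G x0 A t).x) := rfl
  have hl : lam t ≠ 0 := (hβ.trans_le (hlam t)).ne'
  rw [hy, hx, sub_sub_cancel_left, smul_neg, smul_smul, div_mul_cancel₀ _ hl, ← sub_eq_add_neg]

/-- Measurability of a random state of the algorithm. -/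
structure IsMeasState (m : MeasurableSpace Ω) (s : Ω → State d p) : Prop where
  x : Measurable[m] fun ω => (s ω).x
  y : Measurable[m] fun ω => (s ω).y
  z : Measurable[m] fun ω => (s ω).z
  g : Measurable[m] fun ω => (s ω).gEst
  j : Measurable[m] fun ω => (s ω).jEst

theorem IsMeasState.mono {m m' : MeasurableSpace Ω} {s : Ω → State d p} (h : IsMeasState m s)
    (hm : m ≤ m') : IsMeasState m' s :=
  ⟨h.x.mono hm le_rfl, h.y.mono hm le_rfl, h.z.mono hm le_rfl, h.g.mono hm le_rfl,
    h.j.mono hm le_rfl⟩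

theorem measurable_adjoint_apply {m : MeasurableSpace Ω} {j : Ω → Vec d →L[ℝ] Vec p}
    {v : Ω → Vec p} (hj : Measurable j) (hv : Measurable v) :
    Measurable fun ω => ContinuousLinearMap.adjoint (j ω) (v ω) := by
  have hc : Continuous fun r : (Vec d →L[ℝ] Vec p) × Vec p =>
      ContinuousLinearMap.adjoint r.1 r.2 :=
    ((ContinuousLinearMap.adjoint (𝕜 := ℝ) (E := Vec d) (F := Vec p)).continuous.comp
      continuous_fst).clm_apply continuous_snd
  have hm := hc.measurable.comp (hj.prodMk hv)
  change Measurable ((fun r : (Vec d →L[ℝ] Vec p) × Vec p =>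
    ContinuousLinearMap.adjoint r.1 r.2) ∘ fun ω => (j ω, v ω))
  exact hm

variable [mX : MeasurableSpace X] {bt : ℕ → X → Multiset Ξ} {a : ℕ → Ω → X}

theorem IsMeasState.step {m : MeasurableSpace Ω} {s : Ω → State d p} (h : IsMeasState m s) {t : ℕ}
    (hf : Continuous (gradient f)) (hlam : 0 < lam t)
    (hg : Measurable fun r : X × Vec d => batchMean (bt t r.1) (fun ξ => G ξ r.2))
    (hJ : Measurable fun r : X × Vec d => batchMean (bt t r.1) (fun ξ => fderiv ℝ (G ξ) r.2))
    (ha : Measurable (a t)) :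
    IsMeasState m fun ω =>
      step (constParams τ α β lam) f (fun _ => 0) G (bt t (a t ω)) t (s ω) := by
  have hz : Measurable fun ω => (1 - α) • (s ω).y + α • (s ω).x :=
    (h.y.const_smul (1 - α)).add (h.x.const_smul α)
  have hge : Measurable fun ω => (MVRC.step (constParams τ α β lam) f (fun _ => 0) G
      (bt t (a t ω)) t (s ω)).gEst := by
    have h1 := hg.comp (ha.prodMk hz)
    by_cases ht : t % τ = 0
    · refine (congrArg _ (funext fun ω => ?_)).mp h1
      exact (if_pos ht).symm
    · have h2 := h.g.add (h1.sub (hg.comp (ha.prodMk h.z)))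
      refine (congrArg _ (funext fun ω => ?_)).mp h2
      refine Eq.trans (congrArg ((s ω).gEst + ·) (batchMean_sub (bt t (a t ω))
        (fun ξ => G ξ ((1 - α) • (s ω).y + α • (s ω).x)) (fun ξ => G ξ (s ω).z)).symm) ?_
      exact (if_neg ht).symm
  have hje : Measurable fun ω => (MVRC.step (constParams τ α β lam) f (fun _ => 0) G
      (bt t (a t ω)) t (s ω)).jEst := by
    have h1 := hJ.comp (ha.prodMk hz)
    by_cases ht : t % τ = 0
    · refine (congrArg _ (funext fun ω => ?_)).mp h1
      exact (if_pos ht).symm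
    · have h2 := h.j.add (h1.sub (hJ.comp (ha.prodMk h.z)))
      refine (congrArg _ (funext fun ω => ?_)).mp h2
      refine Eq.trans (congrArg ((s ω).jEst + ·) (batchMean_sub (bt t (a t ω))
        (fun ξ => fderiv ℝ (G ξ) ((1 - α) • (s ω).y + α • (s ω).x))
        (fun ξ => fderiv ℝ (G ξ) (s ω).z)).symm) ?_
      exact (if_neg ht).symm
  have hd := measurable_adjoint_apply hje (hf.measurable.comp hge)
  have hx : Measurable fun ω => (MVRC.step (constParams τ α β lam) f (fun _ => 0) G
      (bt t (a t ω)) t (s ω)).x := by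
    have e : (fun ω => (MVRC.step (constParams τ α β lam) f (fun _ => 0) G
        (bt t (a t ω)) t (s ω)).x) = fun ω => (s ω).x - lam t • ContinuousLinearMap.adjoint
          (MVRC.step (constParams τ α β lam) f (fun _ => 0) G (bt t (a t ω)) t (s ω)).jEst
          (gradient f (MVRC.step (constParams τ α β lam) f (fun _ => 0) G
            (bt t (a t ω)) t (s ω)).gEst) :=
      funext fun ω => prox_zero_fun hlam _
    rw [e]
    exact h.x.sub (hd.const_smul (lam t))
  exact ⟨hx, hz.add ((hx.sub h.x).const_smul (β / lam t)), hz, hge, hje⟩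

variable [mΩ : MeasurableSpace Ω] {μ : Measure Ω} {𝓕 : ℕ → MeasurableSpace Ω} {X0 : Ω → Vec d}

theorem isMeasState_run (hs : IsSeedSeq μ 𝓕 a) (hX0 : Measurable[𝓕 0] X0)
    (hf : Continuous (gradient f)) (hlam : ∀ t, 0 < lam t)
    (hg : ∀ t, Measurable fun r : X × Vec d => batchMean (bt t r.1) (fun ξ => G ξ r.2))
    (hJ : ∀ t, Measurable fun r : X × Vec d => batchMean (bt t r.1) (fun ξ => fderiv ℝ (G ξ) r.2))
    (t : ℕ) :
    IsMeasState (𝓕 t) fun ω =>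
      run (constParams τ α β lam) f (fun _ => 0) G (X0 ω) (fun t => bt t (a t ω)) t := by
  induction t with
  | zero => exact ⟨hX0, hX0, hX0, measurable_const, measurable_const⟩
  | succ t ih =>
    exact (ih.mono (hs.mono (Nat.le_succ t))).step hf (hlam t) (hg t) (hJ t) (hs.meas t)

/-- `z t` is formed from `x t` and `y t` alone, so it is known before batch `t` is drawn, although
it is stored in the state after iteration `t`. This is what makes it independent of that batch. -/
theorem measurable_zPoint (hs : IsSeedSeq μ 𝓕 a) (hX0 : Measurable[𝓕 0] X0)
    (hf : Continuous (gradient f)) (hlam : ∀ t, 0 < lam t)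
    (hg : ∀ t, Measurable fun r : X × Vec d => batchMean (bt t r.1) (fun ξ => G ξ r.2))
    (hJ : ∀ t, Measurable fun r : X × Vec d => batchMean (bt t r.1) (fun ξ => fderiv ℝ (G ξ) r.2))
    (t : ℕ) :
    Measurable[𝓕 t] fun ω =>
      zPoint (constParams τ α β lam) f (fun _ => 0) G (X0 ω) (fun t => bt t (a t ω)) t :=
  have h := isMeasState_run (τ := τ) (α := α) (β := β) hs hX0 hf hlam hg hJ t
  (h.y.const_smul (1 - α)).add (h.x.const_smul α)

/-- The assumptions on the problem and on one sequence of batches. -/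
structure IsModel (μ : Measure Ω) (τ : ℕ) (a : ℕ → Ω → X) (bt : ℕ → X → Multiset Ξ)
    (f : Vec p → ℝ) (G : Ξ → Vec d → Vec p) (g : Vec d → Vec p) (lf Lf lg Lg V₁ V₂ : ℝ) :
    Prop where
  smooth : IsSmooth f (fun _ : Unit => g) lf Lf lg Lg
  meas_g : ∀ t, Measurable fun r : X × Vec d => batchMean (bt t r.1) (fun ξ => G ξ r.2)
  meas_J : ∀ t, Measurable fun r : X × Vec d =>
    batchMean (bt t r.1) (fun ξ => fderiv ℝ (G ξ) r.2)
  oracle_g : IsOracle μ τ a (fun t x z => batchMean (bt t x) (fun ξ => G ξ z)) g V₁ (lg ^ 2 / τ)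
  oracle_J : IsOracle μ τ a
    (fun t x z => frobVec (batchMean (bt t x) (fun ξ => fderiv ℝ (G ξ) z)))
    (fun z => frobVec (fderiv ℝ g z)) V₂ (Lg ^ 2 / τ)

/-- The integrated descent inequality, with the estimation error absorbed. Working with `lintegral`
postpones all integrability questions to the finiteness needed for one cancellation. -/
theorem IsModel.sum_lintegral_sq_gradient_le [IsProbabilityMeasure μ] {V₁ V₂ V : ℝ}
    (hm : IsModel μ τ a bt f G g lf Lf lg Lg V₁ V₂) (hlf : 0 ≤ lf) (hLf : 0 ≤ Lf) (hlg : 0 ≤ lg)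
    (hLg : 0 ≤ Lg) (hV₁ : 0 ≤ V₁) (hV₂ : 0 ≤ V₂)
    (hV : 2 * (lg ^ 2 * Lf ^ 2) * V₁ + 2 * lf ^ 2 * V₂ ≤ V) (hτ : 0 < τ)
    (hc : StepCond α β lf Lf lg Lg) (hlam : ∀ t, β ≤ lam t ∧ lam t ≤ (1 + α) * β)
    (hs : IsSeedSeq μ 𝓕 a) (hX0 : Measurable[𝓕 0] X0) {b : ℝ} (hb : ∀ x, b ≤ f (g x)) (T : ℕ) :
    ENNReal.ofReal (β / 2) * ∑ t ∈ Finset.range T, ∫⁻ ω, ENNReal.ofReal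
      (‖gradient (fun x => f (g x)) (zPoint (constParams τ α β lam) f (fun _ => 0) G (X0 ω)
        (fun t => bt t (a t ω)) t)‖ ^ 2) ∂μ ≤
      ∫⁻ ω, ENNReal.ofReal (f (g (X0 ω)) - b) ∂μ + ENNReal.ofReal (β * (T * V)) := by
  have hβ := hc.be_pos
  have hlam0 : ∀ t, 0 < lam t := fun t => hβ.trans_le (hlam t).1
  have hLF := LF_nonneg (lg := lg) hlf hLf hLg
  have hβL := hc.smooth_le hLF
  set P := constParams τ α β lam with hP
  set A : Ω → ℕ → Multiset Ξ := fun ω t => bt t (a t ω) with hA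
  set z : ℕ → Ω → Vec d := fun t ω => zPoint P f (fun _ => 0) G (X0 ω) (A ω) t with hz
  set D : ℕ → Ω → Vec d := fun t ω => direction P f (fun _ => 0) G (X0 ω) (A ω) t with hD
  set ge : ℕ → Ω → Vec p := fun t ω => (run P f (fun _ => 0) G (X0 ω) (A ω) (t + 1)).gEst with hge
  set je : ℕ → Ω → Vec d →L[ℝ] Vec p :=
    fun t ω => (run P f (fun _ => 0) G (X0 ω) (A ω) (t + 1)).jEst with hje
  have hmf := hm.smooth.continuous_gradient
  have mrun := isMeasState_run (τ := τ) (α := α) (β := β) hs hX0 hmf hlam0 hm.meas_g hm.meas_J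
  have mz : ∀ t, Measurable[𝓕 t] (z t) :=
    measurable_zPoint (τ := τ) (α := α) (β := β) hs hX0 hmf hlam0 hm.meas_g hm.meas_J
  have mz' : ∀ t, Measurable (z t) := fun t => (mz t).mono (hs.le t) le_rfl
  have mge : ∀ t, Measurable[𝓕 (t + 1)] (ge t) := fun t => (mrun (t + 1)).g
  have mje : ∀ t, Measurable[𝓕 (t + 1)] (je t) := fun t => (mrun (t + 1)).j
  have mD : ∀ t, Measurable (D t) := fun t =>
    (measurable_adjoint_apply (mje t) (hmf.measurable.comp (mge t))).mono (hs.le _) le_rfl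
  have mgrad : Measurable (gradient (fun x => f (g x))) :=
    (hm.smooth.continuous_gradient_comp hlf hLf hlg ()).measurable
  have mg : Measurable g := (hm.smooth.diff_g ()).continuous.measurable
  have mfJ : Measurable fun z => frobVec (fderiv ℝ g z) :=
    (frobVec.continuous.comp (hm.smooth.continuous_fderiv ())).measurable
  -- the estimation errors
  set Eg : ℕ → ENNReal := fun t => ∫⁻ ω, ENNReal.ofReal (‖ge t ω - g (z t ω)‖ ^ 2) ∂μ with hEg
  set EJ : ℕ → ENNReal := fun t =>
    ∫⁻ ω, ENNReal.ofReal (‖frobVec (je t ω) - frobVec (fderiv ℝ g (z t ω))‖ ^ 2) ∂μ with hEJ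
  set EZ : ℕ → ENNReal := fun t => ∫⁻ ω, ENNReal.ofReal (‖z (t + 1) ω - z t ω‖ ^ 2) ∂μ with hEZ
  set ED : ℕ → ENNReal := fun t => ∫⁻ ω, ENNReal.ofReal (‖D t ω‖ ^ 2) ∂μ with hED
  -- The weights with which errors in `g` and `g'` enter the squared gradient error, by
  -- `IsSmooth.sq_norm_adjoint_sub_le`.
  set k₁ : ℝ := 2 * (lg ^ 2 * Lf ^ 2) with hk₁
  set k₂ : ℝ := 2 * lf ^ 2 with hk₂
  have hk₁0 : 0 ≤ k₁ := by positivity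
  have hk₂0 : 0 ≤ k₂ := by positivity
  set Er : ℕ → ENNReal := fun t => ENNReal.ofReal k₁ * Eg t + ENNReal.ofReal k₂ * EJ t with hEr
  have mJ' : ∀ t, Measurable fun r : X × Vec d =>
      frobVec (batchMean (bt t r.1) (fun ξ => fderiv ℝ (G ξ) r.2)) :=
    fun t => frobVec.continuous.measurable.comp (hm.meas_J t)
  have mfe : ∀ t, Measurable[𝓕 (t + 1)] fun ω => frobVec (je t ω) :=
    fun t => frobVec.continuous.measurable.comp (mje t)
  have h0 : ∀ t, t % τ = 0 → Er t ≤ ENNReal.ofReal V := by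
    intro t ht
    have h1 : Eg t ≤ ENNReal.ofReal V₁ :=
      hm.oracle_g.lintegral_refresh_le hs hm.meas_g mg mz t ht fun ω => by
        simp only [hge, run, step, hP, constParams, ht, if_true]; rfl
    have h2 : EJ t ≤ ENNReal.ofReal V₂ :=
      hm.oracle_J.lintegral_refresh_le (est := fun t ω => frobVec (je t ω)) hs mJ' mfJ mz t ht
        fun ω => by
          simp only [hje, run, step, hP, constParams, ht, if_true]; rfl
    calc Er t ≤ ENNReal.ofReal k₁ * ENNReal.ofReal V₁ + ENNReal.ofReal k₂ * ENNReal.ofReal V₂ := by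
          simp only [hEr]; gcongr
      _ = ENNReal.ofReal (k₁ * V₁ + k₂ * V₂) := by
          rw [← ENNReal.ofReal_mul hk₁0, ← ENNReal.ofReal_mul hk₂0,
            ENNReal.ofReal_add (by positivity) (by positivity)]
      _ ≤ _ := ENNReal.ofReal_le_ofReal hV
  have hτ0 : (0 : ℝ) < τ := by exact_mod_cast hτ
  -- `G0` arises here: `k₁ lg² + k₂ Lg² = G0`.
  have h1 : ∀ t, (t + 1) % τ ≠ 0 →
      Er (t + 1) ≤ Er t + ENNReal.ofReal (G0 lf Lf lg Lg / τ) * EZ t := by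
    intro t ht
    have h1 : Eg (t + 1) ≤ Eg t + ENNReal.ofReal (lg ^ 2 / τ) * EZ t :=
      hm.oracle_g.lintegral_update_le hs hm.meas_g mg mz mge t ht fun ω => by
        rw [← batchMean_sub]
        simp only [hge, run, step, hP, constParams, ht, if_false]; rfl
    have h2 : EJ (t + 1) ≤ EJ t + ENNReal.ofReal (Lg ^ 2 / τ) * EZ t :=
      hm.oracle_J.lintegral_update_le (est := fun t ω => frobVec (je t ω)) hs mJ' mfJ mz mfe t ht
        fun ω => by
          rw [← map_sub, ← batchMean_sub, ← map_add]
          simp only [hje, run, step, hP, constParams, ht, if_false]; rfl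
    calc Er (t + 1) ≤ ENNReal.ofReal k₁ * (Eg t + ENNReal.ofReal (lg ^ 2 / τ) * EZ t)
          + ENNReal.ofReal k₂ * (EJ t + ENNReal.ofReal (Lg ^ 2 / τ) * EZ t) := by
          simp only [hEr]; gcongr
      _ = Er t + (ENNReal.ofReal k₁ * ENNReal.ofReal (lg ^ 2 / τ)
          + ENNReal.ofReal k₂ * ENNReal.ofReal (Lg ^ 2 / τ)) * EZ t := by
          simp only [hEr]; ring
      _ = _ := by
          rw [← ENNReal.ofReal_mul hk₁0, ← ENNReal.ofReal_mul hk₂0,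
            ← ENNReal.ofReal_add (by positivity) (by positivity)]
          congr 3
          rw [G0]; field_simp; ring
  have hG0 : 0 ≤ G0 lf Lf lg Lg := by unfold G0; positivity
  have mN : ∀ t, Measurable fun ω =>
      ENNReal.ofReal (‖gradient (fun x => f (g x)) (z t ω)‖ ^ 2) := fun t =>
    ((mgrad.comp (mz' t)).norm.pow_const 2).ennreal_ofReal
  have mD2 : ∀ t, Measurable fun ω => ENNReal.ofReal (‖D t ω‖ ^ 2) := fun t =>
    ((mD t).norm.pow_const 2).ennreal_ofReal
  have mE2 : ∀ t, Measurable fun ω =>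
      ENNReal.ofReal (‖D t ω - gradient (fun x => f (g x)) (z t ω)‖ ^ 2) := fun t =>
    (((mD t).sub (mgrad.comp (mz' t))).norm.pow_const 2).ennreal_ofReal
  have mZ2 : ∀ t, Measurable fun ω => ENNReal.ofReal (‖z (t + 1) ω - z t ω‖ ^ 2) := fun t =>
    (((mz' (t + 1)).sub (mz' t)).norm.pow_const 2).ennreal_ofReal
  -- pathwise inequalities
  have hmom := fun ω => isMomentumSeq_run (α := α) (β := β) (τ := τ) (f := f) (G := G) hβ
    (fun t => (hlam t).1) (X0 ω) (A ω)
  have hZD : ∀ T, ∑ t ∈ Finset.range T, EZ t ≤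
      ENNReal.ofReal (4 * β ^ 2) * ∑ t ∈ Finset.range T, ED t := by
    intro T
    simp only [hEZ, hED]
    rw [← lintegral_finsetSum _ fun t _ => mZ2 t, ← lintegral_finsetSum _ fun t _ => mD2 t,
      ← lintegral_const_mul _ (Finset.measurable_sum _ fun t _ => mD2 t)]
    refine lintegral_mono fun ω => ?_
    rw [← ENNReal.ofReal_sum_of_nonneg fun _ _ => sq_nonneg _,
      ← ENNReal.ofReal_sum_of_nonneg fun _ _ => sq_nonneg _, ← ENNReal.ofReal_mul (by positivity)]
    exact ENNReal.ofReal_le_ofReal ((hmom ω).sum_sq_step_le hc.al_pos hc.al_le hlam T)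
  have herr : ∀ t, ∫⁻ ω, ENNReal.ofReal
      (‖D t ω - gradient (fun x => f (g x)) (z t ω)‖ ^ 2) ∂μ ≤ Er t := by
    intro t
    have m1 : Measurable fun ω => ENNReal.ofReal (‖ge t ω - g (z t ω)‖ ^ 2) :=
      ((((mge t).mono (hs.le _) le_rfl).sub (mg.comp (mz' t))).norm.pow_const 2).ennreal_ofReal
    have m2 : Measurable fun ω =>
        ENNReal.ofReal (‖frobVec (je t ω) - frobVec (fderiv ℝ g (z t ω))‖ ^ 2) :=
      ((((mfe t).mono (hs.le _) le_rfl).sub (mfJ.comp (mz' t))).norm.pow_const 2).ennreal_ofReal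
    simp only [hEr, hEg, hEJ]
    rw [← lintegral_const_mul _ m1, ← lintegral_const_mul _ m2,
      ← lintegral_add_left (m1.const_mul _)]
    refine lintegral_mono fun ω => ?_
    rw [← ENNReal.ofReal_mul hk₁0, ← ENNReal.ofReal_mul hk₂0,
      ← ENNReal.ofReal_add (by positivity) (by positivity)]
    exact ENNReal.ofReal_le_ofReal (hm.smooth.sq_norm_adjoint_sub_le hlf hlg () _ _ _)
  -- finiteness of the second moments
  have hfin : ∀ t, ED t < ⊤ := by
    intro t
    induction t using Nat.strong_induction_on with
    | _ t ih =>
      have h2 : Er t < ⊤ := by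
        refine (periodic_error_le_sum_range h0 h1 t).trans_lt ?_
        refine ENNReal.add_lt_top.2 ⟨ENNReal.ofReal_lt_top, ENNReal.mul_lt_top
          ENNReal.ofReal_lt_top ((hZD t).trans_lt (ENNReal.mul_lt_top ENNReal.ofReal_lt_top ?_))⟩
        exact ENNReal.sum_lt_top.2 fun s hs => ih s (Finset.mem_range.1 hs)
      -- The direction is a true gradient, bounded by `lg * lf`, plus an error that is controlled by
      -- the directions before time `t`.
      have h3 : ED t ≤ ENNReal.ofReal (2 * (lg * lf) ^ 2) + ENNReal.ofReal 2 * Er t := by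
        calc ED t ≤ ∫⁻ ω, (ENNReal.ofReal (2 * (lg * lf) ^ 2) + ENNReal.ofReal 2 * ENNReal.ofReal
              (‖D t ω - gradient (fun x => f (g x)) (z t ω)‖ ^ 2)) ∂μ := by
              refine lintegral_mono fun ω => ?_
              rw [← ENNReal.ofReal_mul (by norm_num),
                ← ENNReal.ofReal_add (by positivity) (by positivity)]
              refine ENNReal.ofReal_le_ofReal ?_
              have h4 := hm.smooth.norm_gradient_comp_le hlf hlg () (z t ω)
              have h5 : ‖D t ω‖ ≤ ‖D t ω - gradient (fun x => f (g x)) (z t ω)‖ + lg * lf := by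
                have := norm_add_le (D t ω - gradient (fun x => f (g x)) (z t ω))
                  (gradient (fun x => f (g x)) (z t ω))
                rw [sub_add_cancel] at this
                linarith
              have h6 := pow_le_pow_left₀ (norm_nonneg _) h5 2
              nlinarith [sq_nonneg (‖D t ω - gradient (fun x => f (g x)) (z t ω)‖ - lg * lf)]
          _ = ENNReal.ofReal (2 * (lg * lf) ^ 2) + ENNReal.ofReal 2 * ∫⁻ ω, ENNReal.ofReal
              (‖D t ω - gradient (fun x => f (g x)) (z t ω)‖ ^ 2) ∂μ := by
              rw [lintegral_add_left measurable_const, lintegral_const_mul _ (mE2 t)]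
              rw [lintegral_const, measure_univ, mul_one]
          _ ≤ _ := by gcongr; exact herr t
      exact h3.trans_lt (ENNReal.add_lt_top.2
        ⟨ENNReal.ofReal_lt_top, ENNReal.mul_lt_top ENNReal.ofReal_lt_top h2⟩)
  have hSD : ∑ t ∈ Finset.range T, ED t < ⊤ := ENNReal.sum_lt_top.2 fun t _ => hfin t
  -- The epoch length `τ` cancels the batch size in `G0 / τ`, and `StepCond.variance_le` bounds what
  -- remains.
  have hEr' : ENNReal.ofReal β * ∑ t ∈ Finset.range T, Er t ≤
      ENNReal.ofReal (β * (T * V)) + ENNReal.ofReal (1 / 8 * β) * ∑ t ∈ Finset.range T, ED t := by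
    calc ENNReal.ofReal β * ∑ t ∈ Finset.range T, Er t
        ≤ ENNReal.ofReal β * (T * ENNReal.ofReal V + ENNReal.ofReal (G0 lf Lf lg Lg / τ) * τ *
          (ENNReal.ofReal (4 * β ^ 2) * ∑ t ∈ Finset.range T, ED t)) := by
          gcongr
          refine (sum_periodic_error_le hτ h0 h1 T).trans ?_
          gcongr
          exact hZD T
      _ = ENNReal.ofReal (β * (T * V)) + ENNReal.ofReal (β * (G0 lf Lf lg Lg / τ * τ * (4 * β ^ 2)))
          * ∑ t ∈ Finset.range T, ED t := by
          rw [ENNReal.ofReal_mul hβ.le, ENNReal.ofReal_mul (Nat.cast_nonneg _),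
            ENNReal.ofReal_natCast, ENNReal.ofReal_mul (q := _ * (4 * β ^ 2)) hβ.le,
            ENNReal.ofReal_mul (q := 4 * β ^ 2) (by positivity),
            ENNReal.ofReal_mul (q := (τ : ℝ)) (by positivity), ENNReal.ofReal_natCast]
          ring
      _ ≤ _ := by
          refine add_le_add le_rfl (mul_le_mul' (ENNReal.ofReal_le_ofReal ?_) le_rfl)
          rw [div_mul_cancel₀ _ hτ0.ne']
          nlinarith [hc.variance_le hLF]
  -- integrate the descent inequality
  have mX : Measurable X0 := hX0.mono (hs.le 0) le_rfl
  have mF : Measurable fun ω => ENNReal.ofReal (f (g (X0 ω)) - b) :=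
    (((hm.smooth.differentiable_comp ()).continuous.measurable.comp mX).sub_const b).ennreal_ofReal
  have hmain : ENNReal.ofReal (β / 2) * ∑ t ∈ Finset.range T, ∫⁻ ω, ENNReal.ofReal
      (‖gradient (fun x => f (g x)) (z t ω)‖ ^ 2) ∂μ
      + ENNReal.ofReal (1 / 8 * β) * ∑ t ∈ Finset.range T, ED t ≤
      ∫⁻ ω, ENNReal.ofReal (f (g (X0 ω)) - b) ∂μ
        + ENNReal.ofReal β * ∑ t ∈ Finset.range T, ∫⁻ ω, ENNReal.ofReal
          (‖D t ω - gradient (fun x => f (g x)) (z t ω)‖ ^ 2) ∂μ := by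
    rw [← lintegral_finsetSum _ fun t _ => mN t, ← lintegral_finsetSum _ fun t _ => mD2 t,
      ← lintegral_finsetSum _ fun t _ => mE2 t,
      ← lintegral_const_mul _ (Finset.measurable_sum _ fun t _ => mN t),
      ← lintegral_const_mul _ (Finset.measurable_sum _ fun t _ => mD2 t),
      ← lintegral_const_mul _ (Finset.measurable_sum _ fun t _ => mE2 t),
      ← lintegral_add_left ((Finset.measurable_sum _ fun t _ => mN t).const_mul _),
      ← lintegral_add_left mF]
    refine lintegral_mono fun ω => ?_
    have hnn : ∀ v : ℕ → Vec d, 0 ≤ ∑ t ∈ Finset.range T, ‖v t‖ ^ 2 :=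
      fun v => Finset.sum_nonneg fun _ _ => sq_nonneg _
    have hn1 := hnn fun t => gradient (fun x => f (g x)) (z t ω)
    have hn2 := hnn fun t => D t ω
    have hn3 := hnn fun t => D t ω - gradient (fun x => f (g x)) (z t ω)
    rw [← ENNReal.ofReal_sum_of_nonneg fun _ _ => sq_nonneg _,
      ← ENNReal.ofReal_sum_of_nonneg fun _ _ => sq_nonneg _,
      ← ENNReal.ofReal_sum_of_nonneg fun _ _ => sq_nonneg _, ← ENNReal.ofReal_mul (by positivity),
      ← ENNReal.ofReal_mul (by positivity), ← ENNReal.ofReal_mul (by positivity),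
      ← ENNReal.ofReal_add (by positivity) (by positivity),
      ← ENNReal.ofReal_add (sub_nonneg.2 (hb _)) (by positivity)]
    refine ENNReal.ofReal_le_ofReal ?_
    have hd : f (g (run P f (fun _ => 0) G (X0 ω) (A ω) T).x)
        + β / 2 * ∑ t ∈ Finset.range T, ‖gradient (fun x => f (g x)) (z t ω)‖ ^ 2
        + 1 / 8 * β * ∑ t ∈ Finset.range T, ‖D t ω‖ ^ 2 ≤ f (g (X0 ω))
        + β * ∑ t ∈ Finset.range T, ‖D t ω - gradient (fun x => f (g x)) (z t ω)‖ ^ 2 :=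
      (hmom ω).descent hc.al_pos hc.al_le hβ hlam (hm.smooth.differentiable_comp ()) hLF
        (hm.smooth.lip_gradient_comp hlf hLf hlg ()) hβL T
    have hd' := hb (run P f (fun _ => 0) G (X0 ω) (A ω) T).x
    linarith
  -- The same multiple of `∑ ED t` now stands on both sides; it is finite, so it cancels.
  have hfinal := hmain.trans (add_le_add_right
    ((mul_le_mul_right (Finset.sum_le_sum fun t _ => herr t) _).trans hEr') _)
  rw [← add_assoc] at hfinal
  exact (ENNReal.add_le_add_iff_right (ENNReal.mul_lt_top ENNReal.ofReal_lt_top hSD).ne).1 hfinal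

end Run

/-! ### The output of a run -/

section Output

theorem measurable_eval_index {Ω E ι : Type*} {m : MeasurableSpace Ω} [MeasurableSpace E]
    [Countable ι] [MeasurableSpace ι] [MeasurableSingletonClass ι] {z : ι → Ω → E} {ζ : Ω → ι}
    (hz : ∀ t, Measurable (z t)) (hζ : Measurable ζ) : Measurable fun ω => z (ζ ω) ω := by
  have h : Measurable fun r : Ω × ι => z r.2 r.1 := measurable_from_prod_countable_left hz
  exact h.comp (measurable_id.prodMk hζ)

/-- Split according to the value of `ζ`; each event `ζ = t` has probability `1 / T` and is
independent of `z t`. -/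
theorem lintegral_eval_uniform_le {Ω E : Type*} [mΩ : MeasurableSpace Ω] [MeasurableSpace E]
    {μ : Measure Ω} [IsProbabilityMeasure μ] {T : ℕ} {z : ℕ → Ω → E} {ζ : Ω → Fin T}
    (hz : ∀ t, Measurable (z t)) (hζ : Measurable ζ)
    (hunif : ∀ t : Fin T, μ {ω | ζ ω = t} = ((T : ℕ) : ENNReal)⁻¹)
    (hind : ∀ t, IndepFun (z t) ζ μ) {φ : E → ENNReal} (hφ : Measurable φ) :
    ∫⁻ ω, φ (z (ζ ω) ω) ∂μ ≤
      (T : ENNReal)⁻¹ * ∑ t ∈ Finset.range T, ∫⁻ ω, φ (z t ω) ∂μ := by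
  have h1 : ∀ ω, φ (z (ζ ω) ω) = ∑ t : Fin T, if ζ ω = t then φ (z t ω) else 0 := by
    intro ω; simp
  have hm : ∀ t : Fin T, Measurable fun r : E × Fin T => if r.2 = t then φ r.1 else 0 :=
    fun t => Measurable.ite (measurable_snd (measurableSet_singleton t)) (hφ.comp measurable_fst)
      measurable_const
  have mt : ∀ t : Fin T, Measurable fun ω => if ζ ω = t then φ (z t ω) else 0 :=
    fun t => (hm t).comp ((hz t).prodMk hζ)
  simp_rw [h1]
  rw [lintegral_finsetSum _ fun t _ => mt t, Finset.mul_sum,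
    Finset.sum_range fun t => (T : ENNReal)⁻¹ * ∫⁻ ω, φ (z t ω) ∂μ]
  refine Finset.sum_le_sum fun t _ => ?_
  have h2 := lintegral_le_of_indepFun (hz t) hζ (hind t) (hm t)
    (ψ := fun s => (T : ENNReal)⁻¹ * φ s) fun s => by
      have h3 : ∀ ω, (if ζ ω = t then φ s else 0) =
          Set.indicator {ω | ζ ω = t} (fun _ => φ s) ω := fun ω => by
        simp [Set.indicator_apply]
      simp_rw [h3]
      exact (lintegral_indicator_const (s := {ω | ζ ω = t}) (hζ (measurableSet_singleton t))
        (φ s)).trans_le (by rw [hunif, mul_comm])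
  exact h2.trans_eq (lintegral_const_mul _ (hφ.comp (hz t)))

variable {d p : ℕ} {Ξ X Ω : Type*} {f : Vec p → ℝ} {G : Ξ → Vec d → Vec p} {g : Vec d → Vec p}
  {lf Lf lg Lg α β : ℝ} {lam : ℕ → ℝ} {τ : ℕ} [mX : MeasurableSpace X] {bt : ℕ → X → Multiset Ξ}
  {a : ℕ → Ω → X} [mΩ : MeasurableSpace Ω] {μ : Measure Ω} {𝓕 : ℕ → MeasurableSpace Ω}
  {X0 : Ω → Vec d}

theorem infVal_le {F : Vec d → ℝ} {S : Set (Vec d)} {v : ℝ} (h : GradDominantOn F S v)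
    (x : Vec d) : infVal F ≤ F x := ciInf_le h.bddBelow x

/-- Bounds for a random output point `w` of a run started at `X0`. -/
structure OutputBound (μ : Measure Ω) (F : Vec d → ℝ) (T : ℕ) (β v V : ℝ) (X0 w : Ω → Vec d) :
    Prop where
  int_F : Integrable (fun ω => F (w ω)) μ
  int_grad : Integrable (fun ω => gradient F (w ω)) μ
  int_sq : Integrable (fun ω => ‖gradient F (w ω)‖ ^ 2) μ
  sq_le : ∫ ω, ‖gradient F (w ω)‖ ^ 2 ∂μ ≤
    2 / (T * β) * (∫ ω, F (X0 ω) ∂μ - infVal F) + 2 * V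
  gap_le : ∫ ω, F (w ω) ∂μ - infVal F ≤ v / 2 * ∫ ω, ‖gradient F (w ω)‖ ^ 2 ∂μ

/-- Averaging the summed gradient bound over the independent output index divides it by `T β / 2`;
gradient dominance applies because the query points stay in `S` almost surely. -/
theorem IsModel.outputBound [IsProbabilityMeasure μ] {V₁ V₂ V : ℝ}
    (hm : IsModel μ τ a bt f G g lf Lf lg Lg V₁ V₂) (hlf : 0 ≤ lf) (hLf : 0 ≤ Lf) (hlg : 0 ≤ lg)
    (hLg : 0 ≤ Lg) (hV₁ : 0 ≤ V₁) (hV₂ : 0 ≤ V₂)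
    (hV : 2 * (lg ^ 2 * Lf ^ 2) * V₁ + 2 * lf ^ 2 * V₂ ≤ V) (hτ : 0 < τ)
    (hc : StepCond α β lf Lf lg Lg) (hlam : ∀ t, β ≤ lam t ∧ lam t ≤ (1 + α) * β)
    (hs : IsSeedSeq μ 𝓕 a) (hX0 : Measurable[𝓕 0] X0) {T : ℕ} (hT : 0 < T) {ζ : Ω → Fin T}
    (hζ : Measurable ζ) (hunif : ∀ t : Fin T, μ {ω | ζ ω = t} = ((T : ℕ) : ENNReal)⁻¹)
    (hind : ∀ t, Indep (𝓕 t) (MeasurableSpace.comap ζ inferInstance) μ)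
    {S : Set (Vec d)} {v : ℝ} (hF : GradDominantOn (fun x => f (g x)) S v)
    (hint : Integrable (fun ω => f (g (X0 ω))) μ)
    (hS : ∀ t < T, ∀ᵐ ω ∂μ, zPoint (constParams τ α β lam) f (fun _ => 0) G (X0 ω)
      (fun t => bt t (a t ω)) t ∈ S) :
    OutputBound μ (fun x => f (g x)) T β v V X0 fun ω => zPoint (constParams τ α β lam) f
      (fun _ => 0) G (X0 ω) (fun t => bt t (a t ω)) (ζ ω) := by
  have hβ := hc.be_pos
  set F : Vec d → ℝ := fun x => f (g x) with hFdef
  have mz := measurable_zPoint (τ := τ) (α := α) (β := β) hs hX0 hm.smooth.continuous_gradient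
    (fun t => hβ.trans_le (hlam t).1) hm.meas_g hm.meas_J
  set z : ℕ → Ω → Vec d := fun t ω => zPoint (constParams τ α β lam) f (fun _ => 0) G (X0 ω)
    (fun t => bt t (a t ω)) t with hz
  have mz' : ∀ t, Measurable (z t) := fun t => (mz t).mono (hs.le t) le_rfl
  have hwm : Measurable fun ω => z (ζ ω) ω :=
    measurable_eval_index (z := fun t : Fin T => z t) (fun t => mz' t) hζ
  have cF : Continuous F := (hm.smooth.differentiable_comp ()).continuous
  have cg : Continuous (gradient F) := hm.smooth.continuous_gradient_comp hlf hLf hlg ()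
  have hgb : ∀ x, ‖gradient F x‖ ≤ lg * lf := hm.smooth.norm_gradient_comp_le hlf hlg ()
  have hgb2 : ∀ x, ‖gradient F x‖ ^ 2 ≤ (lg * lf) ^ 2 :=
    fun x => pow_le_pow_left₀ (norm_nonneg _) (hgb x) 2
  have hwS : ∀ᵐ ω ∂μ, z (ζ ω) ω ∈ S := by
    have : ∀ᵐ ω ∂μ, ∀ t : Fin T, z t ω ∈ S := ae_all_iff.2 fun t => hS t t.2
    exact this.mono fun ω h => h (ζ ω)
  have hdom : ∀ᵐ ω ∂μ, F (z (ζ ω) ω) - infVal F ≤ v / 2 * ‖gradient F (z (ζ ω) ω)‖ ^ 2 :=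
    hwS.mono fun ω h => hF.dom _ h
  -- `F` is not assumed bounded, but on `S` dominance bounds its gap by the bounded gradient.
  have iF : Integrable (fun ω => F (z (ζ ω) ω)) μ := by
    refine Integrable.of_bound (C := |infVal F| + v / 2 * (lg * lf) ^ 2)
      (cF.measurable.comp hwm).aestronglyMeasurable (hdom.mono fun ω h => ?_)
    have h1 := infVal_le hF (z (ζ ω) ω)
    have h2 := mul_le_mul_of_nonneg_left (hgb2 (z (ζ ω) ω)) (half_pos hF.pos).le
    rw [Real.norm_eq_abs, abs_le]
    constructor
    · nlinarith [neg_abs_le (infVal F), mul_nonneg (half_pos hF.pos).le (sq_nonneg (lg * lf))]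
    · linarith [le_abs_self (infVal F)]
  have ig : Integrable (fun ω => gradient F (z (ζ ω) ω)) μ :=
    Integrable.of_bound (C := lg * lf) (cg.measurable.comp hwm).aestronglyMeasurable
      (Filter.Eventually.of_forall fun ω => hgb _)
  have isq : Integrable (fun ω => ‖gradient F (z (ζ ω) ω)‖ ^ 2) μ := by
    refine Integrable.of_bound (C := (lg * lf) ^ 2)
      ((cg.measurable.comp hwm).norm.pow_const 2).aestronglyMeasurable
      (Filter.Eventually.of_forall fun ω => ?_)
    rw [Real.norm_of_nonneg (sq_nonneg _)]
    exact hgb2 _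
  refine ⟨iF, ig, isq, ?_, ?_⟩
  · have h1 : ENNReal.ofReal (β / 2) * ∑ t ∈ Finset.range T,
        ∫⁻ ω, ENNReal.ofReal (‖gradient F (z t ω)‖ ^ 2) ∂μ ≤
        ∫⁻ ω, ENNReal.ofReal (F (X0 ω) - infVal F) ∂μ + ENNReal.ofReal (β * (T * V)) :=
      hm.sum_lintegral_sq_gradient_le hlf hLf hlg hLg hV₁ hV₂ hV hτ hc hlam hs hX0 (infVal_le hF) T
    have h5 : ∫⁻ ω, ENNReal.ofReal (F (X0 ω) - infVal F) ∂μ =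
        ENNReal.ofReal (∫ ω, F (X0 ω) ∂μ - infVal F) := by
      have h6 := ofReal_integral_eq_lintegral_ofReal (hint.sub (integrable_const (infVal F)))
        (Filter.Eventually.of_forall fun ω => sub_nonneg.2 (infVal_le hF (X0 ω)))
      refine h6.symm.trans (congrArg _ ?_)
      exact (integral_sub hint (integrable_const _)).trans (by simp [hFdef])
    have h2 := lintegral_eval_uniform_le mz' hζ hunif
      (fun t => indepFun_of_indep_comap (hind t) (mz t))
      (φ := fun x => ENNReal.ofReal (‖gradient F x‖ ^ 2))
      (cg.measurable.norm.pow_const 2).ennreal_ofReal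
    rw [← ofReal_integral_eq_lintegral_ofReal isq
      (Filter.Eventually.of_forall fun ω => sq_nonneg _)] at h2
    have hT0 : (T : ENNReal) ≠ 0 := by exact_mod_cast hT.ne'
    have hTr : (0 : ℝ) < T := by exact_mod_cast hT
    have hV0 : 0 ≤ V := le_trans (by positivity) hV
    have h0 : 0 ≤ ∫ ω, F (X0 ω) ∂μ - infVal F := by
      have : ∫ _ω, infVal F ∂μ ≤ ∫ ω, F (X0 ω) ∂μ :=
        integral_mono (integrable_const _) hint fun ω => infVal_le hF (X0 ω)
      simpa using this
    have h3 : ENNReal.ofReal (β / 2 * (T * ∫ ω, ‖gradient F (z (ζ ω) ω)‖ ^ 2 ∂μ)) ≤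
        ENNReal.ofReal ((∫ ω, F (X0 ω) ∂μ - infVal F) + β * (T * V)) := by
      rw [ENNReal.ofReal_add h0 (by positivity), ENNReal.ofReal_mul (by positivity),
        ENNReal.ofReal_mul (Nat.cast_nonneg _), ENNReal.ofReal_natCast]
      refine le_trans (mul_le_mul_right ?_ _) (h1.trans_eq (by rw [h5]))
      refine (mul_le_mul_right h2 _).trans_eq ?_
      rw [← mul_assoc, ENNReal.mul_inv_cancel hT0 (ENNReal.natCast_ne_top T), one_mul]
    have h4 := (ENNReal.ofReal_le_ofReal_iff (by positivity)).1 h3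
    have e : 2 / (T * β) * (∫ ω, F (X0 ω) ∂μ - infVal F) + 2 * V =
        ((∫ ω, F (X0 ω) ∂μ - infVal F) + β * (T * V)) / (β / 2 * T) := by
      field_simp
    rw [e, le_div_iff₀ (by positivity)]
    linarith
  · have h1 : ∫ ω, (F (z (ζ ω) ω) - infVal F) ∂μ ≤
        ∫ ω, v / 2 * ‖gradient F (z (ζ ω) ω)‖ ^ 2 ∂μ :=
      integral_mono_ae (iF.sub (integrable_const _)) (isq.const_mul _) hdom
    rw [integral_sub iF (integrable_const _), integral_const_mul] at h1
    simpa using h1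

end Output

/-! ### Independence of the random choices -/

section Seeds

/-- A finite intersection splits into its part from each family; independence of the two suprema
separates the parts, and independence within each family finishes. -/
theorem iIndep_sum {Ω ι κ : Type*} {mΩ : MeasurableSpace Ω} {μ : Measure Ω}
    {mA : ι → MeasurableSpace Ω} {mB : κ → MeasurableSpace Ω} (hA : iIndep mA μ)
    (hB : iIndep mB μ) (h : Indep (⨆ i, mA i) (⨆ k, mB k) μ) : iIndep (Sum.elim mA mB) μ := by
  classical
  rw [iIndep_iff] at hA hB ⊢
  rw [Indep_iff] at h
  intro s u hu
  have hl : ∀ i ∈ s.toLeft, MeasurableSet[mA i] (u (Sum.inl i)) :=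
    fun i hi => hu _ (Finset.mem_toLeft.1 hi)
  have hr : ∀ k ∈ s.toRight, MeasurableSet[mB k] (u (Sum.inr k)) :=
    fun k hk => hu _ (Finset.mem_toRight.1 hk)
  have e : ⋂ i ∈ s, u i = (⋂ i ∈ s.toLeft, u (Sum.inl i)) ∩ ⋂ k ∈ s.toRight, u (Sum.inr k) := by
    ext ω; simp
  have hp : ∏ i ∈ s, μ (u i) =
      (∏ i ∈ s.toLeft, μ (u (Sum.inl i))) * ∏ k ∈ s.toRight, μ (u (Sum.inr k)) := by
    conv_lhs => rw [← Finset.toLeft_disjSum_toRight (u := s)]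
    rw [Finset.prod_disjSum]
  rw [e, hp, ← hA _ hl, ← hB _ hr]
  refine h _ _ ?_ ?_
  · exact Finset.measurableSet_biInter _ fun i hi => le_iSup mA i _ (hl i hi)
  · exact Finset.measurableSet_biInter _ fun k hk => le_iSup mB k _ (hr k hk)

theorem comap_pi_eq_iSup {Ω ι : Type*} {β : ι → Type*} [m : ∀ i, MeasurableSpace (β i)]
    (X : ∀ i, Ω → β i) : MeasurableSpace.comap (fun ω i => X i ω) MeasurableSpace.pi =
      ⨆ i, (m i).comap (X i) := by
  rw [MeasurableSpace.pi, MeasurableSpace.comap_iSup]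
  simp only [MeasurableSpace.comap_comp]
  rfl

variable {Ω X R : Type*} [mΩ : MeasurableSpace Ω] [mX : MeasurableSpace X] {T : ℕ}

/-- The information in each of the batches and of the output indices. -/
@[reducible] def seedAlgebra (a : R → ℕ → Ω → X) (ζ : R → Ω → Fin T) :
    (R × ℕ) ⊕ R → MeasurableSpace Ω :=
  Sum.elim (fun q => mX.comap (a q.1 q.2)) fun ρ => MeasurableSpace.comap (ζ ρ) inferInstance

/-- Independent batches and independent uniform output indices. -/
structure IndepSeeds (μ : Measure Ω) (a : R → ℕ → Ω → X) (ζ : R → Ω → Fin T) : Prop where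
  meas_a : ∀ ρ t, Measurable (a ρ t)
  meas_ζ : ∀ ρ, Measurable (ζ ρ)
  unif_ζ : ∀ ρ (t : Fin T), μ {ω | ζ ρ ω = t} = ((T : ℕ) : ENNReal)⁻¹
  indep : ∀ i, Indep (⨆ j ∈ ({i}ᶜ : Set _), seedAlgebra a ζ j) (seedAlgebra a ζ i) μ

variable {μ : Measure Ω} {a : R → ℕ → Ω → X} {ζ : R → Ω → Fin T}

theorem IndepSeeds.seedAlgebra_le (h : IndepSeeds μ a ζ) (i : (R × ℕ) ⊕ R) :
    seedAlgebra a ζ i ≤ mΩ := by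
  rcases i with q | ρ
  · exact (h.meas_a q.1 q.2).comap_le
  · exact (h.meas_ζ ρ).comap_le

theorem IndepSeeds.indep_iSup (h : IndepSeeds μ a ζ) {i : (R × ℕ) ⊕ R} {J : Set ((R × ℕ) ⊕ R)}
    (hi : i ∉ J) : Indep (⨆ j ∈ J, seedAlgebra a ζ j) (seedAlgebra a ζ i) μ :=
  indep_of_indep_of_le_left (h.indep i)
    (biSup_mono fun j hj => by rintro rfl; exact hi hj)

variable [LinearOrder R]

/-- The random choices made before iteration `t` of run `ρ`. -/
def seedPast (ρ : R) (t : ℕ) : Set ((R × ℕ) ⊕ R) :=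
  {i | Sum.elim (fun q => q.1 < ρ ∨ q.1 = ρ ∧ q.2 < t) (fun r => r < ρ) i}

/-- The information available before iteration `t` of run `ρ`. -/
@[reducible] def seedFiltration (a : R → ℕ → Ω → X) (ζ : R → Ω → Fin T) (ρ : R) (t : ℕ) :
    MeasurableSpace Ω := ⨆ j ∈ seedPast ρ t, seedAlgebra a ζ j

theorem IndepSeeds.isSeedSeq (h : IndepSeeds μ a ζ) (ρ : R) :
    IsSeedSeq μ (seedFiltration a ζ ρ) (a ρ) where
  mono s t hst := biSup_mono fun j hj => by
    rcases j with q | r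
    · exact hj.imp id fun hq => ⟨hq.1, hq.2.trans_le hst⟩
    · exact hj
  le t := iSup₂_le fun j _ => h.seedAlgebra_le j
  meas t := by
    rw [measurable_iff_comap_le]
    exact le_biSup (seedAlgebra a ζ)
      (show Sum.inl (ρ, t) ∈ seedPast ρ (t + 1) from Or.inr ⟨rfl, Nat.lt_succ_self t⟩)
  indep t := h.indep_iSup (i := Sum.inl (ρ, t)) fun hc => by
    rcases hc with hc | hc
    · exact lt_irrefl _ hc
    · exact lt_irrefl _ hc.2

/-- The output index of a run is not part of the past of any iteration of that run. -/
theorem IndepSeeds.indep_index (h : IndepSeeds μ a ζ) (ρ : R) (t : ℕ) :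
    Indep (seedFiltration a ζ ρ t) (MeasurableSpace.comap (ζ ρ) inferInstance) μ :=
  h.indep_iSup (i := Sum.inr ρ) fun hc => lt_irrefl ρ hc

end Seeds

/-! ### Passing information from one run to the next. -/

section SeedsNat

variable {Ω X : Type*} [mX : MeasurableSpace X] {T : ℕ}

theorem seedFiltration_le_succ {a : ℕ → ℕ → Ω → X} {ζ : ℕ → Ω → Fin T} (m t : ℕ) :
    seedFiltration a ζ m t ≤ seedFiltration a ζ (m + 1) 0 :=
  biSup_mono fun j hj => by
    rcases j with q | r
    · left
      rcases hj with hj | hj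
      · exact hj.trans (Nat.lt_succ_self m)
      · exact hj.1 ▸ Nat.lt_succ_self m
    · exact Nat.lt_trans hj (Nat.lt_succ_self m)

theorem measurable_index_succ {a : ℕ → ℕ → Ω → X} {ζ : ℕ → Ω → Fin T} (m : ℕ) :
    Measurable[seedFiltration a ζ (m + 1) 0] (ζ m) := by
  rw [measurable_iff_comap_le]
  exact le_biSup (seedAlgebra a ζ)
    (show Sum.inr m ∈ seedPast (m + 1) 0 from Nat.lt_succ_self m)

end SeedsNat

/-! ### Restarts -/

section Restart

variable {d p : ℕ} {Ξ X Ω : Type*} {f : Vec p → ℝ} {G : Ξ → Vec d → Vec p} {g : Vec d → Vec p}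
  {lf Lf lg Lg α β : ℝ} {lam : ℕ → ℝ} {τ : ℕ} [mX : MeasurableSpace X] {bt : ℕ → X → Multiset Ξ}
  [mΩ : MeasurableSpace Ω] {μ : Measure Ω} {T : ℕ} {a : ℕ → ℕ → Ω → X} {ζ : ℕ → Ω → Fin T}

/-- The starting point of run `m` depends only on earlier batches and indices, so it is measurable
for the initial information of that run, as `IsModel.outputBound` requires. -/
theorem outputBound_restart [IsProbabilityMeasure μ] {V₁ V₂ V : ℝ}
    (hm : ∀ m, IsModel μ τ (a m) bt f G g lf Lf lg Lg V₁ V₂) (hlf : 0 ≤ lf) (hLf : 0 ≤ Lf)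
    (hlg : 0 ≤ lg) (hLg : 0 ≤ Lg) (hV₁ : 0 ≤ V₁) (hV₂ : 0 ≤ V₂)
    (hV : 2 * (lg ^ 2 * Lf ^ 2) * V₁ + 2 * lf ^ 2 * V₂ ≤ V) (hτ : 0 < τ)
    (hc : StepCond α β lf Lf lg Lg) (hlam : ∀ t, β ≤ lam t ∧ lam t ≤ (1 + α) * β)
    (hs : IndepSeeds μ a ζ) (hT : 0 < T) {S : Set (Vec d)} {v : ℝ}
    (hF : GradDominantOn (fun x => f (g x)) S v) (x0 : Vec d) {M : ℕ}
    (hS : ∀ m < M, ∀ t < T, ∀ᵐ ω ∂μ, zPoint (constParams τ α β lam) f (fun _ => 0) G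
      (restartPoint (constParams τ α β lam) f (fun _ => 0) G x0 (fun m t => bt t (a m t ω))
        (fun m => ζ m ω) m) (fun t => bt t (a m t ω)) t ∈ S) :
    ∀ m < M, OutputBound μ (fun x => f (g x)) T β v V
      (fun ω => restartPoint (constParams τ α β lam) f (fun _ => 0) G x0
        (fun m t => bt t (a m t ω)) (fun m => ζ m ω) m)
      (fun ω => restartPoint (constParams τ α β lam) f (fun _ => 0) G x0
        (fun m t => bt t (a m t ω)) (fun m => ζ m ω) (m + 1)) := by
  set w : ℕ → Ω → Vec d := fun m ω => restartPoint (constParams τ α β lam) f (fun _ => 0) G x0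
    (fun m t => bt t (a m t ω)) (fun m => ζ m ω) m with hw
  have hlam0 : ∀ t, 0 < lam t := fun t => hc.be_pos.trans_le (hlam t).1
  have hmeas : ∀ m, Measurable[seedFiltration a ζ m 0] (w m) := by
    intro m
    induction m with
    | zero => exact measurable_const
    | succ m ih =>
      have mz := measurable_zPoint (τ := τ) (α := α) (β := β) (hs.isSeedSeq m) ih
        (hm m).smooth.continuous_gradient hlam0 (hm m).meas_g (hm m).meas_J
      exact measurable_eval_index (z := fun (t : Fin T) ω => zPoint (constParams τ α β lam) f
        (fun _ => 0) G (w m ω) (fun t => bt t (a m t ω)) t)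
        (fun t => (mz t).mono (seedFiltration_le_succ m t) le_rfl) (measurable_index_succ m)
  have hstep : ∀ m < M, Integrable (fun ω => f (g (w m ω))) μ →
      OutputBound μ (fun x => f (g x)) T β v V (w m) (w (m + 1)) := fun m hmM hint =>
    (hm m).outputBound hlf hLf hlg hLg hV₁ hV₂ hV hτ hc hlam (hs.isSeedSeq m) (hmeas m) hT
      (hs.meas_ζ m) (hs.unif_ζ m) (hs.indep_index m) hF hint (hS m hmM)
  -- Each run needs an integrable starting value, which the preceding run supplies.
  have hint : ∀ m ≤ M, Integrable (fun ω => f (g (w m ω))) μ := by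
    intro m
    induction m with
    | zero => exact fun _ => integrable_const (f (g x0))
    | succ m ih => exact fun h => (hstep m h (ih (Nat.le_of_succ_le h))).int_F
  exact fun m hmM => hstep m hmM (hint m hmM.le)

/-- Halving of the optimality gap. -/
theorem gap_le_of_outputBound [IsProbabilityMeasure μ] {F : Vec d → ℝ} {v V Δ : ℝ} {M : ℕ}
    {w : ℕ → Ω → Vec d} {x0 : Vec d} (hw : ∀ ω, w 0 ω = x0) (hΔ : F x0 - infVal F ≤ Δ)
    (hΔ0 : 0 ≤ Δ) (hv : 0 ≤ v) (hV : 0 ≤ V) (hβ : 0 < β) (hT : 0 < T) (hvT : 2 * v ≤ T * β)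
    (h : ∀ m < M, OutputBound μ F T β v V (w m) (w (m + 1))) :
    ∀ m ≤ M, ∫ ω, F (w m ω) ∂μ - infVal F ≤ Δ / 2 ^ m + 2 * (v * V) := by
  intro m
  have hTr : (0 : ℝ) < T := by exact_mod_cast hT
  induction m with
  | zero =>
    intro _
    have : 0 ≤ v * V := mul_nonneg hv hV
    simp only [hw, integral_const, probReal_univ, one_smul, pow_zero, div_one]
    linarith
  | succ m ih =>
    intro hmM
    have h1 := ih (Nat.le_of_succ_le hmM)
    have h2 := (h m hmM).gap_le
    have h3 := mul_le_mul_of_nonneg_left (h m hmM).sq_le (show (0:ℝ) ≤ v / 2 by positivity)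
    -- One run maps a gap `δ` to at most `δ / 2 + v V`; the fixed point of this map is `2 v V`.
    have h4 : v / (T * β) ≤ 1 / 2 := by
      rw [div_le_div_iff₀ (by positivity) (by norm_num)]; linarith
    have h5 : 0 ≤ Δ / 2 ^ m + 2 * (v * V) := by positivity
    have h6 : v / (T * β) * (∫ ω, F (w m ω) ∂μ - infVal F) ≤ 1 / 2 * (Δ / 2 ^ m + 2 * (v * V)) :=
      (mul_le_mul_of_nonneg_left h1 (by positivity)).trans (mul_le_mul_of_nonneg_right h4 h5)
    have e : v / 2 * (2 / (T * β) * (∫ ω, F (w m ω) ∂μ - infVal F) + 2 * V) =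
        v / (T * β) * (∫ ω, F (w m ω) ∂μ - infVal F) + v * V := by
      field_simp
    have e2 : Δ / 2 ^ (m + 1) = 1 / 2 * (Δ / 2 ^ m) := by
      rw [pow_succ]; field_simp
    rw [e2]
    linarith

/-- The variance of `‖∇F w‖` is nonnegative. -/
theorem OutputBound.integral_norm_sq_le [IsProbabilityMeasure μ] {F : Vec d → ℝ} {v V : ℝ}
    {X0 w : Ω → Vec d} (h : OutputBound μ F T β v V X0 w) :
    (∫ ω, ‖gradient F (w ω)‖ ∂μ) ^ 2 ≤ ∫ ω, ‖gradient F (w ω)‖ ^ 2 ∂μ := by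
  set c := ∫ ω, ‖gradient F (w ω)‖ ∂μ with hc
  have h1 : 0 ≤ ∫ ω, (‖gradient F (w ω)‖ - c) ^ 2 ∂μ := integral_nonneg fun ω => sq_nonneg _
  have e : ∀ ω, (‖gradient F (w ω)‖ - c) ^ 2 =
      (‖gradient F (w ω)‖ ^ 2 - 2 * c * ‖gradient F (w ω)‖) + c ^ 2 := fun ω => by ring
  simp_rw [e] at h1
  have i1 : Integrable (fun ω => 2 * c * ‖gradient F (w ω)‖) μ := h.int_grad.norm.const_mul _
  have i2 : Integrable (fun ω => ‖gradient F (w ω)‖ ^ 2 - 2 * c * ‖gradient F (w ω)‖) μ :=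
    h.int_sq.sub i1
  rw [integral_add i2 (integrable_const _), integral_sub h.int_sq i1, integral_const_mul,
    ← hc] at h1
  simp only [integral_const, probReal_univ, one_smul] at h1
  nlinarith

end Restart

/-! ### Sampling without replacement -/

section FiniteSampling

/-- Every index lies in equally many subsets of size `b`. -/
theorem sum_powersetCard_sum {ι V : Type*} [Fintype ι] [DecidableEq ι] [AddCommGroup V]
    [Module ℝ V] {b : ℕ} (hb : 1 ≤ b) (u : ι → V) :
    ∑ S ∈ Finset.powersetCard b (Finset.univ : Finset ι), ∑ i ∈ S, u i =
      ((Fintype.card ι - 1).choose (b - 1) : ℝ) • ∑ i, u i := by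
  have h1 : ∀ S : Finset ι, ∑ i ∈ S, u i = ∑ i, if {i} ⊆ S then u i else 0 := by
    intro S
    simp [Finset.sum_ite_mem]
  simp_rw [h1]
  rw [Finset.sum_comm, Finset.smul_sum]
  refine Finset.sum_congr rfl fun i _ => ?_
  rw [← Finset.sum_filter, Finset.sum_const,
    Finset.card_filter_powersetCard_subset _ _ _ (Finset.subset_univ _) (by simpa using hb)]
  simp [Nat.cast_smul_eq_nsmul]

/-- All pairs of distinct indices lie in the same number `c` of subsets. Only `0 ≤ c` matters later,
so its value stays hidden. -/
theorem exists_sum_powersetCard_pairs {ι : Type*} [Fintype ι] [DecidableEq ι] {b : ℕ}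
    (hb : 1 ≤ b) : ∃ c : ℝ, 0 ≤ c ∧ ∀ k : ι → ι → ℝ,
    ∑ S ∈ Finset.powersetCard b (Finset.univ : Finset ι), ∑ i ∈ S, ∑ j ∈ S, k i j =
      (((Fintype.card ι - 1).choose (b - 1) : ℝ) - c) * ∑ i, k i i + c * ∑ i, ∑ j, k i j := by
  obtain ⟨c, hc⟩ : ∃ c : ℕ, ∀ i j : ι, i ≠ j →
      ((Finset.powersetCard b (Finset.univ : Finset ι)).filter ({i, j} ⊆ ·)).card = c := by
    -- For `b = 1` no subset contains a pair, whereas truncated subtraction in `choose (b - 2)`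
    -- would give one.
    by_cases h2 : 2 ≤ b
    · refine ⟨(Fintype.card ι - 2).choose (b - 2), fun i j hij => ?_⟩
      rw [Finset.card_filter_powersetCard_subset _ _ _ (Finset.subset_univ _)
        (by rwa [Finset.card_pair hij]), Finset.card_pair hij, Finset.card_univ]
    · refine ⟨0, fun i j hij => ?_⟩
      rw [Finset.card_eq_zero, Finset.filter_eq_empty_iff]
      intro S hS hsub
      have h3 := Finset.card_le_card hsub
      rw [Finset.card_pair hij, (Finset.mem_powersetCard.1 hS).2] at h3
      exact h2 h3
  refine ⟨c, Nat.cast_nonneg c, fun k => ?_⟩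
  have h1 : ∀ S : Finset ι, ∑ i ∈ S, ∑ j ∈ S, k i j =
      ∑ i, ∑ j, if {i, j} ⊆ S then k i j else 0 := by
    intro S
    rw [← Finset.sum_filter_add_sum_filter_not Finset.univ (· ∈ S) fun i =>
      ∑ j, if {i, j} ⊆ S then k i j else 0]
    rw [Finset.sum_eq_zero (s := Finset.univ.filter (· ∉ S)) fun i hi => ?_, add_zero]
    · simp only [Finset.filter_mem_eq_inter, Finset.univ_inter]
      refine Finset.sum_congr rfl fun i hi => ?_
      simp [Finset.insert_subset_iff, hi, Finset.sum_ite_mem]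
    · have : i ∉ S := (Finset.mem_filter.1 hi).2
      simp [Finset.insert_subset_iff, this]
  rw [Finset.sum_congr rfl fun S _ => h1 S, Finset.sum_comm, Finset.mul_sum, Finset.mul_sum,
    ← Finset.sum_add_distrib]
  refine Finset.sum_congr rfl fun i _ => ?_
  rw [Finset.sum_comm]
  have h2 : ∀ j, ∑ S ∈ Finset.powersetCard b (Finset.univ : Finset ι),
      (if {i, j} ⊆ S then k i j else 0) = c * k i j +
        if i = j then (((Fintype.card ι - 1).choose (b - 1) : ℝ) - c) * k i j else 0 := by
    intro j
    rw [← Finset.sum_filter, Finset.sum_const, nsmul_eq_mul]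
    by_cases hij : i = j
    · subst hij
      rw [if_pos rfl, Finset.pair_eq_singleton, Finset.card_filter_powersetCard_subset _ _ _
        (Finset.subset_univ _) (by simpa using hb), Finset.card_singleton, Finset.card_univ]
      ring
    · rw [hc i j hij, if_neg hij, add_zero]
  simp_rw [h2]
  rw [Finset.sum_add_distrib, Finset.sum_ite_eq, if_pos (Finset.mem_univ i), ← Finset.mul_sum]
  ring

variable {n : ℕ} {H : Type*} [NormedAddCommGroup H] [InnerProductSpace ℝ H]

/-- For centred `Y` the linear term vanishes and so does the full double sum of inner products; only
a diagonal term remains. Discarding `c` means that drawing without replacement is no worse than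
drawing independently. -/
theorem sum_powersetCard_sq_norm_le {b : ℕ} (hb : 1 ≤ b) (hbn : b ≤ n) {Y : Fin n → H}
    (hY : ∑ i, Y i = 0) (e : H) :
    ∑ S ∈ Finset.powersetCard b (Finset.univ : Finset (Fin n)),
      ‖e + (b : ℝ)⁻¹ • ∑ i ∈ S, Y i‖ ^ 2 ≤
      (n.choose b : ℝ) * (‖e‖ ^ 2 + (∑ i, ‖Y i‖ ^ 2) / (b * n)) := by
  have hb0 : (0 : ℝ) < b := by exact_mod_cast hb
  have hn0 : (0 : ℝ) < n := by exact_mod_cast hb.trans hbn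
  have h1 := sum_powersetCard_sum hb Y
  obtain ⟨c, hc, h2⟩ := exists_sum_powersetCard_pairs (ι := Fin n) hb
  have h3 := h2 fun i j => inner ℝ (Y i) (Y j)
  have h4 : ∑ i, ∑ j, inner ℝ (Y i) (Y j) = (0 : ℝ) := by
    simp_rw [← inner_sum, hY, inner_zero_right, Finset.sum_const_zero]
  rw [h4, mul_zero, add_zero] at h3
  rw [hY, smul_zero] at h1
  simp_rw [real_inner_self_eq_norm_sq, ← inner_sum, ← sum_inner,
    real_inner_self_eq_norm_sq, Fintype.card_fin] at h3
  have h5 : ∀ S : Finset (Fin n), ‖e + (b : ℝ)⁻¹ • ∑ i ∈ S, Y i‖ ^ 2 =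
      ‖e‖ ^ 2 + 2 * (b : ℝ)⁻¹ * inner ℝ e (∑ i ∈ S, Y i)
        + ((b : ℝ)⁻¹) ^ 2 * ‖∑ i ∈ S, Y i‖ ^ 2 := by
    intro S
    rw [norm_add_sq_real, inner_smul_right, norm_smul, mul_pow, Real.norm_eq_abs, sq_abs]
    ring
  simp_rw [h5]
  rw [Finset.sum_add_distrib, Finset.sum_add_distrib, ← Finset.mul_sum, ← Finset.mul_sum,
    ← inner_sum, h1, inner_zero_right, mul_zero, add_zero, h3, Finset.sum_const,
    Finset.card_powersetCard, Finset.card_univ, Fintype.card_fin, nsmul_eq_mul, mul_add]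
  have h6 : (n : ℝ) * ((n - 1).choose (b - 1) : ℝ) = (n.choose b : ℝ) * b := by
    have := Nat.add_one_mul_choose_eq (n - 1) (b - 1)
    rw [Nat.sub_add_cancel (hb.trans hbn), Nat.sub_add_cancel hb] at this
    exact_mod_cast this
  have h7 : 0 ≤ ∑ i, ‖Y i‖ ^ 2 := Finset.sum_nonneg fun _ _ => sq_nonneg _
  have h8 : (((n - 1).choose (b - 1) : ℝ) - c) * ∑ i, ‖Y i‖ ^ 2 ≤
      ((n.choose b : ℝ) * b / n) * ∑ i, ‖Y i‖ ^ 2 := by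
    refine mul_le_mul_of_nonneg_right ?_ h7
    rw [← h6, mul_div_cancel_left₀ _ hn0.ne']
    linarith
  have h9 : (n.choose b : ℝ) * ((∑ i, ‖Y i‖ ^ 2) / (b * n)) =
      ((b : ℝ)⁻¹) ^ 2 * (((n.choose b : ℝ) * b / n) * ∑ i, ‖Y i‖ ^ 2) := by
    field_simp
  rw [h9]
  gcongr

variable {Ω : Type*} [MeasurableSpace Ω] {μ : Measure Ω}

theorem lintegral_uniform_subset {b : ℕ} {A : Ω → Finset (Fin n)} (hA : Measurable A)
    (hcard : ∀ ω, (A ω).card = b)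
    (hunif : ∀ S : Finset (Fin n), S.card = b → μ {ω | A ω = S} = ((n.choose b : ℕ) : ENNReal)⁻¹)
    (φ : Finset (Fin n) → ENNReal) :
    ∫⁻ ω, φ (A ω) ∂μ = ((n.choose b : ℕ) : ENNReal)⁻¹ *
      ∑ S ∈ Finset.powersetCard b (Finset.univ : Finset (Fin n)), φ S := by
  rw [← lintegral_map (measurable_of_countable φ) hA, lintegral_fintype, Finset.mul_sum]
  rw [← Finset.sum_subset (Finset.subset_univ (Finset.powersetCard b Finset.univ))]
  · refine Finset.sum_congr rfl fun S hS => ?_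
    have h : μ (A ⁻¹' {S}) = ((n.choose b : ℕ) : ENNReal)⁻¹ :=
      hunif S (Finset.mem_powersetCard.1 hS).2
    rw [Measure.map_apply hA (measurableSet_singleton S), h, mul_comm]
  · intro S _ hS
    have h : A ⁻¹' {S} = ∅ := by
      ext ω
      simp only [Set.mem_preimage, Set.mem_singleton_iff, Set.mem_empty_iff_false, iff_false]
      rintro rfl
      exact hS (Finset.mem_powersetCard.2 ⟨Finset.subset_univ _, hcard ω⟩)
    rw [Measure.map_apply hA (measurableSet_singleton S), h, measure_empty, mul_zero]

theorem batchMean_val {V : Type*} [AddCommGroup V] [Module ℝ V] (S : Finset (Fin n))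
    (h : Fin n → V) : batchMean S.val h = (S.card : ℝ)⁻¹ • ∑ i ∈ S, h i := rfl

theorem sum_sq_norm_sub_mean_le (u : Fin n → H) :
    ∑ i, ‖u i - (n : ℝ)⁻¹ • ∑ j, u j‖ ^ 2 ≤ ∑ i, ‖u i‖ ^ 2 := by
  rcases Nat.eq_zero_or_pos n with rfl | hn
  · simp
  have hn0 : (n : ℝ) ≠ 0 := by exact_mod_cast hn.ne'
  set c := (n : ℝ)⁻¹ • ∑ j, u j with hc
  have h1 : ∑ j, u j = (n : ℝ) • c := by rw [hc, smul_smul, mul_inv_cancel₀ hn0, one_smul]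
  have h2 : ∀ i, ‖u i - c‖ ^ 2 = ‖u i‖ ^ 2 - 2 * inner ℝ (u i) c + ‖c‖ ^ 2 :=
    fun i => norm_sub_sq_real _ _
  simp_rw [h2]
  rw [Finset.sum_add_distrib, Finset.sum_sub_distrib, ← Finset.mul_sum, ← sum_inner, h1,
    inner_smul_left, real_inner_self_eq_norm_sq, Finset.sum_const, Finset.card_univ,
    Fintype.card_fin, nsmul_eq_mul]
  have : 0 ≤ (n : ℝ) * ‖c‖ ^ 2 := by positivity
  simp only [conj_trivial]
  linarith

/-- The moment bounds for sampling without replacement, with exact values at refreshes. -/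
theorem isOracle_finset [IsProbabilityMeasure μ] {E : Type*} [NormedAddCommGroup E] {τ : ℕ}
    (hτ : 1 ≤ τ) (hτn : τ ≤ n) {b : ℕ → ℕ} (hb : ∀ t, b t = if t % τ = 0 then n else τ)
    {A : ℕ → Ω → Finset (Fin n)} (hA : ∀ t, Measurable (A t)) (hcard : ∀ t ω, (A t ω).card = b t)
    (hunif : ∀ t (S : Finset (Fin n)), S.card = b t →
      μ {ω | A t ω = S} = ((n.choose (b t) : ℕ) : ENNReal)⁻¹)
    {h : Fin n → E → H} {L : ℝ} (hL : ∀ i x y, ‖h i x - h i y‖ ≤ L * ‖x - y‖) :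
    IsOracle μ τ A (fun _ S z => batchMean S.val (fun i => h i z))
      (fun z => (n : ℝ)⁻¹ • ∑ i, h i z) 0 (L ^ 2 / τ) := by
  have hn : 1 ≤ n := hτ.trans hτn
  have hn0 : (n : ℝ) ≠ 0 := by exact_mod_cast (by omega : n ≠ 0)
  constructor
  -- A batch of `n` distinct indices is the whole index set, so a refresh is exact.
  · intro t z ht
    have h1 : ∀ ω, batchMean (A t ω).val (fun i => h i z) = (n : ℝ)⁻¹ • ∑ i, h i z := by
      intro ω
      have h2 : (A t ω).card = n := by rw [hcard, hb, if_pos ht]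
      have h3 : A t ω = Finset.univ := by
        rw [← Finset.card_eq_iff_eq_univ, h2, Fintype.card_fin]
      rw [batchMean_val, h2, h3]
    simp [h1]
  · intro t e z w ht
    have hbt : b t = τ := by rw [hb, if_neg ht]
    have hτ0 : (0 : ℝ) < τ := by exact_mod_cast hτ
    set u : Fin n → H := fun i => h i z - h i w with hu
    set Y : Fin n → H := fun i => u i - (n : ℝ)⁻¹ • ∑ j, u j with hYdef
    have hY : ∑ i, Y i = 0 := by
      simp only [hYdef]
      rw [Finset.sum_sub_distrib, Finset.sum_const, Finset.card_univ, Fintype.card_fin,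
        ← Nat.cast_smul_eq_nsmul ℝ, smul_smul, mul_inv_cancel₀ hn0, one_smul, sub_self]
    have h1 : ∀ ω, batchMean (A t ω).val (fun i => h i z) - batchMean (A t ω).val (fun i => h i w)
        - ((n : ℝ)⁻¹ • ∑ i, h i z - (n : ℝ)⁻¹ • ∑ i, h i w) =
        (τ : ℝ)⁻¹ • ∑ i ∈ A t ω, Y i := by
      intro ω
      have hc : (A t ω).card = τ := by rw [hcard, hbt]
      simp only [hYdef, hu]
      rw [batchMean_val, batchMean_val, ← smul_sub, ← smul_sub, ← Finset.sum_sub_distrib,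
        ← Finset.sum_sub_distrib, Finset.sum_sub_distrib (s := A t ω) (f := fun i => h i z - h i w),
        Finset.sum_const, hc, smul_sub, ← Nat.cast_smul_eq_nsmul ℝ τ, smul_smul (τ : ℝ)⁻¹,
        inv_mul_cancel₀ hτ0.ne', one_smul]
    have hYs : (∑ i, ‖Y i‖ ^ 2) / (τ * n) ≤ L ^ 2 / τ * ‖z - w‖ ^ 2 := by
      have h2 : ∑ i, ‖Y i‖ ^ 2 ≤ n * (L ^ 2 * ‖z - w‖ ^ 2) := by
        refine (sum_sq_norm_sub_mean_le u).trans ?_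
        calc ∑ i, ‖u i‖ ^ 2 ≤ ∑ _i : Fin n, L ^ 2 * ‖z - w‖ ^ 2 :=
              Finset.sum_le_sum fun i _ => by
                rw [← mul_pow]; exact pow_le_pow_left₀ (norm_nonneg _) (hL i z w) 2
          _ = _ := by simp
      have hn' : (0 : ℝ) < n := by exact_mod_cast hn
      rw [div_le_iff₀ (by positivity)]
      refine h2.trans_eq ?_
      field_simp
    have h3 := sum_powersetCard_sq_norm_le hτ hτn hY e
    have hC : (0 : ℝ) < n.choose τ := by exact_mod_cast Nat.choose_pos hτn
    have h4 := lintegral_uniform_subset (hA t) (hcard t) (hunif t)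
      fun S => ENNReal.ofReal (‖e + (τ : ℝ)⁻¹ • ∑ i ∈ S, Y i‖ ^ 2)
    simp_rw [h1]
    rw [h4, hbt, ← ENNReal.ofReal_sum_of_nonneg fun _ _ => sq_nonneg _,
      ← ENNReal.ofReal_mul (by positivity), ← ENNReal.ofReal_add (by positivity) (by positivity),
      ← ENNReal.ofReal_natCast, ← ENNReal.ofReal_inv_of_pos hC,
      ← ENNReal.ofReal_mul (by positivity)]
    refine ENNReal.ofReal_le_ofReal ?_
    rw [inv_mul_le_iff₀ hC]
    exact h3.trans (mul_le_mul_of_nonneg_left (by linarith) hC.le)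

end FiniteSampling

/-! ### The finite-sum model -/

section FiniteModel

variable {d p n : ℕ} {f : Vec p → ℝ} {G : Fin n → Vec d → Vec p} {lf Lf lg Lg : ℝ}

theorem fderiv_mean (hG : ∀ i, Differentiable ℝ (G i)) (x : Vec d) :
    fderiv ℝ (fun x => (n : ℝ)⁻¹ • ∑ i, G i x) x = (n : ℝ)⁻¹ • ∑ i, fderiv ℝ (G i) x :=
  ((HasFDerivAt.fun_sum fun i _ => (hG i x).hasFDerivAt).fun_const_smul _).fderiv

theorem norm_mean_sub_le {H : Type*} [NormedAddCommGroup H] [NormedSpace ℝ H] (hn : 1 ≤ n)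
    {u w : Fin n → H} {c : ℝ} (h : ∀ i, ‖u i - w i‖ ≤ c) :
    ‖(n : ℝ)⁻¹ • ∑ i, u i - (n : ℝ)⁻¹ • ∑ i, w i‖ ≤ c := by
  have hn0 : (0 : ℝ) < n := by exact_mod_cast hn
  rw [← smul_sub, ← Finset.sum_sub_distrib, norm_smul, Real.norm_of_nonneg (by positivity),
    inv_mul_le_iff₀ hn0]
  refine (norm_sum_le_of_le _ fun i _ => h i).trans_eq ?_
  simp

theorem IsSmooth.mean (h : IsSmooth f G lf Lf lg Lg) (hn : 1 ≤ n) :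
    IsSmooth f (fun (_ : Unit) x => (n : ℝ)⁻¹ • ∑ i, G i x) lf Lf lg Lg where
  diff_f := h.diff_f
  lip_f := h.lip_f
  lip_grad_f := h.lip_grad_f
  diff_g _ := (Differentiable.fun_sum fun i _ => h.diff_g i).fun_const_smul _
  lip_g _ x y := norm_mean_sub_le hn fun i => h.lip_g i x y
  lip_jac_g _ x y := by
    rw [fderiv_mean h.diff_g, fderiv_mean h.diff_g, ← norm_frobVec, map_sub, map_smul, map_smul,
      map_sum, map_sum]
    refine norm_mean_sub_le hn fun i => ?_
    rw [← map_sub, norm_frobVec]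
    exact h.lip_jac_g i x y

theorem finTau_pos (hn : 1 ≤ n) : 1 ≤ finTau n := by
  rw [finTau, Nat.le_floor_iff (Real.sqrt_nonneg _), Nat.cast_one, Real.one_le_sqrt]
  exact_mod_cast hn

theorem finTau_le (hn : 1 ≤ n) : finTau n ≤ n := by
  refine Nat.floor_le_of_le ?_
  rw [Real.sqrt_le_left (Nat.cast_nonneg _)]
  have : (1 : ℝ) ≤ n := by exact_mod_cast hn
  nlinarith

variable {Ω R : Type*} [MeasurableSpace Ω] {μ : Measure Ω} {T : ℕ}
  {A : R → ℕ → Ω → Finset (Fin n)} {ζ : R → Ω → Fin T}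

theorem FinSampling.isModel [IsProbabilityMeasure μ] (hA : FinSampling μ (finBatch n) A ζ)
    (h : IsSmooth f G lf Lf lg Lg) (hn : 1 ≤ n) (ρ : R) :
    IsModel μ (finTau n) (A ρ) (fun _ S => S.val) f G (fun x => (n : ℝ)⁻¹ • ∑ i, G i x)
      lf Lf lg Lg 0 0 where
  smooth := h.mean hn
  meas_g t := measurable_from_prod_countable_right fun S => by
    simp_rw [batchMean_val]
    exact (Finset.measurable_sum _ fun i _ => (h.diff_g i).continuous.measurable).fun_const_smul
      (S.card : ℝ)⁻¹
  meas_J t := measurable_from_prod_countable_right fun S => by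
    simp_rw [batchMean_val]
    exact (Finset.measurable_sum _ fun i _ => (h.continuous_fderiv i).measurable).fun_const_smul
      (S.card : ℝ)⁻¹
  oracle_g := isOracle_finset (finTau_pos hn) (finTau_le hn) (fun _ => rfl) (hA.meas_A ρ)
    (hA.card_A ρ) (hA.unif_A ρ) h.lip_g
  oracle_J := by
    have h1 := isOracle_finset (E := Vec d) (finTau_pos hn) (finTau_le hn) (fun _ => rfl)
      (hA.meas_A ρ) (hA.card_A ρ) (hA.unif_A ρ) (h := fun i x => frobVec (fderiv ℝ (G i) x))
      (L := Lg) fun i x y => by rw [← map_sub, norm_frobVec]; exact h.lip_jac_g i x y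
    simp_rw [fderiv_mean h.diff_g, map_batchMean frobVec, map_smul, map_sum]
    exact h1

end FiniteModel

/-! ### Independent sampling -/

section IndependentSampling

variable {Ω H : Type*} [MeasurableSpace Ω] {μ : Measure Ω} [IsProbabilityMeasure μ]
  [NormedAddCommGroup H] [InnerProductSpace ℝ H] [CompleteSpace H]

/-- The cross term has mean zero; if the second moment of `X` is infinite there is nothing to show.
-/
theorem lintegral_sq_norm_add_le {X : Ω → H} (hX : Integrable X μ) (h0 : ∫ ω, X ω ∂μ = 0)
    (e : H) : ∫⁻ ω, ENNReal.ofReal (‖e + X ω‖ ^ 2) ∂μ ≤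
      ENNReal.ofReal (‖e‖ ^ 2) + ∫⁻ ω, ENNReal.ofReal (‖X ω‖ ^ 2) ∂μ := by
  by_cases hfin : ∫⁻ ω, ENNReal.ofReal (‖X ω‖ ^ 2) ∂μ = ⊤
  · rw [hfin, add_top]; exact le_top
  have hsq : Integrable (fun ω => ‖X ω‖ ^ 2) μ := by
    refine ⟨(hX.aestronglyMeasurable.norm.pow 2), ?_⟩
    rw [hasFiniteIntegral_iff_ofReal (Filter.Eventually.of_forall fun ω => sq_nonneg _)]
    exact lt_top_iff_ne_top.2 hfin
  have hin : Integrable (fun ω => 2 * inner ℝ e (X ω)) μ := (hX.const_inner e).const_mul 2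
  have e1 : ∀ ω, ‖e + X ω‖ ^ 2 = (‖e‖ ^ 2 + 2 * inner ℝ e (X ω)) + ‖X ω‖ ^ 2 :=
    fun ω => norm_add_sq_real _ _
  have hA : Integrable (fun ω => ‖e‖ ^ 2 + 2 * inner ℝ e (X ω)) μ :=
    (integrable_const _).add hin
  have hB : Integrable (fun ω => ‖e + X ω‖ ^ 2) μ := by
    simp_rw [e1]; exact hA.add hsq
  rw [← ofReal_integral_eq_lintegral_ofReal hB (Filter.Eventually.of_forall fun ω => sq_nonneg _),
    ← ofReal_integral_eq_lintegral_ofReal hsq (Filter.Eventually.of_forall fun ω => sq_nonneg _),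
    ← ENNReal.ofReal_add (sq_nonneg _) (integral_nonneg fun ω => sq_nonneg _)]
  refine ENNReal.ofReal_le_ofReal (le_of_eq ?_)
  simp_rw [e1]
  rw [integral_add hA hsq, integral_add (integrable_const _) hin, integral_const_mul,
    integral_inner hX, h0, inner_zero_right]
  simp

variable [MeasurableSpace H] [BorelSpace H] [SecondCountableTopology H]

/-- Samples are added one at a time: the partial sum is frozen by independence and plays the role of
`e` in `lintegral_sq_norm_add_le`. -/
theorem lintegral_sq_norm_add_sum_le {X : ℕ → Ω → H} (hm : ∀ i, Measurable (X i))
    (hind : iIndepFun X μ) (hX : ∀ i, Integrable (X i) μ) (h0 : ∀ i, ∫ ω, X i ω ∂μ = 0)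
    {σ : ENNReal} (hσ : ∀ i, ∫⁻ ω, ENNReal.ofReal (‖X i ω‖ ^ 2) ∂μ ≤ σ) (e : H) (k : ℕ) :
    ∫⁻ ω, ENNReal.ofReal (‖e + ∑ i ∈ Finset.range k, X i ω‖ ^ 2) ∂μ ≤
      ENNReal.ofReal (‖e‖ ^ 2) + k * σ := by
  induction k with
  | zero => simp
  | succ k ih =>
    have hS : Measurable fun ω => ∑ i ∈ Finset.range k, X i ω :=
      Finset.measurable_sum _ fun i _ => hm i
    have hI : IndepFun (fun ω => ∑ i ∈ Finset.range k, X i ω) (X k) μ := by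
      have := hind.indepFun_sum_range_succ hm k
      convert this using 1
      ext ω
      simp
    have hφ : Measurable fun r : H × H => ENNReal.ofReal (‖(e + r.1) + r.2‖ ^ 2) :=
      (((measurable_fst.const_add e).add measurable_snd).norm.pow_const 2).ennreal_ofReal
    have key := lintegral_le_of_indepFun hS (hm k) hI hφ
      (ψ := fun s => ENNReal.ofReal (‖e + s‖ ^ 2) + σ) fun s =>
        (lintegral_sq_norm_add_le (hX k) (h0 k) (e + s)).trans (by gcongr; exact hσ k)
    rw [lintegral_add_right _ measurable_const, lintegral_const, measure_univ, mul_one] at key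
    calc ∫⁻ ω, ENNReal.ofReal (‖e + ∑ i ∈ Finset.range (k + 1), X i ω‖ ^ 2) ∂μ
        = ∫⁻ ω, ENNReal.ofReal (‖(e + ∑ i ∈ Finset.range k, X i ω) + X k ω‖ ^ 2) ∂μ := by
          simp_rw [Finset.sum_range_succ, add_assoc]
      _ ≤ (ENNReal.ofReal (‖e‖ ^ 2) + k * σ) + σ := key.trans (by gcongr)
      _ = _ := by push_cast; ring

theorem batchMean_sampleBatch {Ξ V : Type*} [AddCommGroup V] [Module ℝ V] (k : ℕ) (x : ℕ → Ξ)
    (h : Ξ → V) :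
    batchMean (sampleBatch k x) h = (k : ℝ)⁻¹ • ∑ i ∈ Finset.range k, h (x i) := by
  rw [batchMean, sampleBatch, Multiset.card_map, Multiset.card_range, Multiset.map_map]
  rfl

variable {Ξ : Type*} [MeasurableSpace Ξ] {D : Measure Ξ} [IsProbabilityMeasure D]

/-- The error of the average of `k` independent samples. -/
theorem lintegral_sq_norm_add_batchMean_le {ξ : ℕ → Ω → Ξ} (hm : ∀ i, Measurable (ξ i))
    (hlaw : ∀ i, μ.map (ξ i) = D) (hind : iIndepFun ξ μ) {h : Ξ → H} (hh : Measurable h)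
    (hint : Integrable h D) {V : ℝ} (hV : ∫⁻ x, ENNReal.ofReal (‖h x - ∫ y, h y ∂D‖ ^ 2) ∂D ≤
      ENNReal.ofReal V) {k : ℕ} (hk : 1 ≤ k) (e : H) :
    ∫⁻ ω, ENNReal.ofReal (‖e + (batchMean (sampleBatch k fun i => ξ i ω) h
      - ∫ y, h y ∂D)‖ ^ 2) ∂μ ≤ ENNReal.ofReal (‖e‖ ^ 2) + ENNReal.ofReal (V / k) := by
  have hk0 : (0 : ℝ) < k := by exact_mod_cast hk
  set c := ∫ y, h y ∂D with hc
  set Y : Ξ → H := fun x => (k : ℝ)⁻¹ • (h x - c) with hY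
  have mY : Measurable Y := (hh.sub_const c).fun_const_smul (k : ℝ)⁻¹
  have iY : Integrable Y D := (hint.sub (integrable_const c)).smul (k : ℝ)⁻¹
  have zY : ∫ x, Y x ∂D = 0 := by
    simp only [hY]
    rw [integral_smul, integral_sub hint (integrable_const c), ← hc]
    simp
  have h1 : ∀ ω, e + (batchMean (sampleBatch k fun i => ξ i ω) h - c) =
      e + ∑ i ∈ Finset.range k, Y (ξ i ω) := by
    intro ω
    simp only [hY]
    rw [batchMean_sampleBatch, ← Finset.smul_sum, Finset.sum_sub_distrib, Finset.sum_const,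
      Finset.card_range, smul_sub, ← Nat.cast_smul_eq_nsmul ℝ, smul_smul, inv_mul_cancel₀ hk0.ne',
      one_smul]
  have hσ : ∀ i, ∫⁻ ω, ENNReal.ofReal (‖Y (ξ i ω)‖ ^ 2) ∂μ ≤
      ENNReal.ofReal (((k : ℝ)⁻¹) ^ 2 * V) := by
    intro i
    have e1 : ∀ x, ENNReal.ofReal (‖Y x‖ ^ 2) =
        ENNReal.ofReal (((k : ℝ)⁻¹) ^ 2) * ENNReal.ofReal (‖h x - c‖ ^ 2) := fun x => by
      rw [← ENNReal.ofReal_mul (by positivity), hY, norm_smul, mul_pow, Real.norm_eq_abs, sq_abs]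
    have mh : Measurable fun x => ENNReal.ofReal (‖h x - c‖ ^ 2) :=
      ((hh.sub_const c).norm.pow_const 2).ennreal_ofReal
    rw [← lintegral_map (f := fun x => ENNReal.ofReal (‖Y x‖ ^ 2))
      (mY.norm.pow_const 2).ennreal_ofReal (hm i), hlaw]
    simp_rw [e1]
    rw [lintegral_const_mul _ mh, ENNReal.ofReal_mul (by positivity)]
    gcongr
  have key := lintegral_sq_norm_add_sum_le (X := fun i ω => Y (ξ i ω)) (μ := μ)
    (fun i => mY.comp (hm i)) (hind.comp (fun _ => Y) fun _ => mY)
    (fun i => (hlaw i ▸ iY : Integrable Y (μ.map (ξ i))).comp_measurable (hm i))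
    (fun i => by
      have h2 := integral_map (μ := μ) (hm i).aemeasurable (f := Y)
        (mY.aestronglyMeasurable)
      rw [← h2, hlaw, zY]) hσ e k
  simp_rw [h1]
  refine key.trans_eq ?_
  rw [← ENNReal.ofReal_natCast, ← ENNReal.ofReal_mul hk0.le]
  congr 2
  field_simp

/-- The variance is at most the second moment. -/
theorem lintegral_sq_norm_sub_integral_le {u : Ξ → H} (hu : Measurable u) {c : ℝ}
    (hc : ∀ x, ‖u x‖ ≤ c) :
    ∫⁻ x, ENNReal.ofReal (‖u x - ∫ y, u y ∂D‖ ^ 2) ∂D ≤ ENNReal.ofReal (c ^ 2) := by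
  have iu : Integrable u D := Integrable.of_bound hu.aestronglyMeasurable c
    (Filter.Eventually.of_forall hc)
  have isq : Integrable (fun x => ‖u x‖ ^ 2) D :=
    Integrable.of_bound (hu.norm.pow_const 2).aestronglyMeasurable (c ^ 2)
      (Filter.Eventually.of_forall fun x => by
        rw [Real.norm_of_nonneg (sq_nonneg _)]; exact pow_le_pow_left₀ (norm_nonneg _) (hc x) 2)
  set m := ∫ y, u y ∂D with hm
  have iin : Integrable (fun x => 2 * inner ℝ m (u x)) D := (iu.const_inner m).const_mul 2
  have e1 : ∀ x, ‖u x - m‖ ^ 2 = (‖u x‖ ^ 2 - 2 * inner ℝ m (u x)) + ‖m‖ ^ 2 := fun x => by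
    rw [norm_sub_sq_real, real_inner_comm]
  have i1 : Integrable (fun x => ‖u x‖ ^ 2 - 2 * inner ℝ m (u x)) D := isq.sub iin
  have i2 : Integrable (fun x => ‖u x - m‖ ^ 2) D := by
    simp_rw [e1]; exact i1.add (integrable_const _)
  rw [← ofReal_integral_eq_lintegral_ofReal i2 (Filter.Eventually.of_forall fun x => sq_nonneg _)]
  refine ENNReal.ofReal_le_ofReal ?_
  simp_rw [e1]
  rw [integral_add i1 (integrable_const _), integral_sub isq iin, integral_const_mul,
    integral_inner iu, ← hm, real_inner_self_eq_norm_sq]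
  have h2 : ∫ x, ‖u x‖ ^ 2 ∂D ≤ ∫ _x, c ^ 2 ∂D :=
    integral_mono isq (integrable_const _) fun x => pow_le_pow_left₀ (norm_nonneg _) (hc x) 2
  simp only [integral_const, probReal_univ, one_smul] at h2 ⊢
  linarith [sq_nonneg ‖m‖]

/-- The moment bounds for independent sampling. -/
theorem isOracle_sampleBatch {E : Type*} [NormedAddCommGroup E] {τ N : ℕ} (hτ : 1 ≤ τ)
    (hN : 1 ≤ N) {b : ℕ → ℕ} (hb : ∀ t, b t = if t % τ = 0 then N else τ)
    {ξ : ℕ → ℕ → Ω → Ξ} (hm : ∀ t i, Measurable (ξ t i)) (hlaw : ∀ t i, μ.map (ξ t i) = D)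
    (hind : ∀ t, iIndepFun (ξ t) μ) {h : Ξ → E → H} (hh : ∀ z, Measurable fun x => h x z)
    (hint : ∀ z, Integrable (fun x => h x z) D) {q : E → H} (hq : ∀ z, ∫ x, h x z ∂D = q z)
    {L V : ℝ} (hL : ∀ x z w, ‖h x z - h x w‖ ≤ L * ‖z - w‖)
    (hV : ∀ z, ∫⁻ x, ENNReal.ofReal (‖h x z - q z‖ ^ 2) ∂D ≤ ENNReal.ofReal V) :
    IsOracle μ τ (fun t ω i => ξ t i ω) (fun t x z => batchMean (sampleBatch (b t) x)
      (fun ξ => h ξ z)) q (V / N) (L ^ 2 / τ) := by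
  constructor
  · intro t z ht
    have h1 := lintegral_sq_norm_add_batchMean_le (hm t) (hlaw t) (hind t) (hh z) (hint z)
      (V := V) (by rw [hq]; exact hV z) (k := b t) (by rw [hb, if_pos ht]; exact hN) 0
    rw [hq] at h1
    simpa [hb t, ht] using h1
  · intro t e z w ht
    have h2 : ∫ x, (h x z - h x w) ∂D = q z - q w := by
      rw [integral_sub (hint z) (hint w), hq, hq]
    have h1 := lintegral_sq_norm_add_batchMean_le (hm t) (hlaw t) (hind t)
      ((hh z).sub (hh w)) ((hint z).sub (hint w)) (V := (L * ‖z - w‖) ^ 2)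
      (lintegral_sq_norm_sub_integral_le ((hh z).sub (hh w)) fun x => hL x z w)
      (k := τ) hτ e
    have h3 : ∫ x, ((fun x => h x z) - fun x => h x w) x ∂D = q z - q w := h2
    have h4 : ∀ ω, batchMean (sampleBatch τ fun i => ξ t i ω) ((fun x => h x z) - fun x => h x w) =
        batchMean (sampleBatch τ fun i => ξ t i ω) (fun x => h x z)
          - batchMean (sampleBatch τ fun i => ξ t i ω) (fun x => h x w) :=
      fun ω => batchMean_sub _ _ _
    simp_rw [h3, h4] at h1
    rw [← ENNReal.ofReal_mul (by positivity), hb, if_neg ht]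
    refine h1.trans_eq ?_
    congr 2
    ring

end IndependentSampling

/-! ### The online model -/

section OnlineModel

variable {d p : ℕ} {Ξ : Type*} [MeasurableSpace Ξ] {D : Measure Ξ}
  {f : Vec p → ℝ} {G : Ξ → Vec d → Vec p} {lf Lf lg Lg sg sg' : ℝ}

theorem clm_eq_sum_smulRight (B : Vec d →L[ℝ] Vec p) :
    B = ∑ j, ContinuousLinearMap.smulRightL ℝ (Vec d) (Vec p) (EuclideanSpace.proj j)
      (B (EuclideanSpace.single j (1 : ℝ))) := by
  ext x i
  have h1 : x = ∑ j, x j • EuclideanSpace.single j (1 : ℝ) := by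
    ext k
    simp [Finset.sum_apply, Pi.single_apply]
  conv_lhs => rw [h1]
  simp

/-- Directional derivatives are limits of measurable difference quotients, and the Jacobian is a
fixed linear expression in its columns. -/
theorem measurable_fderiv_sample (hG : ∀ x, Measurable fun ξ => G ξ x)
    (hd : ∀ ξ, Differentiable ℝ (G ξ)) (x : Vec d) : Measurable fun ξ => fderiv ℝ (G ξ) x := by
  have h1 : ∀ v : Vec d, Measurable fun ξ => fderiv ℝ (G ξ) x v := by
    intro v
    refine measurable_of_tendsto_metrizable
      (f := fun (k : ℕ) ξ => ((k : ℝ) + 1) • (G ξ (x + ((k : ℝ) + 1)⁻¹ • v) - G ξ x))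
      (fun k => ((hG _).sub (hG x)).fun_const_smul ((k : ℝ) + 1)) ?_
    rw [tendsto_pi_nhds]
    intro ξ
    refine (hd ξ x).hasFDerivAt.lim v (c := fun k : ℕ => (k : ℝ) + 1) (l := Filter.atTop) ?_
    exact tendsto_norm_atTop_atTop.comp
      (Filter.tendsto_atTop_add_const_right _ _ tendsto_natCast_atTop_atTop)
  have h2 : (fun ξ => fderiv ℝ (G ξ) x) = fun ξ => ∑ j,
      ContinuousLinearMap.smulRightL ℝ (Vec d) (Vec p) (EuclideanSpace.proj j)
        (fderiv ℝ (G ξ) x (EuclideanSpace.single j (1 : ℝ))) :=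
    funext fun ξ => clm_eq_sum_smulRight _
  rw [h2]
  exact Finset.measurable_sum _ fun j _ =>
    (ContinuousLinearMap.continuous _).measurable.comp (h1 _)

variable [IsProbabilityMeasure D]

theorem IsSmooth.integrable_fderiv (h : IsSmooth f G lf Lf lg Lg) (hlg : 0 ≤ lg)
    (hG : ∀ x, Measurable fun ξ => G ξ x) (x : Vec d) :
    Integrable (fun ξ => fderiv ℝ (G ξ) x) D :=
  Integrable.of_bound (measurable_fderiv_sample hG h.diff_g x).aestronglyMeasurable lg
    (Filter.Eventually.of_forall fun ξ => h.norm_fderiv_le hlg ξ x)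

/-- Differentiation under the integral, with the common Lipschitz constant `lg` as dominating
function. -/
theorem IsSmooth.hasFDerivAt_meanMap (h : IsSmooth f G lf Lf lg Lg) (hlg : 0 ≤ lg)
    (hG : ∀ x, Measurable fun ξ => G ξ x) (hint : ∀ x, Integrable (fun ξ => G ξ x) D)
    (x : Vec d) : HasFDerivAt (meanMap D G) (∫ ξ, fderiv ℝ (G ξ) x ∂D) x := by
  refine (hasFDerivAt_integral_of_dominated_loc_of_lip (μ := D) (F := fun x ξ => G ξ x)
    (F' := fun ξ => fderiv ℝ (G ξ) x) (bound := fun _ => lg) Filter.univ_mem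
    (Filter.Eventually.of_forall fun y => (hG y).aestronglyMeasurable) (hint x)
    (measurable_fderiv_sample hG h.diff_g x).aestronglyMeasurable
    (Filter.Eventually.of_forall fun ξ => ?_) (integrable_const _)
    (Filter.Eventually.of_forall fun ξ => (h.diff_g ξ x).hasFDerivAt)).2
  refine (LipschitzWith.of_dist_le_mul fun y z => ?_).lipschitzOnWith
  rw [dist_eq_norm, dist_eq_norm, Real.coe_nnabs, abs_of_nonneg hlg]
  exact h.lip_g ξ y z

theorem norm_integral_sub_le {H : Type*} [NormedAddCommGroup H] [NormedSpace ℝ H] {u w : Ξ → H}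
    (hu : Integrable u D) (hw : Integrable w D) {c : ℝ} (h : ∀ x, ‖u x - w x‖ ≤ c) :
    ‖∫ x, u x ∂D - ∫ x, w x ∂D‖ ≤ c := by
  rw [← integral_sub hu hw]
  refine (norm_integral_le_of_norm_le_const (Filter.Eventually.of_forall h)).trans_eq ?_
  simp

theorem IsSmooth.integral_frobVec (h : IsSmooth f G lf Lf lg Lg) (hlg : 0 ≤ lg)
    (hG : ∀ x, Measurable fun ξ => G ξ x) (hint : ∀ x, Integrable (fun ξ => G ξ x) D)
    (x : Vec d) :
    ∫ ξ, frobVec (fderiv ℝ (G ξ) x) ∂D = frobVec (fderiv ℝ (meanMap D G) x) := by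
  rw [(h.hasFDerivAt_meanMap hlg hG hint x).fderiv]
  exact frobVec.integral_comp_comm (h.integrable_fderiv hlg hG x)

theorem IsSmooth.meanMap (h : IsSmooth f G lf Lf lg Lg) (hlg : 0 ≤ lg)
    (hG : ∀ x, Measurable fun ξ => G ξ x) (hint : ∀ x, Integrable (fun ξ => G ξ x) D) :
    IsSmooth f (fun (_ : Unit) => meanMap D G) lf Lf lg Lg where
  diff_f := h.diff_f
  lip_f := h.lip_f
  lip_grad_f := h.lip_grad_f
  diff_g _ x := (h.hasFDerivAt_meanMap hlg hG hint x).differentiableAt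
  lip_g _ x y := norm_integral_sub_le (hint x) (hint y) fun ξ => h.lip_g ξ x y
  lip_jac_g _ x y := by
    rw [← norm_frobVec, map_sub, ← h.integral_frobVec hlg hG hint, ← h.integral_frobVec hlg hG hint]
    refine norm_integral_sub_le (frobVec.integrable_comp (h.integrable_fderiv hlg hG x))
      (frobVec.integrable_comp (h.integrable_fderiv hlg hG y)) fun ξ => ?_
    rw [← map_sub, norm_frobVec]
    exact h.lip_jac_g ξ x y

/-- A Carathéodory argument: measurability in the sample and continuity in the point give joint
measurability. -/
theorem measurable_batchMean_sampleBatch {V : Type*} [NormedAddCommGroup V] [NormedSpace ℝ V]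
    [MeasurableSpace V] [BorelSpace V] [SecondCountableTopology V] {h : Ξ → Vec d → V}
    (hh : ∀ z, Measurable fun x => h x z) (hc : ∀ x, Continuous (h x)) (k : ℕ) :
    Measurable fun r : (ℕ → Ξ) × Vec d =>
      batchMean (sampleBatch k r.1) (fun ξ => h ξ r.2) := by
  have h1 : Measurable (Function.uncurry fun z x => h x z) :=
    measurable_uncurry_of_continuous_of_measurable hc hh
  simp_rw [batchMean_sampleBatch]
  refine (Finset.measurable_sum _ fun i _ => ?_).fun_const_smul (k : ℝ)⁻¹
  exact h1.comp (measurable_snd.prodMk ((measurable_pi_apply i).comp measurable_fst))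

variable {Ω R : Type*} [MeasurableSpace Ω] {μ : Measure Ω} {T : ℕ}
  {ξ : R → ℕ → ℕ → Ω → Ξ} {ζ : R → Ω → Fin T}

theorem OnlSampling.isModel [IsProbabilityMeasure μ] (hξ : OnlSampling μ D ξ ζ)
    (h : IsSmooth f G lf Lf lg Lg) (hlg : 0 ≤ lg) (hv : BoundedVariance D G sg sg') {s ε : ℝ}
    (hτ : 1 ≤ onlTau s ε) (hN : 1 ≤ ⌈2 * s / ε ^ 2⌉₊) (ρ : R) :
    IsModel μ (onlTau s ε) (fun t ω i => ξ ρ t i ω) (fun t x => sampleBatch (onlBatch s ε t) x)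
      f G (MVRC.meanMap D G) lf Lf lg Lg (sg ^ 2 / ⌈2 * s / ε ^ 2⌉₊)
      (sg' ^ 2 / ⌈2 * s / ε ^ 2⌉₊) where
  smooth := h.meanMap hlg hv.meas hv.integrable
  meas_g t := measurable_batchMean_sampleBatch hv.meas (fun ξ => (h.diff_g ξ).continuous) _
  meas_J t := measurable_batchMean_sampleBatch (measurable_fderiv_sample hv.meas h.diff_g)
    h.continuous_fderiv _
  oracle_g := by
    have hind : ∀ t, iIndepFun (ξ ρ t) μ := fun t =>
      hξ.indep_ξ.precomp (g := fun i : ℕ => (ρ, t, i)) fun i j hij => by simpa using hij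
    refine isOracle_sampleBatch hτ hN (fun _ => rfl) (hξ.meas_ξ ρ) (hξ.law_ξ ρ) hind hv.meas
      hv.integrable (q := MVRC.meanMap D G) (fun z => rfl) h.lip_g fun z => ?_
    rw [← ofReal_integral_eq_lintegral_ofReal (hv.integrable_var z)
      (Filter.Eventually.of_forall fun x => sq_nonneg _)]
    exact ENNReal.ofReal_le_ofReal (hv.var z)
  oracle_J := by
    have hind : ∀ t, iIndepFun (ξ ρ t) μ := fun t =>
      hξ.indep_ξ.precomp (g := fun i : ℕ => (ρ, t, i)) fun i j hij => by simpa using hij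
    have h1 := isOracle_sampleBatch (E := Vec d) (b := onlBatch s ε) hτ hN (fun _ => rfl)
      (hξ.meas_ξ ρ) (hξ.law_ξ ρ) hind (h := fun ξ z => frobVec (fderiv ℝ (G ξ) z))
      (q := fun z => frobVec (fderiv ℝ (MVRC.meanMap D G) z)) (L := Lg) (V := sg' ^ 2)
      (fun z => frobVec.continuous.measurable.comp (measurable_fderiv_sample hv.meas h.diff_g z))
      (fun z => frobVec.integrable_comp (h.integrable_fderiv hlg hv.meas z))
      (h.integral_frobVec hlg hv.meas hv.integrable)
      (fun x z w => by rw [← map_sub, norm_frobVec]; exact h.lip_jac_g x z w) fun z => by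
        simp_rw [← map_sub, norm_frobVec]
        rw [← ofReal_integral_eq_lintegral_ofReal (hv.integrable_jac_var z)
          (Filter.Eventually.of_forall fun x => sq_nonneg _)]
        exact ENNReal.ofReal_le_ofReal (hv.jac_var z)
    simp_rw [map_batchMean frobVec]
    exact h1

end OnlineModel

/-! ### Independence in the two sampling schemes -/

section SamplingSeeds

variable {Ω X R : Type*} [mΩ : MeasurableSpace Ω] [mX : MeasurableSpace X] {μ : Measure Ω} {T : ℕ}

/-- Disjoint blocks of an independent family are independent; `π` assigns each elementary choice to
its block. -/
theorem IndepSeeds.of_iIndep {κ : Type*} {a : R → ℕ → Ω → X} {ζ : R → Ω → Fin T}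
    (ha : ∀ ρ t, Measurable (a ρ t)) (hζ : ∀ ρ, Measurable (ζ ρ))
    (hunif : ∀ ρ (t : Fin T), μ {ω | ζ ρ ω = t} = ((T : ℕ) : ENNReal)⁻¹)
    {σ : κ → MeasurableSpace Ω} (hle : ∀ j, σ j ≤ mΩ) (hind : iIndep σ μ)
    (π : κ → (R × ℕ) ⊕ R) (hσ : ∀ i, seedAlgebra a ζ i ≤ ⨆ j ∈ π ⁻¹' {i}, σ j) :
    IndepSeeds μ a ζ where
  meas_a := ha
  meas_ζ := hζ
  unif_ζ := hunif
  indep i := by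
    have hd : Disjoint (π ⁻¹' {i}ᶜ) (π ⁻¹' {i}) :=
      (Disjoint.preimage π (Set.disjoint_compl_left_iff_subset.2 le_rfl))
    refine indep_of_indep_of_le_left (indep_of_indep_of_le_right
      (indep_iSup_of_disjoint hle hind hd) (hσ i)) ?_
    refine iSup₂_le fun j hj => (hσ j).trans (biSup_mono fun k hk => ?_)
    simp only [Set.mem_preimage, Set.mem_singleton_iff, Set.mem_compl_iff] at hk hj ⊢
    exact hk ▸ hj

theorem FinSampling.indepSeeds {n : ℕ} {b : ℕ → ℕ} {A : R → ℕ → Ω → Finset (Fin n)}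
    {ζ : R → Ω → Fin T} (h : FinSampling μ b A ζ) : IndepSeeds μ A ζ := by
  have hI := h.indep
  rw [IndepFun_iff_Indep] at hI
  have e1 := comap_pi_eq_iSup fun (q : R × ℕ) => A q.1 q.2
  have e2 := comap_pi_eq_iSup ζ
  rw [show (MeasurableSpace.comap (fun ω (q : R × ℕ) => A q.1 q.2 ω) inferInstance) = _ from e1,
    show (MeasurableSpace.comap (fun ω ρ => ζ ρ ω) inferInstance) = _ from e2] at hI
  have hA := h.indep_A
  have hZ := h.indep_ζ
  rw [iIndepFun_iff_iIndep] at hA hZ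
  refine IndepSeeds.of_iIndep h.meas_A h.meas_ζ h.unif_ζ ?_ (iIndep_sum hA hZ hI) id fun i => ?_
  · rintro (q | ρ)
    · exact (h.meas_A q.1 q.2).comap_le
    · exact (h.meas_ζ ρ).comap_le
  · exact le_biSup (Sum.elim (fun q : R × ℕ => MeasurableSpace.comap (A q.1 q.2) inferInstance)
      fun ρ => MeasurableSpace.comap (ζ ρ) inferInstance) (show i ∈ id ⁻¹' {i} from rfl)

/-- Here a block is the whole sequence of samples of one iteration, so the sample number is
forgotten by the map of blocks. -/
theorem OnlSampling.indepSeeds {D : Measure X} {ξ : R → ℕ → ℕ → Ω → X} {ζ : R → Ω → Fin T}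
    (h : OnlSampling μ D ξ ζ) : IndepSeeds μ (fun ρ t ω i => ξ ρ t i ω) ζ := by
  have hI := h.indep
  rw [IndepFun_iff_Indep] at hI
  have e1 := comap_pi_eq_iSup fun (q : R × ℕ × ℕ) => ξ q.1 q.2.1 q.2.2
  have e2 := comap_pi_eq_iSup ζ
  rw [show (MeasurableSpace.comap (fun ω (q : R × ℕ × ℕ) => ξ q.1 q.2.1 q.2.2 ω)
      inferInstance) = _ from e1,
    show (MeasurableSpace.comap (fun ω ρ => ζ ρ ω) inferInstance) = _ from e2] at hI
  have hA := h.indep_ξ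
  have hZ := h.indep_ζ
  rw [iIndepFun_iff_iIndep] at hA hZ
  refine IndepSeeds.of_iIndep (fun ρ t => measurable_pi_lambda _ (h.meas_ξ ρ t)) h.meas_ζ h.unif_ζ
    ?_ (iIndep_sum hA hZ hI) (Sum.map (fun q : R × ℕ × ℕ => (q.1, q.2.1)) id) fun i => ?_
  · rintro (q | ρ)
    · exact (h.meas_ξ q.1 q.2.1 q.2.2).comap_le
    · exact (h.meas_ζ ρ).comap_le
  · rcases i with ⟨ρ, t⟩ | ρ
    · refine (comap_pi_eq_iSup (ξ ρ t)).trans_le (iSup_le fun i => ?_)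
      exact le_biSup (Sum.elim (fun q : R × ℕ × ℕ => MeasurableSpace.comap (ξ q.1 q.2.1 q.2.2) mX)
        fun ρ => MeasurableSpace.comap (ζ ρ) inferInstance)
        (show Sum.inl (ρ, t, i) ∈ Sum.map (fun q : R × ℕ × ℕ => (q.1, q.2.1)) id ⁻¹'
          {Sum.inl (ρ, t)} from rfl)
    · exact le_biSup (Sum.elim (fun q : R × ℕ × ℕ => MeasurableSpace.comap (ξ q.1 q.2.1 q.2.2) mX)
        fun ρ => MeasurableSpace.comap (ζ ρ) inferInstance)
        (show Sum.inr ρ ∈ Sum.map (fun q : R × ℕ × ℕ => (q.1, q.2.1)) id ⁻¹' {Sum.inr ρ} from rfl)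

end SamplingSeeds

/-! ### Counting evaluations -/

section Counting

theorem card_filter_mod_eq_zero_le (τ T : ℕ) :
    ((Finset.range T).filter (· % τ = 0)).card ≤ T / τ + 1 := by
  calc _ ≤ (Finset.range (T / τ + 1)).card := by
        refine Finset.card_le_card_of_injOn (· / τ) (fun s hs => ?_) fun s hs t ht hst => ?_
        · simp only [Finset.coe_filter, Finset.mem_range, Set.mem_ofPred_eq, Finset.coe_range,
            Set.mem_Iio] at hs ⊢
          exact Nat.lt_succ_of_le (Nat.div_le_div_right hs.1.le)
        · simp only [Finset.coe_filter, Set.mem_ofPred_eq] at hs ht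
          rw [← Nat.div_add_mod s τ, ← Nat.div_add_mod t τ, hs.2, ht.2]
          exact congrArg (τ * · + 0) hst
    _ = _ := Finset.card_range _

variable {d p : ℕ} {Ξ : Type*} {P : Params} {f : Vec p → ℝ} {r : Vec d → ℝ}
  {G : Ξ → Vec d → Vec p}

theorem evals_run (x0 : Vec d) (A : ℕ → Multiset Ξ) (T : ℕ) :
    (run P f r G x0 A T).evals =
      ∑ t ∈ Finset.range T, (if t % P.tau = 0 then 2 else 4) * Multiset.card (A t) := by
  induction T with
  | zero => rfl
  | succ T ih =>
    rw [Finset.sum_range_succ, ← ih]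
    rfl

/-- At most `T / τ + 1` refreshes cost `2 N` each, and every other iteration costs `4 τ`. With `N ≤
8 τ²` the refreshes amount to `16 τ T` plus one extra `2 N`. -/
theorem evals_run_le {N : ℕ} (hτ : 0 < P.tau) (hN : (N : ℝ) ≤ 8 * (P.tau : ℝ) ^ 2) (x0 : Vec d)
    {A : ℕ → Multiset Ξ} (hA : ∀ t, Multiset.card (A t) = if t % P.tau = 0 then N else P.tau)
    (T : ℕ) : ((run P f r G x0 A T).evals : ℝ) ≤ 20 * P.tau * T + 2 * N := by
  have hτ0 : (0 : ℝ) < P.tau := by exact_mod_cast hτ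
  have h1 : (run P f r G x0 A T).evals ≤ (T / P.tau + 1) * (2 * N) + T * (4 * P.tau) := by
    rw [evals_run]
    calc ∑ t ∈ Finset.range T, (if t % P.tau = 0 then 2 else 4) * Multiset.card (A t)
        ≤ ∑ t ∈ Finset.range T, ((if t % P.tau = 0 then 2 * N else 0) + 4 * P.tau) := by
          refine Finset.sum_le_sum fun t _ => ?_
          rw [hA]
          split_ifs <;> omega
      _ = ((Finset.range T).filter (· % P.tau = 0)).card * (2 * N) + T * (4 * P.tau) := by
          rw [Finset.sum_add_distrib, ← Finset.sum_filter, Finset.sum_const, Finset.sum_const,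
            Finset.card_range, smul_eq_mul, smul_eq_mul]
      _ ≤ _ := by gcongr; exact card_filter_mod_eq_zero_le P.tau T
  have h2 : ((run P f r G x0 A T).evals : ℝ) ≤
      (((T / P.tau : ℕ) : ℝ) + 1) * (2 * N) + T * (4 * P.tau) := by exact_mod_cast h1
  have h3 : ((T / P.tau : ℕ) : ℝ) ≤ T / P.tau := Nat.cast_div_le
  have h4 : (T / P.tau : ℝ) * (2 * N) ≤ (T / P.tau : ℝ) * (16 * (P.tau : ℝ) ^ 2) :=
    mul_le_mul_of_nonneg_left (by linarith) (by positivity)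
  have h5 : (T / P.tau : ℝ) * (16 * (P.tau : ℝ) ^ 2) = 16 * P.tau * T := by field_simp
  have h6 : ((T / P.tau : ℕ) : ℝ) * (2 * N) ≤ (T / P.tau : ℝ) * (2 * N) :=
    mul_le_mul_of_nonneg_right h3 (by positivity)
  linarith

theorem restartEvals_le {N : ℕ} (hτ : 0 < P.tau) (hN : (N : ℝ) ≤ 8 * (P.tau : ℝ) ^ 2) (x0 : Vec d)
    {A : ℕ → ℕ → Multiset Ξ}
    (hA : ∀ m t, Multiset.card (A m t) = if t % P.tau = 0 then N else P.tau) (ζ : ℕ → ℕ)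
    (T M : ℕ) :
    (restartEvals P f r G x0 A ζ T M : ℝ) ≤ M * (20 * P.tau * T + 2 * N) := by
  rw [restartEvals, Nat.cast_sum]
  refine (Finset.sum_le_sum fun m _ => evals_run_le hτ hN _ (hA m) T).trans_eq ?_
  rw [Finset.sum_const, Finset.card_range, nsmul_eq_mul]

theorem le_four_mul_sq_floor_sqrt {q : ℝ} (hq : 1 ≤ q) :
    q ≤ 4 * (⌊Real.sqrt q⌋₊ : ℝ) ^ 2 := by
  have h1 : (1 : ℝ) ≤ ⌊Real.sqrt q⌋₊ := by
    have : 1 ≤ ⌊Real.sqrt q⌋₊ := by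
      rw [Nat.le_floor_iff (Real.sqrt_nonneg _), Nat.cast_one, Real.one_le_sqrt]; exact hq
    exact_mod_cast this
  have h2 : Real.sqrt q ≤ 2 * ⌊Real.sqrt q⌋₊ := by
    have := (Nat.lt_floor_add_one (Real.sqrt q)).le
    linarith
  have h3 := pow_le_pow_left₀ (Real.sqrt_nonneg _) h2 2
  rw [Real.sq_sqrt (by linarith)] at h3
  linarith

theorem sq_floor_sqrt_le {q : ℝ} (hq : 0 ≤ q) : (⌊Real.sqrt q⌋₊ : ℝ) ^ 2 ≤ q := by
  have h := pow_le_pow_left₀ (Nat.cast_nonneg _) (Nat.floor_le (Real.sqrt_nonneg q)) 2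
  rwa [Real.sq_sqrt hq] at h

/-- A logarithmic number of halvings reaches the accuracy `ε ^ 2`. -/
theorem exists_restart_count (B : ℝ) : ∃ K : ℝ, 0 < K ∧ ∀ ε : ℝ, 0 < ε → ε ≤ 1 / 2 →
    ∃ m : ℕ, ((m + 1 : ℕ) : ℝ) ≤ K * Real.log (1 / ε) ∧ B ≤ 2 ^ m * ε ^ 2 := by
  -- Here `k` halvings deal with `B` and `j` further ones with `ε²`. Since `ε ≤ 1 / 2`, additive
  -- constants are absorbed into `log (1 / ε)`.
  obtain ⟨k, hk⟩ := pow_unbounded_of_one_lt B (one_lt_two (α := ℝ))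
  have hl2 : 0 < Real.log 2 := Real.log_pos one_lt_two
  refine ⟨(k + 4) / Real.log 2, by positivity, fun ε hε hε2 => ?_⟩
  have hL : Real.log 2 ≤ Real.log (1 / ε) := by
    refine Real.log_le_log (by norm_num) ?_
    rw [le_div_iff₀ hε]; linarith
  set L := Real.log (1 / ε) with hLdef
  set j := ⌈2 * L / Real.log 2⌉₊ with hj
  have hL0 : 0 < L := hl2.trans_le hL
  have hj1 : 2 * L / Real.log 2 ≤ j := Nat.le_ceil _
  have hj2 : (j : ℝ) ≤ 2 * L / Real.log 2 + 1 := (Nat.ceil_lt_add_one (by positivity)).le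
  refine ⟨k + j, ?_, ?_⟩
  · have h1 : 1 ≤ L / Real.log 2 := by rw [le_div_iff₀ hl2]; linarith
    have h2 : (k + 2 : ℝ) * 1 ≤ (k + 2) * (L / Real.log 2) :=
      mul_le_mul_of_nonneg_left h1 (by positivity)
    have e1 : (k + 4) / Real.log 2 * L = (k + 2) * (L / Real.log 2) + 2 * L / Real.log 2 := by
      ring
    rw [e1]
    push_cast
    linarith
  · have h1 : 1 ≤ (2 : ℝ) ^ j * ε ^ 2 := by
      have h2 : 2 * L ≤ j * Real.log 2 := by rwa [div_le_iff₀ hl2] at hj1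
      have h3 : L = - Real.log ε := by rw [hLdef, one_div, Real.log_inv]
      have h4 : 0 ≤ Real.log ((2 : ℝ) ^ j * ε ^ 2) := by
        rw [Real.log_mul (by positivity) (by positivity), Real.log_pow, Real.log_pow]
        push_cast
        linarith
      exact (Real.log_nonneg_iff (by positivity)).1 h4
    rw [pow_add, mul_assoc]
    have : (2 : ℝ) ^ k * 1 ≤ 2 ^ k * (2 ^ j * ε ^ 2) :=
      mul_le_mul_of_nonneg_left h1 (by positivity)
    linarith

end Counting

/-! ### Convergence of one run and of the restarted algorithm -/

section Outputs

variable {d : ℕ} {Ω : Type*} [MeasurableSpace Ω] {μ : Measure Ω} [IsProbabilityMeasure μ]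
  {F : Vec d → ℝ} {T : ℕ} {β v V Δ : ℝ}

theorem OutputBound.gap_le_of_start {x0 : Vec d} {w : Ω → Vec d}
    (h : OutputBound μ F T β v V (fun _ => x0) w) (hv : 0 ≤ v) :
    ∫ ω, F (w ω) ∂μ - infVal F ≤ v * (V + (F x0 - infVal F) / (T * β)) := by
  have h1 := h.sq_le
  simp only [integral_const, probReal_univ, one_smul] at h1
  have h2 := h.gap_le.trans (mul_le_mul_of_nonneg_left h1 (by positivity : 0 ≤ v / 2))
  refine h2.trans_eq ?_
  ring

/-- The first `m` runs make the gap small and the last one converts it into a small gradient; `2 v ≤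
T β` turns the residual gap `2 v V` into at most `2 V`. -/
theorem integral_norm_sq_le_of_outputBound {m : ℕ} {w : ℕ → Ω → Vec d} {x0 : Vec d}
    (hw : ∀ ω, w 0 ω = x0) (hΔ : F x0 - infVal F ≤ Δ) (hΔ0 : 0 ≤ Δ) (hv : 0 ≤ v) (hV : 0 ≤ V)
    (hβ : 0 < β) (hT : 0 < T) (hvT : 2 * v ≤ T * β)
    (h : ∀ k < m + 1, OutputBound μ F T β v V (w k) (w (k + 1))) :
    ∫ ω, ‖gradient F (w (m + 1) ω)‖ ^ 2 ∂μ ≤ 2 / (T * β) * (Δ / 2 ^ m) + 4 * V := by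
  have hTβ : 0 < T * β := mul_pos (by exact_mod_cast hT) hβ
  have h1 := gap_le_of_outputBound hw hΔ hΔ0 hv hV hβ hT hvT h m m.le_succ
  have h2 := (h m m.lt_succ_self).sq_le
  have h3 := mul_le_mul_of_nonneg_left h1 (by positivity : 0 ≤ 2 / (T * β))
  have h4 : 2 / (T * β) * (2 * (v * V)) ≤ 2 * V := by
    rw [div_mul_eq_mul_div, div_le_iff₀ hTβ]
    nlinarith [mul_le_mul_of_nonneg_right hvT hV]
  rw [mul_add] at h3
  linarith

theorem OutputBound.integral_norm_le {X0 w : Ω → Vec d} (h : OutputBound μ F T β v V X0 w)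
    {ε : ℝ} (hε : 0 ≤ ε) (hsq : ∫ ω, ‖gradient F (w ω)‖ ^ 2 ∂μ ≤ ε ^ 2) :
    ∫ ω, ‖gradient F (w ω)‖ ∂μ ≤ ε :=
  le_of_sq_le_sq (h.integral_norm_sq_le.trans hsq) hε

end Outputs

/-! ### Run length and cost of one run. -/

section Costs

variable {β v κ : ℝ} {T τ : ℕ}

theorem natCast_max_ceil_le (h : 0 ≤ κ * v) (hT : T = max ⌈κ * v⌉₊ τ) :
    (T : ℝ) ≤ κ * v + 1 + τ := by
  have h1 := (Nat.ceil_lt_add_one h).le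
  have h2 : (T : ℝ) ≤ (⌈κ * v⌉₊ : ℝ) + τ := by
    rw [hT]
    exact_mod_cast max_le (Nat.le_add_right _ _) (Nat.le_add_left _ _)
  linarith

theorem two_mul_le_of_max_ceil (hβ : 0 < β) (hT : T = max ⌈2 / β * v⌉₊ τ) : 2 * v ≤ T * β := by
  have h1 : 2 / β * v ≤ T :=
    (Nat.le_ceil _).trans (by rw [hT]; exact_mod_cast le_max_left _ _)
  rwa [div_mul_eq_mul_div, div_le_iff₀ hβ] at h1

/-- The cost of a run with epochs of length `τ = ⌊√q⌋`. -/
theorem runCost_le {q N : ℝ} (h0 : 0 ≤ κ * v) (hT : T = max ⌈κ * v⌉₊ τ) (hτ : 1 ≤ τ)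
    (hq : τ = ⌊Real.sqrt q⌋₊) (hq0 : 0 ≤ q) :
    20 * τ * T + 2 * N ≤ 20 * κ * (Real.sqrt q * v) + 40 * q + 2 * N := by
  have h1 := natCast_max_ceil_le h0 hT
  have h2 : (1 : ℝ) ≤ τ := by exact_mod_cast hτ
  have h3 : (τ : ℝ) ^ 2 ≤ q := hq ▸ sq_floor_sqrt_le hq0
  have h4 : (τ : ℝ) ≤ Real.sqrt q := hq ▸ Nat.floor_le (Real.sqrt_nonneg q)
  have h5 := mul_le_mul_of_nonneg_left h1 (by positivity : (0 : ℝ) ≤ 20 * τ)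
  have h6 := mul_le_mul_of_nonneg_right h4 h0
  nlinarith

end Costs

/-! ### The finite-sum problem. -/

section FiniteSum

variable {lf Lf lg Lg α β : ℝ} {d p n : ℕ} {f : Vec p → ℝ} {G : Fin n → Vec d → Vec p}
  {S : Set (Vec d)} {v : ℝ} {lam : ℕ → ℝ} {T : ℕ} {Ω : Type*} [MeasurableSpace Ω] {μ : Measure Ω}
  [IsProbabilityMeasure μ]

theorem FinSampling.outputBound {A : Unit → ℕ → Ω → Finset (Fin n)} {ζ : Unit → Ω → Fin T}
    (hA : FinSampling μ (finBatch n) A ζ) (hlf : 0 ≤ lf) (hLf : 0 ≤ Lf) (hlg : 0 ≤ lg)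
    (hLg : 0 ≤ Lg) (hc : StepCond α β lf Lf lg Lg) (hn : 1 ≤ n) (hT : 1 ≤ T)
    (hs : IsSmooth f G lf Lf lg Lg) (hF : GradDominantOn (finObj f G) S v)
    (hlam : ∀ t, β ≤ lam t ∧ lam t ≤ (1 + α) * β) (x0 : Vec d)
    (hS : ∀ t < T, ∀ᵐ ω ∂μ, zPoint (constParams (finTau n) α β lam) f (fun _ => 0) G x0
      (fun t => (A () t ω).val) t ∈ S) :
    OutputBound μ (finObj f G) T β v 0 (fun _ => x0) fun ω =>
      zPoint (constParams (finTau n) α β lam) f (fun _ => 0) G x0 (fun t => (A () t ω).val)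
        (ζ () ω) :=
  have hi := hA.indepSeeds
  (hA.isModel hs hn ()).outputBound hlf hLf hlg hLg le_rfl le_rfl (by simp) (finTau_pos hn) hc hlam
    (hi.isSeedSeq ()) measurable_const hT (hi.meas_ζ ()) (hi.unif_ζ ()) (hi.indep_index ()) hF
    (integrable_const _) hS

theorem FinSampling.outputBound_restart {A : ℕ → ℕ → Ω → Finset (Fin n)} {ζ : ℕ → Ω → Fin T}
    (hA : FinSampling μ (finBatch n) A ζ) (hlf : 0 ≤ lf) (hLf : 0 ≤ Lf) (hlg : 0 ≤ lg)
    (hLg : 0 ≤ Lg) (hc : StepCond α β lf Lf lg Lg) (hn : 1 ≤ n) (hT : 1 ≤ T)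
    (hs : IsSmooth f G lf Lf lg Lg) (hF : GradDominantOn (finObj f G) S v)
    (hlam : ∀ t, β ≤ lam t ∧ lam t ≤ (1 + α) * β) (x0 : Vec d) {M : ℕ}
    {B : Ω → ℕ → ℕ → Multiset (Fin n)} (hB : B = fun ω m t => (A m t ω).val)
    {P : Params} (hP : P = constParams (finTau n) α β lam)
    (hS : ∀ m < M, ∀ t < T, ∀ᵐ ω ∂μ, zPoint P f (fun _ => 0) G
      (restartPoint P f (fun _ => 0) G x0 (B ω) (fun m => ζ m ω) m) (B ω m) t ∈ S) :
    ∀ m < M, OutputBound μ (finObj f G) T β v 0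
      (fun ω => restartPoint P f (fun _ => 0) G x0 (B ω) (fun m => ζ m ω) m)
      (fun ω => restartPoint P f (fun _ => 0) G x0 (B ω) (fun m => ζ m ω) (m + 1)) := by
  subst hB hP
  have h0 : 2 * (lg ^ 2 * Lf ^ 2) * 0 + 2 * lf ^ 2 * 0 ≤ (0 : ℝ) := by simp
  have hm : ∀ m, IsModel μ (finTau n) (A m) (fun _ S => S.val) f G
      (fun x => (n : ℝ)⁻¹ • ∑ i, G i x) lf Lf lg Lg 0 0 := fun m => hA.isModel hs hn m
  have hi : IndepSeeds μ A ζ := hA.indepSeeds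
  have key := MVRC.outputBound_restart hm hlf hLf hlg hLg le_rfl le_rfl h0 (finTau_pos hn) hc hlam
    hi hT hF x0 hS
  exact key

theorem finite_sum_gap_le {A : Unit → ℕ → Ω → Finset (Fin n)} {ζ : Unit → Ω → Fin T}
    (hA : FinSampling μ (finBatch n) A ζ) (hlf : 0 ≤ lf) (hLf : 0 ≤ Lf) (hlg : 0 ≤ lg)
    (hLg : 0 ≤ Lg) (hc : StepCond α β lf Lf lg Lg) (hn : 1 ≤ n) (hT : 1 ≤ T)
    (hs : IsSmooth f G lf Lf lg Lg) (hF : GradDominantOn (finObj f G) S v)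
    (hlam : ∀ t, β ≤ lam t ∧ lam t ≤ (1 + α) * β) (x0 : Vec d) {z : Ω → ℕ → Vec d}
    (hz : z = fun ω => zPoint (constParams (finTau n) α β lam) f (fun _ => 0) G x0
      (fun t => (A () t ω).val))
    (hS : ∀ t < T, ∀ᵐ ω ∂μ, z ω t ∈ S) :
    Integrable (fun ω => finObj f G (z ω (ζ () ω))) μ ∧
      (∫ ω, finObj f G (z ω (ζ () ω)) ∂μ) - infVal (finObj f G) ≤
        v * (α⁻¹ + 1) / (T * β) * (finObj f G x0 - infVal (finObj f G)) := by
  subst hz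
  have h := hA.outputBound hlf hLf hlg hLg hc hn hT hs hF hlam x0 hS
  refine ⟨h.int_F, (h.gap_le_of_start hF.pos.le).trans ?_⟩
  have hD : 0 ≤ finObj f G x0 - infVal (finObj f G) := sub_nonneg.2 (infVal_le hF x0)
  have hβ := hc.be_pos
  have hα : 0 ≤ α⁻¹ := inv_nonneg.2 hc.al_pos.le
  have hv := hF.pos
  -- The estimate holds without the factor `α⁻¹ + 1`; the surplus is nonnegative.
  have e : v * (α⁻¹ + 1) / (T * β) * (finObj f G x0 - infVal (finObj f G)) =
      v * (0 + (finObj f G x0 - infVal (finObj f G)) / (T * β)) +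
        v * α⁻¹ * ((finObj f G x0 - infVal (finObj f G)) / (T * β)) := by ring
  rw [e]
  exact le_add_of_nonneg_right (by positivity)

end FiniteSum

/-! ### The online problem. -/

section Online

variable {lf Lf lg Lg sg sg' α β : ℝ} {d p : ℕ} {Ξ : Type*} [MeasurableSpace Ξ] {D : Measure Ξ}
  [IsProbabilityMeasure D] {f : Vec p → ℝ} {G : Ξ → Vec d → Vec p} {S : Set (Vec d)} {v ε : ℝ}
  {lam : ℕ → ℝ} {T : ℕ} {Ω : Type*} [MeasurableSpace Ω] {μ : Measure Ω} [IsProbabilityMeasure μ]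

theorem one_le_of_sq_le {s : ℝ} (hε : 0 < ε) (h : ε ^ 2 ≤ 2 * s) : 1 ≤ 2 * s / ε ^ 2 := by
  rwa [le_div_iff₀ (by positivity), one_mul]

theorem one_le_onlTau {s : ℝ} (hε : 0 < ε) (h : ε ^ 2 ≤ 2 * s) : 1 ≤ onlTau s ε := by
  rw [onlTau, Nat.le_floor_iff (Real.sqrt_nonneg _), Nat.cast_one, Real.one_le_sqrt]
  exact one_le_of_sq_le hε h

theorem one_le_onlBatch_refresh {s : ℝ} (hε : 0 < ε) (h : ε ^ 2 ≤ 2 * s) :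
    1 ≤ ⌈2 * s / ε ^ 2⌉₊ :=
  Nat.one_le_ceil_iff.2 (zero_lt_one.trans_le (one_le_of_sq_le hε h))

theorem sigmaSq_div_batch_le (hε : 0 < ε) (h : ε ^ 2 ≤ 2 * sigmaSq lf Lf lg sg sg') :
    2 * (lg ^ 2 * Lf ^ 2) * (sg ^ 2 / ⌈2 * sigmaSq lf Lf lg sg sg' / ε ^ 2⌉₊) +
      2 * lf ^ 2 * (sg' ^ 2 / ⌈2 * sigmaSq lf Lf lg sg sg' / ε ^ 2⌉₊) ≤ ε ^ 2 / 2 := by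
  set N := ⌈2 * sigmaSq lf Lf lg sg sg' / ε ^ 2⌉₊ with hN
  have hN1 : (0 : ℝ) < N := by exact_mod_cast one_le_onlBatch_refresh hε h
  have h1 : 2 * sigmaSq lf Lf lg sg sg' ≤ N * ε ^ 2 := by
    rw [← div_le_iff₀ (by positivity)]
    exact Nat.le_ceil _
  have e : 2 * (lg ^ 2 * Lf ^ 2) * (sg ^ 2 / N) + 2 * lf ^ 2 * (sg' ^ 2 / N) =
      sigmaSq lf Lf lg sg sg' / N := by
    rw [sigmaSq]; ring
  rw [e, div_le_iff₀ hN1]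
  linarith

theorem OnlSampling.outputBound {ξ : Unit → ℕ → ℕ → Ω → Ξ} {ζ : Unit → Ω → Fin T}
    (hξ : OnlSampling μ D ξ ζ) (hlf : 0 ≤ lf) (hLf : 0 ≤ Lf) (hlg : 0 ≤ lg)
    (hLg : 0 ≤ Lg) (hc : StepCond α β lf Lf lg Lg) (hT : 1 ≤ T) (hε : 0 < ε)
    (hεs : ε ^ 2 ≤ 2 * sigmaSq lf Lf lg sg sg')
    (hs : IsSmooth f G lf Lf lg Lg) (hv : BoundedVariance D G sg sg')
    (hF : GradDominantOn (onlObj D f G) S v)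
    (hlam : ∀ t, β ≤ lam t ∧ lam t ≤ (1 + α) * β) (x0 : Vec d)
    (hS : ∀ t < T, ∀ᵐ ω ∂μ, zPoint (constParams (onlTau (sigmaSq lf Lf lg sg sg') ε) α β lam) f
      (fun _ => 0) G x0
      (fun t => sampleBatch (onlBatch (sigmaSq lf Lf lg sg sg') ε t) (fun i => ξ () t i ω)) t ∈ S) :
    OutputBound μ (onlObj D f G) T β v (ε ^ 2 / 2) (fun _ => x0) fun ω =>
      zPoint (constParams (onlTau (sigmaSq lf Lf lg sg sg') ε) α β lam) f (fun _ => 0) G x0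
        (fun t => sampleBatch (onlBatch (sigmaSq lf Lf lg sg sg') ε t) (fun i => ξ () t i ω))
        (ζ () ω) :=
  have hi := hξ.indepSeeds
  (hξ.isModel hs hlg hv (one_le_onlTau hε hεs) (one_le_onlBatch_refresh hε hεs) ()).outputBound
    hlf hLf hlg hLg (by positivity) (by positivity) (sigmaSq_div_batch_le hε hεs)
    (one_le_onlTau hε hεs) hc hlam (hi.isSeedSeq ()) measurable_const hT (hi.meas_ζ ())
    (hi.unif_ζ ()) (hi.indep_index ()) hF (integrable_const _) hS

theorem OnlSampling.outputBound_restart {ξ : ℕ → ℕ → ℕ → Ω → Ξ} {ζ : ℕ → Ω → Fin T}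
    (hξ : OnlSampling μ D ξ ζ) (hlf : 0 ≤ lf) (hLf : 0 ≤ Lf) (hlg : 0 ≤ lg)
    (hLg : 0 ≤ Lg) (hc : StepCond α β lf Lf lg Lg) (hT : 1 ≤ T) (hε : 0 < ε)
    (hεs : ε ^ 2 ≤ 2 * sigmaSq lf Lf lg sg sg')
    (hs : IsSmooth f G lf Lf lg Lg) (hv : BoundedVariance D G sg sg')
    (hF : GradDominantOn (onlObj D f G) S v)
    (hlam : ∀ t, β ≤ lam t ∧ lam t ≤ (1 + α) * β) (x0 : Vec d) {M : ℕ} {B : Ω → ℕ → ℕ → Multiset Ξ}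
    (hB : B = fun ω m t =>
      sampleBatch (onlBatch (sigmaSq lf Lf lg sg sg') ε t) (fun i => ξ m t i ω))
    {P : Params} (hP : P = constParams (onlTau (sigmaSq lf Lf lg sg sg') ε) α β lam)
    (hS : ∀ m < M, ∀ t < T, ∀ᵐ ω ∂μ, zPoint P f (fun _ => 0) G
      (restartPoint P f (fun _ => 0) G x0 (B ω) (fun m => ζ m ω) m) (B ω m) t ∈ S) :
    ∀ m < M, OutputBound μ (onlObj D f G) T β v (ε ^ 2 / 2)
      (fun ω => restartPoint P f (fun _ => 0) G x0 (B ω) (fun m => ζ m ω) m)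
      (fun ω => restartPoint P f (fun _ => 0) G x0 (B ω) (fun m => ζ m ω) (m + 1)) := by
  subst hB hP
  exact MVRC.outputBound_restart
    (bt := fun t x => sampleBatch (onlBatch (sigmaSq lf Lf lg sg sg') ε t) x)
    (fun m => hξ.isModel hs hlg hv (one_le_onlTau hε hεs) (one_le_onlBatch_refresh hε hεs) m)
    hlf hLf hlg hLg (by positivity) (by positivity) (sigmaSq_div_batch_le hε hεs)
    (one_le_onlTau hε hεs) hc hlam hξ.indepSeeds hT hF x0 hS

theorem online_gap_le {ξ : Unit → ℕ → ℕ → Ω → Ξ} {ζ : Unit → Ω → Fin T}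
    (hξ : OnlSampling μ D ξ ζ) (hlf : 0 ≤ lf) (hLf : 0 ≤ Lf) (hlg : 0 ≤ lg)
    (hLg : 0 ≤ Lg) (hc : StepCond α β lf Lf lg Lg) (hT : 1 ≤ T) (hε : 0 < ε)
    (hεs : ε ^ 2 ≤ 2 * sigmaSq lf Lf lg sg sg')
    (hs : IsSmooth f G lf Lf lg Lg) (hv : BoundedVariance D G sg sg')
    (hF : GradDominantOn (onlObj D f G) S v)
    (hlam : ∀ t, β ≤ lam t ∧ lam t ≤ (1 + α) * β) (x0 : Vec d) {z : Ω → ℕ → Vec d}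
    (hz : z = fun ω => zPoint (constParams (onlTau (sigmaSq lf Lf lg sg sg') ε) α β lam) f
      (fun _ => 0) G x0
      (fun t => sampleBatch (onlBatch (sigmaSq lf Lf lg sg sg') ε t) (fun i => ξ () t i ω)))
    (hS : ∀ t < T, ∀ᵐ ω ∂μ, z ω t ∈ S) :
    Integrable (fun ω => onlObj D f G (z ω (ζ () ω))) μ ∧
      (∫ ω, onlObj D f G (z ω (ζ () ω)) ∂μ) - infVal (onlObj D f G) ≤
        v * (α⁻¹ + 1) * (ε ^ 2 + (onlObj D f G x0 - infVal (onlObj D f G)) / (T * β)) := by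
  subst hz
  have h := hξ.outputBound hlf hLf hlg hLg hc hT hε hεs hs hv hF hlam x0 hS
  refine ⟨h.int_F, (h.gap_le_of_start hF.pos.le).trans ?_⟩
  have hD : 0 ≤ onlObj D f G x0 - infVal (onlObj D f G) := sub_nonneg.2 (infVal_le hF x0)
  have hβ := hc.be_pos
  have hα : 0 ≤ α⁻¹ := inv_nonneg.2 hc.al_pos.le
  have hv := hF.pos
  rw [mul_assoc]
  refine mul_le_mul_of_nonneg_left ?_ hv.le
  have h2 : 0 ≤ (onlObj D f G x0 - infVal (onlObj D f G)) / (T * β) := by positivity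
  nlinarith [mul_nonneg hα h2, mul_nonneg hα (sq_nonneg ε), sq_nonneg ε]

end Online

theorem finite_sum_restart :
    ∀ (lf Lf lg Lg α β Δ : ℝ), 0 ≤ lf → 0 ≤ Lf → 0 ≤ lg → 0 ≤ Lg →
      StepCond α β lf Lf lg Lg →
      ∃ κ K : ℝ, 0 < κ ∧ 0 < K ∧ ∀ ε : ℝ, 0 < ε → ε ≤ 1 / 2 →
      ∃ M : ℕ, 1 ≤ M ∧ (M : ℝ) ≤ K * Real.log (1 / ε) ∧
        ∀ (d p n : ℕ) (f : Vec p → ℝ) (G : Fin n → Vec d → Vec p)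
          (S : Set (Vec d)) (v : ℝ) (x0 : Vec d) (lam : ℕ → ℝ) (T : ℕ), 1 ≤ n →
        T = max ⌈κ * v⌉₊ (finTau n) →
        IsSmooth f G lf Lf lg Lg →
        GradDominantOn (finObj f G) S v →
        finObj f G x0 - infVal (finObj f G) ≤ Δ →
        (∀ t, β ≤ lam t ∧ lam t ≤ (1 + α) * β) →
        ∀ (Ω : Type*) [MeasurableSpace Ω] (μ : Measure Ω) [IsProbabilityMeasure μ]
          (A : ℕ → ℕ → Ω → Finset (Fin n)) (ζ : ℕ → Ω → Fin T),
        FinSampling μ (finBatch n) A ζ →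
        let P : Params := constParams (finTau n) α β lam
        let B : Ω → ℕ → ℕ → Multiset (Fin n) := fun ω m t => (A m t ω).val
        let w : Ω → ℕ → Vec d := fun ω =>
          restartPoint P f (fun _ => 0) G x0 (B ω) (fun m => ζ m ω)
        let F : Vec d → ℝ := finObj f G
        (∀ m < M, ∀ t < T, ∀ᵐ ω ∂μ, zPoint P f (fun _ => 0) G (w ω m) (B ω m) t ∈ S) →
        (Integrable (fun ω => gradient F (w ω M)) μ ∧ ∫ ω, ‖gradient F (w ω M)‖ ∂μ ≤ ε) ∧
        (Integrable (fun ω => F (w ω M)) μ ∧ (∫ ω, F (w ω M) ∂μ) - infVal F ≤ ε ^ 2) ∧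
        ∀ ω, (restartEvals P f (fun _ => 0) G x0 (B ω) (fun m => (ζ m ω : ℕ)) T M : ℝ) ≤
          K * ((n + Real.sqrt n * v) * Real.log (1 / ε)) := by
  intro lf Lf lg Lg α β Δ hlf hLf hlg hLg hc
  have hβ := hc.be_pos
  -- The summand `1` serves the gap and `2 / β` the squared gradient, because `2 / (T β) ≤ 2 / β`.
  obtain ⟨K₀, hK₀, hcount⟩ := exists_restart_count (max Δ 0 * (1 + 2 / β))
  -- `κ = 2 / β` makes every run halve the gap; the second factor of `K` bounds the cost of a run in
  -- units of `n + √n v`, by `runCost_le` with `N = n`.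
  refine ⟨2 / β, K₀ * (20 * (2 / β) + 42), by positivity, by positivity, fun ε hε hε2 => ?_⟩
  obtain ⟨m, hm, hB⟩ := hcount ε hε hε2
  have hL : 0 < Real.log (1 / ε) := by
    refine Real.log_pos ?_
    rw [lt_div_iff₀ hε]; linarith
  have hΔ0 : 0 ≤ max Δ 0 := le_max_right _ _
  have hΔm : max Δ 0 / 2 ^ m * (1 + 2 / β) ≤ ε ^ 2 := by
    rw [div_mul_eq_mul_div, div_le_iff₀ (by positivity)]
    linarith
  refine ⟨m + 1, by omega, hm.trans ?_, ?_⟩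
  · refine mul_le_mul_of_nonneg_right (le_mul_of_one_le_right hK₀.le ?_) hL.le
    have : 0 ≤ 20 * (2 / β) := by positivity
    linarith
  intro d p n f G S v x0 lam T hn hT hs hF hΔ hlam Ω _ μ _ A ζ hA P B w F hS
  have hv := hF.pos
  have hT1 : 1 ≤ T := by
    rw [hT]; exact le_max_of_le_right (finTau_pos hn)
  have hvT := two_mul_le_of_max_ceil hβ hT
  have hOB := hA.outputBound_restart hlf hLf hlg hLg hc hn hT1 hs hF hlam x0 (B := B) rfl
    (P := P) rfl hS
  have hlast := hOB m m.lt_succ_self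
  have hsq := integral_norm_sq_le_of_outputBound (fun _ => rfl) (hΔ.trans (le_max_left _ 0)) hΔ0
    hv.le le_rfl hβ hT1 hvT hOB
  have hgap := gap_le_of_outputBound (fun _ => rfl) (hΔ.trans (le_max_left _ 0)) hΔ0
    hv.le le_rfl hβ hT1 hvT hOB (m + 1) le_rfl
  have hX : 0 ≤ max Δ 0 / 2 ^ m := by positivity
  have hX2 : 0 ≤ max Δ 0 / 2 ^ m * (2 / β) := by positivity
  refine ⟨⟨hlast.int_grad, hlast.integral_norm_le hε.le (hsq.trans ?_)⟩,
    ⟨hlast.int_F, hgap.trans ?_⟩, fun ω => ?_⟩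
  · have h1 : 2 / (T * β) ≤ 2 / β := by
      refine div_le_div_of_nonneg_left zero_le_two hβ (le_mul_of_one_le_left hβ.le ?_)
      exact_mod_cast hT1
    have h2 := mul_le_mul_of_nonneg_right h1 hX
    linarith
  · have h1 : max Δ 0 / 2 ^ (m + 1) = max Δ 0 / 2 ^ m / 2 := by rw [pow_succ, div_div]
    rw [h1]
    linarith
  · have hn1 : (1 : ℝ) ≤ n := by exact_mod_cast hn
    have hN : (n : ℝ) ≤ 8 * (P.tau : ℝ) ^ 2 := by
      have h1 := le_four_mul_sq_floor_sqrt hn1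
      have h2 : (0 : ℝ) ≤ (⌊Real.sqrt n⌋₊ : ℝ) ^ 2 := by positivity
      change (n : ℝ) ≤ 8 * (⌊Real.sqrt n⌋₊ : ℝ) ^ 2
      linarith
    have h1 := restartEvals_le (P := P) (f := f) (r := fun _ => 0) (G := G) (finTau_pos hn) hN x0
      (A := B ω) (fun k t => hA.card_A k t ω) (fun k => (ζ k ω : ℕ)) T (m + 1)
    have h2 := runCost_le (N := n) (κ := 2 / β) (by positivity) hT (finTau_pos hn) rfl
      (zero_le_one.trans hn1)
    refine h1.trans ((mul_le_mul hm h2 (by positivity) (by positivity)).trans ?_)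
    have h3 : 0 ≤ Real.sqrt n * v := by positivity
    have h4 : 0 ≤ K₀ * Real.log (1 / ε) := by positivity
    have h5 : 20 * (2 / β) * (Real.sqrt n * v) + 40 * n + 2 * n ≤
        (20 * (2 / β) + 42) * (n + Real.sqrt n * v) := by
      have : 0 ≤ 20 * (2 / β) * n := by positivity
      nlinarith
    refine (mul_le_mul_of_nonneg_left h5 h4).trans_eq ?_
    ring

/-- The constant of gradient dominance of a nonconstant function is bounded below. -/
theorem GradDominantOn.eight_mul_le {d : ℕ} {F : Vec d → ℝ} {S : Set (Vec d)} {v β L : ℝ}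
    (h : GradDominantOn F S v) (hd : Differentiable ℝ F)
    (hL : ∀ x y, ‖gradient F x - gradient F y‖ ≤ L * ‖x - y‖) (hβ : 0 < β) (hβL : 16 * β * L ≤ 1)
    (hx : ∃ x ∈ S, infVal F < F x) : 8 * β ≤ v := by
  obtain ⟨x, hxS, hx⟩ := hx
  have h1 := sq_norm_gradient_le hd hL hβ hβL (infVal_le h) x
  have h2 := h.dom x hxS
  have hv := h.pos
  have hD : 0 < F x - infVal F := sub_pos.2 hx
  have h3 := mul_le_mul_of_nonneg_left h1 hv.le
  -- The two bounds combine to `8 β (F x - F*) ≤ v (F x - F*)`, and the gap at `x` is positive.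
  by_contra! hlt
  nlinarith [mul_pos (sub_pos.2 hlt) hD, mul_le_mul_of_nonneg_left h2 hβ.le]

/-- For `lf = 0` the outer function, and with it the objective, would be constant. -/
theorem IsSmooth.lf_pos {d p : ℕ} {Ξ : Type*} {f : Vec p → ℝ} {G : Ξ → Vec d → Vec p}
    {lf Lf lg Lg : ℝ} (h : IsSmooth f G lf Lf lg Lg) (hlf : 0 ≤ lf) {g : Vec d → Vec p} {x : Vec d}
    (hx : infVal (fun x => f (g x)) < f (g x)) : 0 < lf := by
  refine hlf.lt_of_ne' fun h0 => hx.not_ge (le_ciInf fun y => ?_)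
  have := (le_abs_self _).trans (h.lip_f (g x) (g y))
  rw [h0, zero_mul] at this
  linarith

theorem ceil_le_two_mul {q : ℝ} (hq : 1 ≤ q) : (⌈q⌉₊ : ℝ) ≤ 2 * q := by
  have := (Nat.ceil_lt_add_one (zero_le_one.trans hq)).le
  linarith

/-- The terms without `v`, at most `44 q` with `q = 2 s / ε²`, fit into `6 / β * (q * v)` because `v
≥ 8 β`. -/
theorem online_runCost_le {s v β ε : ℝ} {T : ℕ} (hβ : 0 < β) (hvβ : 8 * β ≤ v)
    (hT : T = max ⌈2 / β * v⌉₊ (onlTau s ε)) (hε : 0 < ε) (hεs : ε ^ 2 ≤ 2 * s) :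
    20 * (onlTau s ε : ℝ) * T + 2 * (⌈2 * s / ε ^ 2⌉₊ : ℝ) ≤
      (20 * (2 / β) + 6 / β) * (2 * s / ε ^ 2 * v) := by
  have hq1 := one_le_of_sq_le hε hεs
  have hv : 0 ≤ v := by linarith
  have h2 := runCost_le (N := (⌈2 * s / ε ^ 2⌉₊ : ℝ)) (κ := 2 / β) (by positivity) hT
    (one_le_onlTau hε hεs) rfl (zero_le_one.trans hq1)
  have hN := ceil_le_two_mul hq1
  generalize 2 * s / ε ^ 2 = q at *
  have h3 : Real.sqrt q ≤ q := by
    rw [Real.sqrt_le_left (zero_le_one.trans hq1)]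
    nlinarith
  have h6 : 20 * (2 / β) * (Real.sqrt q * v) ≤ 20 * (2 / β) * (q * v) := by gcongr
  have h7 : 44 * q ≤ 6 / β * (q * v) := by
    rw [div_mul_eq_mul_div, le_div_iff₀ hβ]
    nlinarith [mul_le_mul_of_nonneg_left hvβ (zero_le_one.trans hq1)]
  linarith

theorem online_restart :
    ∀ (lf Lf lg Lg sg sg' α β Δ : ℝ), 0 ≤ lf → 0 ≤ Lf → 0 ≤ lg → 0 ≤ Lg → 0 < sg → 0 < sg' →
      StepCond α β lf Lf lg Lg →
      ∃ κ K θ : ℝ, 0 < κ ∧ 0 < K ∧ 0 < θ ∧ θ ≤ 1 ∧ ∀ ε : ℝ, 0 < ε → ε ≤ 1 / 2 →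
      ∃ M : ℕ, 1 ≤ M ∧ (M : ℝ) ≤ K * Real.log (1 / ε) ∧
        ∀ (d p : ℕ) (Ξ : Type*) [MeasurableSpace Ξ] (D : Measure Ξ) [IsProbabilityMeasure D]
          (f : Vec p → ℝ) (G : Ξ → Vec d → Vec p)
          (S : Set (Vec d)) (v : ℝ) (x0 : Vec d) (lam : ℕ → ℝ) (T : ℕ),
        T = max ⌈κ * v⌉₊ (onlTau (sigmaSq lf Lf lg sg sg') (θ * ε)) →
        IsSmooth f G lf Lf lg Lg →
        BoundedVariance D G sg sg' →
        GradDominantOn (onlObj D f G) S v →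
        (∃ x ∈ S, infVal (onlObj D f G) < onlObj D f G x) →
        onlObj D f G x0 - infVal (onlObj D f G) ≤ Δ →
        (∀ t, β ≤ lam t ∧ lam t ≤ (1 + α) * β) →
        ∀ (Ω : Type*) [MeasurableSpace Ω] (μ : Measure Ω) [IsProbabilityMeasure μ]
          (ξ : ℕ → ℕ → ℕ → Ω → Ξ) (ζ : ℕ → Ω → Fin T),
        OnlSampling μ D ξ ζ →
        let s : ℝ := sigmaSq lf Lf lg sg sg'
        let P : Params := constParams (onlTau s (θ * ε)) α β lam
        let B : Ω → ℕ → ℕ → Multiset Ξ := fun ω m t =>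
          sampleBatch (onlBatch s (θ * ε) t) (fun i => ξ m t i ω)
        let w : Ω → ℕ → Vec d := fun ω =>
          restartPoint P f (fun _ => 0) G x0 (B ω) (fun m => ζ m ω)
        let F : Vec d → ℝ := onlObj D f G
        (∀ m < M, ∀ t < T, ∀ᵐ ω ∂μ, zPoint P f (fun _ => 0) G (w ω m) (B ω m) t ∈ S) →
        1 ≤ onlTau s (θ * ε) ∧
        (Integrable (fun ω => gradient F (w ω M)) μ ∧ ∫ ω, ‖gradient F (w ω M)‖ ∂μ ≤ ε) ∧
        (Integrable (fun ω => F (w ω M)) μ ∧ (∫ ω, F (w ω M) ∂μ) - infVal F ≤ v * ε ^ 2) ∧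
        ∀ ω, (restartEvals P f (fun _ => 0) G x0 (B ω) (fun m => (ζ m ω : ℕ)) T M : ℝ) ≤
          K * (v * ε⁻¹ ^ 2 * Real.log (1 / ε)) := by
  intro lf Lf lg Lg sg sg' α β Δ hlf hLf hlg hLg hsg hsg' hc
  have hβ := hc.be_pos
  set s := sigmaSq lf Lf lg sg sg' with hs_def
  have hs0 : 0 ≤ s := by rw [hs_def, sigmaSq]; positivity
  -- `θ ≤ 1 / 2` keeps the residual variance within half of `ε²`, and `θ² ≤ s` gives epochs of
  -- length at least one. The value for `s = 0` is immaterial, as a nonconstant objective forces `s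
  -- > 0`.
  obtain ⟨θ, hθ, hθ2, hθs⟩ : ∃ θ : ℝ, 0 < θ ∧ θ ≤ 1 / 2 ∧ (0 < s → θ ^ 2 ≤ s) := by
    rcases hs0.eq_or_lt with h | h
    · exact ⟨1 / 2, by norm_num, le_rfl, fun h' => absurd h' (h ▸ lt_irrefl _)⟩
    · refine ⟨min (1 / 2) (Real.sqrt s), lt_min (by norm_num) (Real.sqrt_pos.2 h),
        min_le_left _ _, fun _ => ?_⟩
      calc _ ≤ Real.sqrt s ^ 2 := pow_le_pow_left₀ (by positivity) (min_le_right _ _) 2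
        _ = s := Real.sq_sqrt hs0
  -- After `m` halvings the initial gap is at most `4 β ε²`; as `T β ≥ 2 v ≥ 16 β`, this adds at
  -- most `ε² / 2` to the squared gradient.
  obtain ⟨K₀, hK₀, hcount⟩ := exists_restart_count (max Δ 0 / (4 * β))
  refine ⟨2 / β, K₀ * (1 + (20 * (2 / β) + 6 / β) * (2 * s / θ ^ 2)), θ, by positivity,
    by positivity, hθ, by linarith, fun ε hε hε2 => ?_⟩
  obtain ⟨m, hm, hB⟩ := hcount ε hε hε2
  have hL : 0 < Real.log (1 / ε) := by
    refine Real.log_pos ?_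
    rw [lt_div_iff₀ hε]; linarith
  have hΔ0 : 0 ≤ max Δ 0 := le_max_right _ _
  have hΔm : max Δ 0 / 2 ^ m ≤ 4 * β * ε ^ 2 := by
    rw [div_le_iff₀ (by positivity)] at hB ⊢
    linarith
  have hεθ : 0 < θ * ε := by positivity
  have hεθ2 : (θ * ε) ^ 2 ≤ ε ^ 2 / 4 := by
    have := mul_le_mul_of_nonneg_right (pow_le_pow_left₀ hθ.le hθ2 2) (sq_nonneg ε)
    rw [mul_pow]
    linarith
  refine ⟨m + 1, by omega, hm.trans ?_, ?_⟩
  · refine mul_le_mul_of_nonneg_right (le_mul_of_one_le_right hK₀.le ?_) hL.le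
    exact le_add_of_nonneg_right (by positivity)
  intro d p Ξ _ D _ f G S v x0 lam T hT hs hvar hF hex hΔ hlam Ω _ μ _ ξ ζ hξ s' P B w F hS
  have hv := hF.pos
  have hmean := hs.meanMap hlg hvar.meas hvar.integrable
  have hvβ : 8 * β ≤ v := hF.eight_mul_le (hmean.differentiable_comp ())
    (hmean.lip_gradient_comp hlf hLf hlg ()) hβ (hc.smooth_le (LF_nonneg (lg := lg) hlf hLf hLg))
    hex
  have hlf0 : 0 < lf := by
    obtain ⟨x, -, hx⟩ := hex
    exact hs.lf_pos hlf hx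
  have hs1 : 0 < s := by
    rw [hs_def, sigmaSq]; positivity
  have hεs : (θ * ε) ^ 2 ≤ 2 * s := by
    have h1 := mul_le_mul (hθs hs1) (pow_le_one₀ hε.le (by linarith) : ε ^ 2 ≤ 1) (sq_nonneg ε) hs0
    rw [mul_pow]
    linarith
  have hτ : 1 ≤ onlTau s (θ * ε) := one_le_onlTau hεθ hεs
  have hT1 : 1 ≤ T := by
    rw [hT]; exact le_max_of_le_right hτ
  have hvT := two_mul_le_of_max_ceil hβ hT
  have hOB := hξ.outputBound_restart hlf hLf hlg hLg hc hT1 hεθ hεs hs hvar hF hlam x0 (B := B) rfl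
    (P := P) rfl hS
  have hlast := hOB m m.lt_succ_self
  have hV : 0 ≤ (θ * ε) ^ 2 / 2 := by positivity
  have hsq := integral_norm_sq_le_of_outputBound (fun _ => rfl) (hΔ.trans (le_max_left _ 0)) hΔ0
    hv.le hV hβ hT1 hvT hOB
  have hgap := gap_le_of_outputBound (fun _ => rfl) (hΔ.trans (le_max_left _ 0)) hΔ0
    hv.le hV hβ hT1 hvT hOB (m + 1) le_rfl
  refine ⟨hτ, ⟨hlast.int_grad, hlast.integral_norm_le hε.le (hsq.trans ?_)⟩,
    ⟨hlast.int_F, hgap.trans ?_⟩, fun ω => ?_⟩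
  · have h1 : 2 / (T * β) * (max Δ 0 / 2 ^ m) ≤ ε ^ 2 / 2 := by
      have hTβ : 0 < T * β := by linarith
      rw [div_mul_eq_mul_div, div_le_iff₀ hTβ]
      nlinarith [sq_nonneg ε, mul_le_mul_of_nonneg_right hvT (sq_nonneg ε),
        mul_le_mul_of_nonneg_right hvβ (sq_nonneg ε)]
    linarith
  · have h1 : max Δ 0 / 2 ^ (m + 1) = max Δ 0 / 2 ^ m / 2 := by rw [pow_succ, div_div]
    rw [h1]
    nlinarith [mul_le_mul_of_nonneg_left hεθ2 hv.le, mul_le_mul_of_nonneg_right hvβ (sq_nonneg ε)]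
  · have hq1 := one_le_of_sq_le hεθ hεs
    have hN : (⌈2 * s / (θ * ε) ^ 2⌉₊ : ℝ) ≤ 8 * (P.tau : ℝ) ^ 2 :=
      (ceil_le_two_mul hq1).trans (by
        have h1 := le_four_mul_sq_floor_sqrt hq1
        change _ ≤ 8 * (⌊Real.sqrt (2 * s / (θ * ε) ^ 2)⌋₊ : ℝ) ^ 2
        linarith)
    have h1 := restartEvals_le (P := P) (f := f) (r := fun _ => 0) (G := G) hτ hN x0
      (A := B ω) (fun k t => by
        simp only [B, sampleBatch, Multiset.card_map, Multiset.card_range]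
        rfl) (fun k => (ζ k ω : ℕ)) T (m + 1)
    have h2 := mul_le_mul hm (online_runCost_le hβ hvβ hT hεθ hεs) (by positivity)
      (mul_nonneg hK₀.le hL.le)
    refine h1.trans (h2.trans ?_)
    have h3 : 2 * s / (θ * ε) ^ 2 * v = 2 * s / θ ^ 2 * (v * ε⁻¹ ^ 2) := by
      rw [mul_pow, inv_pow]; ring
    rw [h3]
    have h4 : 0 ≤ K₀ * Real.log (1 / ε) * (v * ε⁻¹ ^ 2) := by positivity
    linarith

end MVRC

theorem theorem4 :
    -- Convergence of a single run, with one absolute constant.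
    (∃ C : ℝ, 0 < C ∧
      -- Finite-sum problem.
      (∀ (lf Lf lg Lg α β : ℝ), 0 ≤ lf → 0 ≤ Lf → 0 ≤ lg → 0 ≤ Lg →
        MVRC.StepCond α β lf Lf lg Lg →
        ∀ (d p n : ℕ) (f : MVRC.Vec p → ℝ) (G : Fin n → MVRC.Vec d → MVRC.Vec p)
          (S : Set (MVRC.Vec d)) (v : ℝ) (x0 : MVRC.Vec d) (lam : ℕ → ℝ) (T : ℕ), 1 ≤ n → 1 ≤ T →
        MVRC.IsSmooth f G lf Lf lg Lg →
        MVRC.GradDominantOn (MVRC.finObj f G) S v →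
        (∀ t, β ≤ lam t ∧ lam t ≤ (1 + α) * β) →
        ∀ (Ω : Type*) [MeasurableSpace Ω] (μ : Measure Ω) [IsProbabilityMeasure μ]
          (A : Unit → ℕ → Ω → Finset (Fin n)) (ζ : Unit → Ω → Fin T),
        MVRC.FinSampling μ (MVRC.finBatch n) A ζ →
        let P : MVRC.Params := MVRC.constParams (MVRC.finTau n) α β lam
        let z : Ω → ℕ → MVRC.Vec d := fun ω =>
          MVRC.zPoint P f (fun _ => 0) G x0 (fun t => (A () t ω).val)
        let F : MVRC.Vec d → ℝ := MVRC.finObj f G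
        (∀ t < T, ∀ᵐ ω ∂μ, z ω t ∈ S) →
        Integrable (fun ω => F (z ω (ζ () ω))) μ ∧
        (∫ ω, F (z ω (ζ () ω)) ∂μ) - MVRC.infVal F ≤
          C * (v * (α⁻¹ + 1) / (T * β) * (F x0 - MVRC.infVal F))) ∧
      -- Online problem.
      (∀ (lf Lf lg Lg sg sg' α β : ℝ), 0 ≤ lf → 0 ≤ Lf → 0 ≤ lg → 0 ≤ Lg → 0 < sg → 0 < sg' →
        MVRC.StepCond α β lf Lf lg Lg →
        ∀ (d p : ℕ) (Ξ : Type*) [MeasurableSpace Ξ] (D : Measure Ξ) [IsProbabilityMeasure D]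
          (f : MVRC.Vec p → ℝ) (G : Ξ → MVRC.Vec d → MVRC.Vec p)
          (S : Set (MVRC.Vec d)) (v : ℝ) (x0 : MVRC.Vec d) (lam : ℕ → ℝ) (T : ℕ) (ε : ℝ), 1 ≤ T →
        0 < ε → ε ^ 2 ≤ 2 * MVRC.sigmaSq lf Lf lg sg sg' →
        MVRC.IsSmooth f G lf Lf lg Lg →
        MVRC.BoundedVariance D G sg sg' →
        MVRC.GradDominantOn (MVRC.onlObj D f G) S v →
        (∀ t, β ≤ lam t ∧ lam t ≤ (1 + α) * β) →
        ∀ (Ω : Type*) [MeasurableSpace Ω] (μ : Measure Ω) [IsProbabilityMeasure μ]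
          (ξ : Unit → ℕ → ℕ → Ω → Ξ) (ζ : Unit → Ω → Fin T),
        MVRC.OnlSampling μ D ξ ζ →
        let s : ℝ := MVRC.sigmaSq lf Lf lg sg sg'
        let P : MVRC.Params := MVRC.constParams (MVRC.onlTau s ε) α β lam
        let z : Ω → ℕ → MVRC.Vec d := fun ω =>
          MVRC.zPoint P f (fun _ => 0) G x0
            (fun t => MVRC.sampleBatch (MVRC.onlBatch s ε t) (fun i => ξ () t i ω))
        let F : MVRC.Vec d → ℝ := MVRC.onlObj D f G
        (∀ t < T, ∀ᵐ ω ∂μ, z ω t ∈ S) →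
        Integrable (fun ω => F (z ω (ζ () ω))) μ ∧
        (∫ ω, F (z ω (ζ () ω)) ∂μ) - MVRC.infVal F ≤
          C * (v * (α⁻¹ + 1) * (ε ^ 2 + (F x0 - MVRC.infVal F) / (T * β))))) ∧
    -- Restarts, finite-sum problem: the constants `κ`, `K` and the number of runs `M` depend neither
    -- on the dimensions, nor on `n`, nor on `v`.
    (∀ (lf Lf lg Lg α β Δ : ℝ), 0 ≤ lf → 0 ≤ Lf → 0 ≤ lg → 0 ≤ Lg →
      MVRC.StepCond α β lf Lf lg Lg →
      ∃ κ K : ℝ, 0 < κ ∧ 0 < K ∧ ∀ ε : ℝ, 0 < ε → ε ≤ 1 / 2 →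
      ∃ M : ℕ, 1 ≤ M ∧ (M : ℝ) ≤ K * Real.log (1 / ε) ∧
        ∀ (d p n : ℕ) (f : MVRC.Vec p → ℝ) (G : Fin n → MVRC.Vec d → MVRC.Vec p)
          (S : Set (MVRC.Vec d)) (v : ℝ) (x0 : MVRC.Vec d) (lam : ℕ → ℝ) (T : ℕ), 1 ≤ n →
        T = max ⌈κ * v⌉₊ (MVRC.finTau n) →
        MVRC.IsSmooth f G lf Lf lg Lg →
        MVRC.GradDominantOn (MVRC.finObj f G) S v →
        MVRC.finObj f G x0 - MVRC.infVal (MVRC.finObj f G) ≤ Δ →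
        (∀ t, β ≤ lam t ∧ lam t ≤ (1 + α) * β) →
        ∀ (Ω : Type*) [MeasurableSpace Ω] (μ : Measure Ω) [IsProbabilityMeasure μ]
          (A : ℕ → ℕ → Ω → Finset (Fin n)) (ζ : ℕ → Ω → Fin T),
        MVRC.FinSampling μ (MVRC.finBatch n) A ζ →
        let P : MVRC.Params := MVRC.constParams (MVRC.finTau n) α β lam
        let B : Ω → ℕ → ℕ → Multiset (Fin n) := fun ω m t => (A m t ω).val
        let w : Ω → ℕ → MVRC.Vec d := fun ω =>
          MVRC.restartPoint P f (fun _ => 0) G x0 (B ω) (fun m => ζ m ω)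
        let F : MVRC.Vec d → ℝ := MVRC.finObj f G
        (∀ m < M, ∀ t < T, ∀ᵐ ω ∂μ, MVRC.zPoint P f (fun _ => 0) G (w ω m) (B ω m) t ∈ S) →
        (Integrable (fun ω => gradient F (w ω M)) μ ∧ ∫ ω, ‖gradient F (w ω M)‖ ∂μ ≤ ε) ∧
        (Integrable (fun ω => F (w ω M)) μ ∧ (∫ ω, F (w ω M) ∂μ) - MVRC.infVal F ≤ ε ^ 2) ∧
        ∀ ω, (MVRC.restartEvals P f (fun _ => 0) G x0 (B ω) (fun m => (ζ m ω : ℕ)) T M : ℝ) ≤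
          K * ((n + Real.sqrt n * v) * Real.log (1 / ε))) ∧
    -- Restarts, online problem: the batch sizes are those for the accuracy parameter `θ * ε`; the
    -- constants `κ`, `K`, `θ` and the number of runs `M` depend neither on the dimensions nor on `v`.
    (∀ (lf Lf lg Lg sg sg' α β Δ : ℝ), 0 ≤ lf → 0 ≤ Lf → 0 ≤ lg → 0 ≤ Lg → 0 < sg → 0 < sg' →
      MVRC.StepCond α β lf Lf lg Lg →
      ∃ κ K θ : ℝ, 0 < κ ∧ 0 < K ∧ 0 < θ ∧ θ ≤ 1 ∧ ∀ ε : ℝ, 0 < ε → ε ≤ 1 / 2 →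
      ∃ M : ℕ, 1 ≤ M ∧ (M : ℝ) ≤ K * Real.log (1 / ε) ∧
        ∀ (d p : ℕ) (Ξ : Type*) [MeasurableSpace Ξ] (D : Measure Ξ) [IsProbabilityMeasure D]
          (f : MVRC.Vec p → ℝ) (G : Ξ → MVRC.Vec d → MVRC.Vec p)
          (S : Set (MVRC.Vec d)) (v : ℝ) (x0 : MVRC.Vec d) (lam : ℕ → ℝ) (T : ℕ),
        T = max ⌈κ * v⌉₊ (MVRC.onlTau (MVRC.sigmaSq lf Lf lg sg sg') (θ * ε)) →
        MVRC.IsSmooth f G lf Lf lg Lg →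
        MVRC.BoundedVariance D G sg sg' →
        MVRC.GradDominantOn (MVRC.onlObj D f G) S v →
        (∃ x ∈ S, MVRC.infVal (MVRC.onlObj D f G) < MVRC.onlObj D f G x) →
        MVRC.onlObj D f G x0 - MVRC.infVal (MVRC.onlObj D f G) ≤ Δ →
        (∀ t, β ≤ lam t ∧ lam t ≤ (1 + α) * β) →
        ∀ (Ω : Type*) [MeasurableSpace Ω] (μ : Measure Ω) [IsProbabilityMeasure μ]
          (ξ : ℕ → ℕ → ℕ → Ω → Ξ) (ζ : ℕ → Ω → Fin T),
        MVRC.OnlSampling μ D ξ ζ →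
        let s : ℝ := MVRC.sigmaSq lf Lf lg sg sg'
        let P : MVRC.Params := MVRC.constParams (MVRC.onlTau s (θ * ε)) α β lam
        let B : Ω → ℕ → ℕ → Multiset Ξ := fun ω m t =>
          MVRC.sampleBatch (MVRC.onlBatch s (θ * ε) t) (fun i => ξ m t i ω)
        let w : Ω → ℕ → MVRC.Vec d := fun ω =>
          MVRC.restartPoint P f (fun _ => 0) G x0 (B ω) (fun m => ζ m ω)
        let F : MVRC.Vec d → ℝ := MVRC.onlObj D f G
        (∀ m < M, ∀ t < T, ∀ᵐ ω ∂μ, MVRC.zPoint P f (fun _ => 0) G (w ω m) (B ω m) t ∈ S) →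
        1 ≤ MVRC.onlTau s (θ * ε) ∧
        (Integrable (fun ω => gradient F (w ω M)) μ ∧ ∫ ω, ‖gradient F (w ω M)‖ ∂μ ≤ ε) ∧
        (Integrable (fun ω => F (w ω M)) μ ∧ (∫ ω, F (w ω M) ∂μ) - MVRC.infVal F ≤ v * ε ^ 2) ∧
        ∀ ω, (MVRC.restartEvals P f (fun _ => 0) G x0 (B ω) (fun m => (ζ m ω : ℕ)) T M : ℝ) ≤
          K * (v * ε⁻¹ ^ 2 * Real.log (1 / ε))) := by
  -- The absolute constant can be taken to be `1`.
  refine ⟨⟨1, one_pos, ?_, ?_⟩, MVRC.finite_sum_restart, MVRC.online_restart⟩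
  · intro lf Lf lg Lg α β hlf hLf hlg hLg hc d p n f G S v x0 lam T hn hT hs hF hlam Ω _ μ _ A ζ hA
      P z F hS
    rw [one_mul]
    exact MVRC.finite_sum_gap_le hA hlf hLf hlg hLg hc hn hT hs hF hlam x0 rfl hS
  · intro lf Lf lg Lg sg sg' α β hlf hLf hlg hLg hsg hsg' hc d p Ξ _ D _ f G S v x0 lam T ε hT hε
      hεs hs hv hF hlam Ω _ μ _ ξ ζ hξ s P z F hS
    rw [one_mul]
    exact MVRC.online_gap_le hξ hlf hLf hlg hLg hc hT hε hεs hs hv hF hlam x0 rfl hS
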